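/- Let $\mathcal{A}$ be an abelian category with a hereditary abelian model structure $\mathfrak{M}=(\mathcal{Q},\mathcal{W},\mathcal{R})$: a triple of classes of objects such that $\mathcal{W}$ has the 2 out of 3 property on short exact sequences, $(\mathcal{Q},\mathcal{W}\cap\mathcal{R})$ and $(\mathcal{Q}\cap\mathcal{W},\mathcal{R})$ are complete cotorsion pairs, and $\mathrm{Ext}^i_{\mathcal{A}}(X,Y)=0$ for all $i\ge 1$ whenever $X\in\mathcal{Q}$, $Y\in\mathcal{W}\cap\mathcal{R}$, or $X\in\mathcal{Q}\cap\mathcal{W}$, $Y\in\mathcal{R}$. Put $\omega=\mathcal{Q}\cap\mathcal{W}\cap\mathcal{R}$, and call two morphisms homotopic if their difference factors through an object of $\omega$. *Homotopy category.* A cofibrant replacement of $A$ is a short exact sequence $0\to K\to QA\to A\to 0$ with $QA\in\mathcal{Q}$, $K\in\mathcal{W}\cap\mathcal{R}$; a fibrant replacement is a short exact sequence $0\to A\to RA\to K\to 0$ with $RA\in\mathcal{R}$, $K\in\mathcal{Q}\cap\mathcal{W}$; and $RQA$ denotes a fibrant replacement of a cofibrant replacement. The category $\mathrm{Ho}(\mathfrak{M})$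 has the objects of $\mathcal{A}$, and $\mathrm{Ho}(\mathfrak{M})(A,B)$ is the group of homotopy classes of morphisms $RQA\to RQB$. *Suspension and loops.* $\Sigma X$ and $\Omega X$ are given by short exact sequences $0\to X\to V\to\Sigma X\to 0$ and $0\to\Omega X\to V'\to X\to 0$ with $V,V'\in\mathcal{W}$. They are functors on $\mathrm{Ho}(\mathfrak{M})$: a short exact sequence $0\to X\to V\to Y\to 0$ with $V\in\mathcal W$ has a bifibrant approximation $0\to RQX\to RQV\to RQY\to 0$ with $RQV\in\omega$, and one such approximation is fixed for each sequence used; for a morphism $(f,h,c)$ between two of them one puts $\Sigma[f]=[c]$, $\Omega[c]=[f]$ (taking the chosen sequences for $\Sigma$, respectively for $\Omega$). Put $\Omega^{-n}=\Sigma^n$ and $\Sigma^{-n}=\Omega^n$ for $n>0$. *Resolutions.* An $\mathfrak{M}$-resolution $W_A$ of $A$ is an exact complex $\cdots\to W_1\to W_0\to W_{-1}\to W_{-2}\to\cdots$ obtained by splicing an exact complex $\cdots\to W_1\to W_0\xrightarrow{\epsilon}A\to 0$ with all $W_n\in\mathcal{Q}\cap\mathcal{W}$ and $\ker\epsilon,\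 \ker(W_{n+1}\to W_n)\in\mathcal{R}$ $(n\geq 0)$, with an exact complex $0\to A\xrightarrow{\eta}W_{-1}\to W_{-2}\to\cdots$ with all $W_{-n}\in\mathcal{W}\cap\mathcal{R}$ and $\mathrm{coker}\,\eta,\ \mathrm{coker}(W_{-n}\to W_{-n-1})\in\mathcal{Q}$ $(n\geq 1)$. An $\mathfrak{M}$-coresolution $W^A$ is the same complex in cochain notation, $W^{n}=W_{-1-n}$, so that it arises from $\cdots\to W^{-1}\to A\to W^0\to\cdots$. Put $$\ell\mathrm{Ext}^n_{\mathfrak{M}}(A,B)=H^n[\mathrm{Hom}_{\mathcal{A}}(W_A,B)],\qquad r\mathrm{Ext}^n_{\mathfrak{M}}(A,B)=H^n[\mathrm{Hom}_{\mathcal{A}}(A,W^B)].$$ For $n\in\mathbb{Z}$, $\mathrm{Ext}^n_{\mathrm{Ho}(\mathfrak{M})}(A,B)$ is $\ell\mathrm{Ext}^n_{\mathfrak{M}}(RQA,RQB)$, or equivalently $r\mathrm{Ext}^n_{\mathfrak{M}}(RQA,RQB)$. Both are bifunctors $\mathrm{Ho}(\mathfrak{M})^{\mathrm{op}}\times\mathrm{Ho}(\mathfrak{M})\to\mathbf{Ab}$.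 **Theorem.** For all choices of the replacements, of the sequences defining $\Sigma$ and $\Omega$, and of the resolutions, and for every integer $n$, there are isomorphisms of abelian groups $$\mathrm{Ho}(\mathfrak{M})(\Omega^nA,B)\;\cong\;\ell\mathrm{Ext}^n_{\mathfrak{M}}(RQA,RQB)\;\cong\; r\mathrm{Ext}^n_{\mathfrak{M}}(RQA,RQB)\;\cong\;\mathrm{Ho}(\mathfrak{M})(A,\Sigma^nB)$$ natural in $A,B\in\mathrm{Ho}(\mathfrak{M})$; that is, $$\mathrm{Ho}(\mathfrak{M})(\Omega^nA,B)\cong\mathrm{Ext}^n_{\mathrm{Ho}(\mathfrak{M})}(A,B)\cong\mathrm{Ho}(\mathfrak{M})(A,\Sigma^nB).$$ Moreover, for all objects $A,B$, every cofibrant replacement $QA$ of $A$, every fibrant replacement $RB$ of $B$, every $\mathfrak{M}$-resolution $W_{QA}$ of $QA$ and every $\mathfrak{M}$-coresolution $W^{RB}$ of $RB$, there are isomorphisms of abelian groups $$\mathrm{Ho}(\mathfrak{M})(\Omega^nA,B)\cong H^n[\mathrm{Hom}_{\mathcal{A}}(W_{QA},RB)],\qquad \mathrm{Ho}(\mathfrak{M})(A,\Sigma^nB)\cong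 H^n[\mathrm{Hom}_{\mathcal{A}}(QA,W^{RB})].$$ -/

import Mathlib

open CategoryTheory Limits Opposite
open scoped ZeroObject

universe w v u

/-! ### Cohomology of complexes of morphisms -/

section Cohomology

variable {C : Type u} [Category.{v} C] [Abelian C]

/-- The complex `Hom(K, B)` of abelian groups, as a bifunctor. Its term `Hom(Kᵐ, B)` is placed in
degree `m`, and its differentials lower the degree. -/
noncomputable def homInto : (CochainComplex C ℤ)ᵒᵖ ⥤ C ⥤
    HomologicalComplex AddCommGrpCat.{v} (ComplexShape.up ℤ).symm where
  obj K :=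
    { obj B := ((preadditiveYoneda.obj B).mapHomologicalComplex _).obj
        ((HomologicalComplex.opFunctor C (ComplexShape.up ℤ)).obj K)
      map f := (NatTrans.mapHomologicalComplex (preadditiveYoneda.map f) _).app _
      map_id B := by
        rw [CategoryTheory.Functor.map_id, NatTrans.mapHomologicalComplex_id]; rfl
      map_comp f g := by
        rw [CategoryTheory.Functor.map_comp, NatTrans.mapHomologicalComplex_comp]; rfl }
  map φ :=
    { app B := ((preadditiveYoneda.obj B).mapHomologicalComplex _).map
        ((HomologicalComplex.opFunctor C (ComplexShape.up ℤ)).map φ)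
      naturality _ _ f := (NatTrans.naturality
        (NatTrans.mapHomologicalComplex (preadditiveYoneda.map f) _) _).symm }
  map_id K := by
    ext B : 2
    dsimp only
    rw [CategoryTheory.Functor.map_id, CategoryTheory.Functor.map_id]
    rfl
  map_comp φ ψ := by
    ext B : 2
    dsimp only
    rw [Functor.map_comp, Functor.map_comp]
    rfl

/-- The complex `Hom(A, K)` of abelian groups, as a bifunctor. -/
noncomputable def homFrom : Cᵒᵖ ⥤ CochainComplex C ℤ ⥤ CochainComplex AddCommGrpCat.{v} ℤ where
  obj A := (preadditiveCoyoneda.obj A).mapHomologicalComplex _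
  map f := NatTrans.mapHomologicalComplex (preadditiveCoyoneda.map f) _
  map_id A := by rw [CategoryTheory.Functor.map_id, NatTrans.mapHomologicalComplex_id]
  map_comp f g := by rw [CategoryTheory.Functor.map_comp, NatTrans.mapHomologicalComplex_comp]

/-- `Hⁿ Hom(W, B)` for a complex `W`, where `W` is given in cochain notation. In chain notation,
the term `Wₙ` is the one of cochain degree `-1-n`. -/
noncomputable def cohomologyInto (n : ℤ) : (CochainComplex C ℤ)ᵒᵖ ⥤ C ⥤ AddCommGrpCat.{v} :=
  homInto ⋙ (Functor.whiskeringRight _ _ _).obj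
    (HomologicalComplex.homologyFunctor AddCommGrpCat.{v} _ (-1 - n))

/-- `Hⁿ Hom(A, W)` for a cochain complex `W`. -/
noncomputable def cohomologyFrom (n : ℤ) : Cᵒᵖ ⥤ CochainComplex C ℤ ⥤ AddCommGrpCat.{v} :=
  homFrom ⋙ (Functor.whiskeringRight _ _ _).obj
    (HomologicalComplex.homologyFunctor AddCommGrpCat.{v} _ n)

lemma cohomologyInto_map_eq (n : ℤ) {K L : CochainComplex C ℤ} {φ ψ : K ⟶ L}
    (h : Homotopy φ ψ) : (cohomologyInto n).map φ.op = (cohomologyInto n).map ψ.op := by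
  ext B : 2
  exact ((preadditiveYoneda.obj B).mapHomotopy h.op).homologyMap_eq _

lemma cohomologyFrom_map_eq (n : ℤ) (A : Cᵒᵖ) {K L : CochainComplex C ℤ} {φ ψ : K ⟶ L}
    (h : Homotopy φ ψ) :
    ((cohomologyFrom n).obj A).map φ = ((cohomologyFrom n).obj A).map ψ :=
  ((preadditiveCoyoneda.obj A).mapHomotopy h).homologyMap_eq _

/-- `Hⁿ Hom(W, B)`, on the homotopy category of complexes. -/
noncomputable def cohomologyInto' (n : ℤ) :
    (HomotopyCategory C (ComplexShape.up ℤ))ᵒᵖ ⥤ C ⥤ AddCommGrpCat.{v} :=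
  Functor.leftOp (C := HomotopyCategory C (ComplexShape.up ℤ)) (CategoryTheory.Quotient.lift
    (_root_.homotopic C (ComplexShape.up ℤ)) (cohomologyInto n).rightOp
    (fun _ _ _ _ ⟨h⟩ => Quiver.Hom.unop_inj (cohomologyInto_map_eq n h)))

/-- `Hⁿ Hom(A, W)`, on the homotopy category of complexes. -/
noncomputable def cohomologyFrom' (n : ℤ) :
    HomotopyCategory C (ComplexShape.up ℤ) ⥤ Cᵒᵖ ⥤ AddCommGrpCat.{v} :=
  CategoryTheory.Quotient.lift (_root_.homotopic C (ComplexShape.up ℤ)) (cohomologyFrom n).flip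
    (fun _ _ _ _ ⟨h⟩ => by ext A : 2; exact cohomologyFrom_map_eq n A h)

end Cohomology

/-! ### Short exact sequences attached to exact sequences -/

section ExactAux

variable {C : Type u} [Category.{v} C] [Abelian C]

lemma shortExact_kernel {A B : C} (p : A ⟶ B) [Epi p] :
    (ShortComplex.mk (kernel.ι p) p (kernel.condition p)).ShortExact :=
  ShortComplex.ShortExact.mk' (ShortComplex.exact_kernel p) inferInstance inferInstance

lemma shortExact_cokernel {A B : C} (i : A ⟶ B) [Mono i] :
    (ShortComplex.mk i (cokernel.π i) (cokernel.condition i)).ShortExact :=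
  ShortComplex.ShortExact.mk' (ShortComplex.exact_cokernel i) inferInstance inferInstance

lemma shortExact_biprod (A B : C) :
    (ShortComplex.mk (biprod.inl : A ⟶ A ⊞ B) (biprod.snd : A ⊞ B ⟶ B) (by simp)).ShortExact :=
  (ShortComplex.Splitting.mk (S := ShortComplex.mk (biprod.inl : A ⟶ A ⊞ B) biprod.snd (by simp))
    biprod.fst biprod.inr (by simp) (by simp) (by simp [biprod.total])).shortExact

lemma shortExact_of_exact_kernel {S : ShortComplex C} (hS : S.Exact) :
    (ShortComplex.mk (kernel.ι S.f) (kernel.lift S.g S.f S.zero)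
      (by rw [← cancel_mono (kernel.ι S.g)]; simp)).ShortExact := by
  have : Epi (kernel.lift S.g S.f S.zero) := hS.epi_kernelLift
  refine ShortComplex.ShortExact.mk' ?_ inferInstance inferInstance
  rw [ShortComplex.exact_iff_exact_up_to_refinements]
  intro A x hx
  have hx' : x ≫ S.f = 0 := by
    have := congrArg (· ≫ kernel.ι S.g) hx
    simpa using this
  exact ⟨A, 𝟙 A, inferInstance, kernel.lift S.f x hx', by simp⟩

lemma shortExact_of_exact_cokernel {S : ShortComplex C} (hS : S.Exact) :
    (ShortComplex.mk (cokernel.desc S.f S.g S.zero) (cokernel.π S.g)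
      (by rw [← cancel_epi (cokernel.π S.f)]; simp)).ShortExact := by
  have : Mono (cokernel.desc S.f S.g S.zero) := hS.mono_cokernelDesc
  refine ShortComplex.ShortExact.mk' ?_ inferInstance inferInstance
  refine ShortComplex.exact_of_g_is_cokernel _ ?_
  have key : ∀ {A : C} (k : S.X₃ ⟶ A), cokernel.desc S.f S.g S.zero ≫ k = 0 → S.g ≫ k = 0 := by
    intro A k hk
    rw [← cokernel.π_desc S.f S.g S.zero, Category.assoc, hk, comp_zero]
  exact CokernelCofork.IsColimit.ofπ' _ _
    (fun {A} k hk => ⟨cokernel.desc S.g k (key k hk), cokernel.π_desc _ _ _⟩)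

end ExactAux

section SquareAux

variable {C : Type u} [Category.{v} C] [Abelian C]

lemma shortExact_of_isPullback {X₁ X₂ X₃ Y E : C} {f : X₁ ⟶ X₂} {g : X₂ ⟶ X₃} {w : f ≫ g = 0}
    (hS : (ShortComplex.mk f g w).ShortExact) {h : Y ⟶ X₃} {u : E ⟶ X₂} {p : E ⟶ Y}
    (sq : IsPullback u p g h) :
    ∃ (i : X₁ ⟶ E) (w' : i ≫ p = 0), i ≫ u = f ∧ (ShortComplex.mk i p w').ShortExact := by
  have : Mono f := hS.mono_f
  have : Epi g := hS.epi_g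
  have hp : Epi p := MorphismProperty.of_isPullback (P := MorphismProperty.epimorphisms C) sq
    (by assumption)
  let i : X₁ ⟶ E := sq.lift f 0 (by simp [w])
  have hi : i ≫ u = f := sq.lift_fst _ _ _
  have hi' : i ≫ p = 0 := sq.lift_snd _ _ _
  have : Mono i := by
    have : Mono (i ≫ u) := by rw [hi]; assumption
    exact mono_of_mono i u
  refine ⟨i, hi', hi, ShortComplex.ShortExact.mk' ?_ (by assumption) hp⟩
  rw [ShortComplex.exact_iff_exact_up_to_refinements]
  intro A x hx
  dsimp at x hx
  obtain ⟨A', π, hπ, y, hy⟩ := hS.exact.exact_up_to_refinements (x ≫ u)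
    (by dsimp; rw [Category.assoc, sq.w, reassoc_of% hx, zero_comp])
  dsimp at y hy
  refine ⟨A', π, hπ, y, sq.hom_ext ?_ ?_⟩
  · dsimp; rw [Category.assoc, Category.assoc, hi, ← hy]
  · dsimp; rw [Category.assoc, Category.assoc, hx, hi', comp_zero, comp_zero]

lemma shortExact_of_isPushout {X₁ X₂ X₃ Y E : C} {f : X₁ ⟶ X₂} {g : X₂ ⟶ X₃} {w : f ≫ g = 0}
    (hS : (ShortComplex.mk f g w).ShortExact) {h : X₁ ⟶ Y} {u : X₂ ⟶ E} {i : Y ⟶ E}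
    (sq : IsPushout f h u i) :
    ∃ (p : E ⟶ X₃) (w' : i ≫ p = 0), u ≫ p = g ∧ (ShortComplex.mk i p w').ShortExact := by
  have hop : (ShortComplex.mk g.op f.op (by rw [← op_comp, w, op_zero])).ShortExact := hS.op
  obtain ⟨p, w', hp, hE⟩ := shortExact_of_isPullback hop sq.op.flip
  refine ⟨p.unop, Quiver.Hom.op_inj (by simpa using w'), Quiver.Hom.op_inj (by simpa using hp), ?_⟩
  exact hE.unop

/-- In a morphism of short exact sequences `(α, β, γ)` with `α` and `β` epi and `γ` mono, the
kernels of `α` and `β` agree. -/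
lemma shortExact_kernel_of_map {X₁ X₂ X₃ Y₁ Y₂ Y₃ : C} {f : X₁ ⟶ X₂} {g : X₂ ⟶ X₃}
    {w : f ≫ g = 0} (hS : (ShortComplex.mk f g w).ShortExact) {f' : Y₁ ⟶ Y₂}
    {g' : Y₂ ⟶ Y₃} [Mono f']
    (α : X₁ ⟶ Y₁) (β : X₂ ⟶ Y₂) (γ : X₃ ⟶ Y₃) [Mono γ] [Epi β]
    (h₁ : f ≫ β = α ≫ f') (h₂ : g ≫ γ = β ≫ g') :
    ∃ (z : (kernel.ι α ≫ f) ≫ β = 0), (ShortComplex.mk (kernel.ι α ≫ f) β z).ShortExact := by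
  have : Mono f := hS.mono_f
  refine ⟨by rw [Category.assoc, h₁, kernel.condition_assoc, zero_comp],
    ShortComplex.ShortExact.mk' ?_ (by dsimp; infer_instance) (by assumption)⟩
  rw [ShortComplex.exact_iff_exact_up_to_refinements]
  intro A x hx
  dsimp at x hx
  obtain ⟨A', π, hπ, y, hy⟩ := hS.exact.exact_up_to_refinements x
    (by dsimp; rw [← cancel_mono γ, Category.assoc, h₂, reassoc_of% hx, zero_comp, zero_comp])
  dsimp at y hy
  have hy' : y ≫ α = 0 := by
    rw [← cancel_mono f', Category.assoc, ← h₁, ← reassoc_of% hy, hx, comp_zero, zero_comp]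
  exact ⟨A', π, hπ, kernel.lift α y hy', by simpa using hy⟩

/-- In a morphism of short exact sequences `(α, β, γ)` with `α` epi and `β`, `γ` mono, the
cokernels of `β` and `γ` agree. -/
lemma shortExact_cokernel_of_map {X₁ X₂ X₃ Y₁ Y₂ Y₃ : C} {f : X₁ ⟶ X₂} {g : X₂ ⟶ X₃}
    [Epi g] {f' : Y₁ ⟶ Y₂} {g' : Y₂ ⟶ Y₃}
    {w' : f' ≫ g' = 0} (hS : (ShortComplex.mk f' g' w').ShortExact)
    (α : X₁ ⟶ Y₁) (β : X₂ ⟶ Y₂) (γ : X₃ ⟶ Y₃) [Epi α] [Mono β]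
    (h₁ : f ≫ β = α ≫ f') (h₂ : g ≫ γ = β ≫ g') :
    ∃ (z : β ≫ g' ≫ cokernel.π γ = 0),
      (ShortComplex.mk β (g' ≫ cokernel.π γ) z).ShortExact := by
  have : Epi g' := hS.epi_g
  refine ⟨by rw [← reassoc_of% h₂, cokernel.condition, comp_zero],
    ShortComplex.ShortExact.mk' ?_ (by assumption) (by dsimp; infer_instance)⟩
  rw [ShortComplex.exact_iff_exact_up_to_refinements]
  intro A x hx
  dsimp at x hx
  obtain ⟨A₁, π₁, _, y, hy⟩ := (ShortComplex.exact_cokernel γ).exact_up_to_refinements (x ≫ g')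
    (by simpa using hx)
  dsimp at y hy
  obtain ⟨A₂, π₂, _, z, hz⟩ := surjective_up_to_refinements_of_epi g y
  obtain ⟨A₃, π₃, _, t, ht⟩ := hS.exact.exact_up_to_refinements (π₂ ≫ π₁ ≫ x - z ≫ β)
    (by
      dsimp
      rw [Preadditive.sub_comp, Category.assoc, Category.assoc, Category.assoc, hy, ← h₂,
        reassoc_of% hz, sub_self])
  dsimp at t ht
  obtain ⟨A₄, π₄, _, s, hs⟩ := surjective_up_to_refinements_of_epi α t
  refine ⟨A₄, π₄ ≫ π₃ ≫ π₂ ≫ π₁, inferInstance, s ≫ f + π₄ ≫ π₃ ≫ z, ?_⟩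
  simp only [Preadditive.add_comp, Category.assoc, h₁, ← reassoc_of% hs, ← ht]
  simp

end SquareAux

variable {C : Type u} [Category.{v} C] [Abelian C] [HasExt.{w} C]

/-! ### Cotorsion pairs and abelian model structures -/

/-- A *cotorsion pair*: `X` is the class of all `A` with `Ext¹(A, Y) = 0`, and `Y` is the class
of all `B` with `Ext¹(X, B) = 0`. -/
structure IsCotorsionPair (X Y : ObjectProperty C) : Prop where
  left_iff : ∀ A : C, X A ↔ ∀ B : C, Y B → ∀ e : Abelian.Ext.{w} A B 1, e = 0
  right_iff : ∀ B : C, Y B ↔ ∀ A : C, X A → ∀ e : Abelian.Ext.{w} A B 1, e = 0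

/-- A *complete* cotorsion pair: it has enough projectives (every `A` has a short exact sequence
`0 ⟶ K ⟶ E ⟶ A ⟶ 0` with `E ∈ X`, `K ∈ Y`) and enough injectives (every `A` has a short exact
sequence `0 ⟶ A ⟶ E ⟶ K ⟶ 0` with `E ∈ Y`, `K ∈ X`). -/
structure IsCompleteCotorsionPair (X Y : ObjectProperty C) : Prop extends
    IsCotorsionPair.{w} X Y where
  enough_proj : ∀ A : C, ∃ (E : C) (p : E ⟶ A), Epi p ∧ X E ∧ Y (kernel p)
  enough_inj : ∀ A : C, ∃ (E : C) (i : A ⟶ E), Mono i ∧ Y E ∧ X (cokernel i)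

/-- The pair `(X, Y)` is *hereditary*: `Extⁱ(A, B) = 0` for `A ∈ X`, `B ∈ Y` and all `i ≥ 1`. -/
def IsHereditaryPair (X Y : ObjectProperty C) : Prop :=
  ∀ A B : C, X A → Y B → ∀ i : ℕ, 1 ≤ i → ∀ e : Abelian.Ext.{w} A B i, e = 0

variable (C) in
/-- An *abelian model structure*, given by its Hovey triple `(Q, W, R)`: the class `W` has the
2 out of 3 property on short exact sequences, and `(Q, W ∩ R)`, `(Q ∩ W, R)` are complete
cotorsion pairs. -/
structure AbelianModelStructure where
  /-- the cofibrant objects -/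
  Q : ObjectProperty C
  /-- the trivial objects -/
  W : ObjectProperty C
  /-- the fibrant objects -/
  R : ObjectProperty C
  thick₁ : ∀ S : ShortComplex C, S.ShortExact → W S.X₂ → W S.X₃ → W S.X₁
  thick₂ : ∀ S : ShortComplex C, S.ShortExact → W S.X₁ → W S.X₃ → W S.X₂
  thick₃ : ∀ S : ShortComplex C, S.ShortExact → W S.X₁ → W S.X₂ → W S.X₃
  left_pair : IsCompleteCotorsionPair.{w} Q (W ⊓ R)
  right_pair : IsCompleteCotorsionPair.{w} (Q ⊓ W) R

section Lifting

lemma exists_lift_of_shortExact {S : ShortComplex C} (hS : S.ShortExact) {A : C}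
    (h : ∀ e : Abelian.Ext.{w} A S.X₁ 1, e = 0) (f : A ⟶ S.X₃) :
    ∃ g : A ⟶ S.X₂, g ≫ S.g = f := by
  obtain ⟨x, hx⟩ := Abelian.Ext.covariant_sequence_exact₃ A hS (Abelian.Ext.mk₀ f)
    (zero_add 1) (h _)
  obtain ⟨g, rfl⟩ := (Abelian.Ext.mk₀_bijective A S.X₂).2 x
  exact ⟨g, (Abelian.Ext.mk₀_bijective A S.X₃).1 (by simpa using hx)⟩

lemma exists_extend_of_shortExact {S : ShortComplex C} (hS : S.ShortExact) {B : C}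
    (h : ∀ e : Abelian.Ext.{w} S.X₃ B 1, e = 0) (f : S.X₁ ⟶ B) :
    ∃ g : S.X₂ ⟶ B, S.f ≫ g = f := by
  obtain ⟨x, hx⟩ := Abelian.Ext.contravariant_sequence_exact₁ hS B (Abelian.Ext.mk₀ f)
    (add_zero 1) (h _)
  obtain ⟨g, rfl⟩ := (Abelian.Ext.mk₀_bijective S.X₂ B).2 x
  exact ⟨g, (Abelian.Ext.mk₀_bijective S.X₁ B).1 (by simpa using hx)⟩

lemma exists_lift_of_exact {S : ShortComplex C} (hS : S.Exact) {A : C}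
    (h : ∀ e : Abelian.Ext.{w} A (kernel S.f) 1, e = 0) (f : A ⟶ S.X₂) (hf : f ≫ S.g = 0) :
    ∃ g : A ⟶ S.X₁, g ≫ S.f = f := by
  obtain ⟨g, hg⟩ := exists_lift_of_shortExact (shortExact_of_exact_kernel hS) h
    (kernel.lift S.g f hf)
  exact ⟨g, by simpa using congrArg (· ≫ kernel.ι S.g) hg⟩

lemma exists_extend_of_exact {S : ShortComplex C} (hS : S.Exact) {B : C}
    (h : ∀ e : Abelian.Ext.{w} (cokernel S.g) B 1, e = 0) (f : S.X₂ ⟶ B) (hf : S.f ≫ f = 0) :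
    ∃ g : S.X₃ ⟶ B, S.g ≫ g = f := by
  obtain ⟨g, hg⟩ := exists_extend_of_shortExact (shortExact_of_exact_cokernel hS) h
    (cokernel.desc S.f f hf)
  exact ⟨g, by simpa using congrArg (cokernel.π S.f ≫ ·) hg⟩

end Lifting

namespace IsCotorsionPair

variable {X Y : ObjectProperty C}

lemma ext_eq_zero (h : IsCotorsionPair.{w} X Y) {A B : C} (hA : X A) (hB : Y B)
    (e : Abelian.Ext.{w} A B 1) : e = 0 :=
  (h.left_iff A).1 hA B hB e

lemma left_of_iso (h : IsCotorsionPair.{w} X Y) {A A' : C} (i : A ≅ A') (hA : X A) : X A' := by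
  rw [h.left_iff]
  intro B hB e
  have : e = (Abelian.Ext.mk₀ i.inv).comp ((Abelian.Ext.mk₀ i.hom).comp e (zero_add 1))
    (zero_add 1) := by simp
  rw [this, h.ext_eq_zero hA hB ((Abelian.Ext.mk₀ i.hom).comp e (zero_add 1)),
    Abelian.Ext.comp_zero]

lemma right_of_iso (h : IsCotorsionPair.{w} X Y) {B B' : C} (i : B ≅ B') (hB : Y B) : Y B' := by
  rw [h.right_iff]
  intro A hA e
  have : e = (e.comp (Abelian.Ext.mk₀ i.inv) (add_zero 1)).comp (Abelian.Ext.mk₀ i.hom)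
    (add_zero 1) := by simp
  rw [this, h.ext_eq_zero hA hB (e.comp (Abelian.Ext.mk₀ i.inv) (add_zero 1)),
    Abelian.Ext.zero_comp]

lemma left_ext (h : IsCotorsionPair.{w} X Y) {S : ShortComplex C} (hS : S.ShortExact)
    (h₁ : X S.X₁) (h₃ : X S.X₃) : X S.X₂ := by
  rw [h.left_iff]
  intro B hB e
  obtain ⟨x, rfl⟩ := Abelian.Ext.contravariant_sequence_exact₂ hS B e (h.ext_eq_zero h₁ hB _)
  rw [h.ext_eq_zero h₃ hB x, Abelian.Ext.comp_zero]

lemma right_ext (h : IsCotorsionPair.{w} X Y) {S : ShortComplex C} (hS : S.ShortExact)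
    (h₁ : Y S.X₁) (h₃ : Y S.X₃) : Y S.X₂ := by
  rw [h.right_iff]
  intro A hA e
  obtain ⟨x, rfl⟩ := Abelian.Ext.covariant_sequence_exact₂ A hS e (h.ext_eq_zero hA h₃ _)
  rw [h.ext_eq_zero hA h₁ x, Abelian.Ext.zero_comp]

lemma left_of_isZero (h : IsCotorsionPair.{w} X Y) {A : C} (hA : IsZero A) : X A := by
  rw [h.left_iff]
  intro B hB e
  rw [← Abelian.Ext.mk₀_id_comp e, hA.eq_of_src (𝟙 A) 0, Abelian.Ext.mk₀_zero,
    Abelian.Ext.zero_comp]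

lemma right_of_isZero (h : IsCotorsionPair.{w} X Y) {B : C} (hB : IsZero B) : Y B := by
  rw [h.right_iff]
  intro A hA e
  rw [← Abelian.Ext.comp_mk₀_id e, hB.eq_of_src (𝟙 B) 0, Abelian.Ext.mk₀_zero,
    Abelian.Ext.comp_zero]

lemma left_kernel (h : IsCotorsionPair.{w} X Y) (hh : IsHereditaryPair.{w} X Y)
    {S : ShortComplex C} (hS : S.ShortExact) (h₂ : X S.X₂) (h₃ : X S.X₃) : X S.X₁ := by
  rw [h.left_iff]
  intro B hB e
  obtain ⟨x, rfl⟩ := Abelian.Ext.contravariant_sequence_exact₁ hS B e (n₁ := 2) (by norm_num)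
    (hh _ _ h₃ hB 2 (by norm_num) _)
  rw [h.ext_eq_zero h₂ hB x, Abelian.Ext.comp_zero]

lemma right_cokernel (h : IsCotorsionPair.{w} X Y) (hh : IsHereditaryPair.{w} X Y)
    {S : ShortComplex C} (hS : S.ShortExact) (h₁ : Y S.X₁) (h₂ : Y S.X₂) : Y S.X₃ := by
  rw [h.right_iff]
  intro A hA e
  obtain ⟨x, rfl⟩ := Abelian.Ext.covariant_sequence_exact₃ A hS e (n₁ := 2) (by norm_num)
    (hh _ _ hA h₁ 2 (by norm_num) _)
  rw [h.ext_eq_zero hA h₂ x, Abelian.Ext.zero_comp]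

end IsCotorsionPair

namespace AbelianModelStructure

variable (M : AbelianModelStructure.{w} C)

/-- The model structure is *hereditary*: both of its cotorsion pairs are hereditary. -/
structure IsHereditary : Prop where
  left : IsHereditaryPair.{w} M.Q (M.W ⊓ M.R)
  right : IsHereditaryPair.{w} (M.Q ⊓ M.W) M.R

/-- The core `ω = Q ∩ W ∩ R`. -/
def core : ObjectProperty C := M.Q ⊓ M.W ⊓ M.R

/-! ### The stable category and the homotopy category -/

/-- Two morphisms are *homotopic* if their difference factors through an object of the core. -/
def homotopic : HomRel C := fun A B f g =>
  ∃ (V : C) (a : A ⟶ V) (b : V ⟶ B), M.core V ∧ g - f = a ≫ b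

variable {M}

lemma core_biprod {A B : C} (hA : M.core A) (hB : M.core B) : M.core (A ⊞ B) :=
  ⟨⟨M.left_pair.left_ext (shortExact_biprod A B) hA.1.1 hB.1.1,
    M.thick₂ _ (shortExact_biprod A B) hA.1.2 hB.1.2⟩,
    M.right_pair.right_ext (shortExact_biprod A B) hA.2 hB.2⟩

lemma core_zero : M.core (0 : C) :=
  ⟨⟨M.left_pair.left_of_isZero (isZero_zero C),
    (M.left_pair.right_of_isZero (isZero_zero C)).1⟩, M.right_pair.right_of_isZero (isZero_zero C)⟩

lemma homotopic_add {A B : C} {f₁ f₂ g₁ g₂ : A ⟶ B} (h₁ : M.homotopic f₁ f₂)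
    (h₂ : M.homotopic g₁ g₂) : M.homotopic (f₁ + g₁) (f₂ + g₂) := by
  obtain ⟨V₁, a₁, b₁, hV₁, e₁⟩ := h₁
  obtain ⟨V₂, a₂, b₂, hV₂, e₂⟩ := h₂
  refine ⟨V₁ ⊞ V₂, biprod.lift a₁ a₂, biprod.desc b₁ b₂, core_biprod hV₁ hV₂, ?_⟩
  rw [biprod.lift_desc, ← e₁, ← e₂]
  abel

instance : Congruence M.homotopic where
  equivalence :=
    { refl := fun f => ⟨0, 0, 0, core_zero, by simp⟩
      symm := by
        rintro f g ⟨V, a, b, hV, e⟩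
        exact ⟨V, -a, b, hV, by rw [Preadditive.neg_comp, ← e, neg_sub]⟩
      trans := by
        intro f g h h₁ h₂
        obtain ⟨V, a, b, hV, e⟩ := homotopic_add h₁ h₂
        exact ⟨V, a, b, hV, by rw [← e]; abel⟩ }
  comp_left := by
    rintro A B D f g g' ⟨V, a, b, hV, e⟩
    exact ⟨V, f ≫ a, b, hV, by rw [← Preadditive.comp_sub, e, Category.assoc]⟩
  comp_right := by
    rintro A B D f g h ⟨V, a, b, hV, e⟩
    exact ⟨V, a, b ≫ h, hV, by rw [← Preadditive.sub_comp, e, Category.assoc]⟩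

lemma homotopic_of_sub {A B V : C} {f g : A ⟶ B} (a : A ⟶ V) (b : V ⟶ B) (hV : M.core V)
    (h : g - f = a ≫ b) : M.homotopic f g := ⟨V, a, b, hV, h⟩

variable (M)

/-- The *stable category* of the model structure: the objects of `C`, and homotopy classes of
morphisms. -/
abbrev Stable := Quotient M.homotopic

instance : Preadditive M.Stable :=
  Quotient.preadditive _ (fun _ _ _ _ _ _ h₁ h₂ => homotopic_add h₁ h₂)

/-- The quotient functor to the stable category. -/
abbrev toStable : C ⥤ M.Stable := Quotient.functor M.homotopic

instance : M.toStable.Additive := Quotient.functor_additive _ _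

/-- A *cofibrant replacement* of `A`: a short exact sequence `0 ⟶ K ⟶ QA ⟶ A ⟶ 0` with `QA`
cofibrant and `K` trivially fibrant. -/
structure CofibrantReplacement (A : C) where
  obj : C
  p : obj ⟶ A
  epi : Epi p
  cofibrant : M.Q obj
  ker : (M.W ⊓ M.R) (kernel p)

/-- A *fibrant replacement* of `A`: a short exact sequence `0 ⟶ A ⟶ RA ⟶ K ⟶ 0` with `RA`
fibrant and `K` trivially cofibrant. -/
structure FibrantReplacement (A : C) where
  obj : C
  j : A ⟶ obj
  mono : Mono j
  fibrant : M.R obj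
  coker : (M.Q ⊓ M.W) (cokernel j)

/-- A *bifibrant replacement* `RQA` of `A`: a fibrant replacement of a cofibrant replacement. -/
structure BifibrantReplacement (A : C) where
  cof : M.CofibrantReplacement A
  fib : M.FibrantReplacement cof.obj

attribute [instance] CofibrantReplacement.epi FibrantReplacement.mono

variable {M}

/-- The object `RQA`. -/
abbrev BifibrantReplacement.obj {A : C} (r : M.BifibrantReplacement A) : C := r.fib.obj

lemma BifibrantReplacement.cofibrant {A : C} (r : M.BifibrantReplacement A) : M.Q r.obj :=
  M.left_pair.left_ext (shortExact_cokernel r.fib.j) r.cof.cofibrant r.fib.coker.1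

lemma BifibrantReplacement.fibrant {A : C} (r : M.BifibrantReplacement A) : M.R r.obj :=
  r.fib.fibrant

/-- The homotopy category `Ho(M)`, with respect to chosen bifibrant replacements: its objects are
those of `C`, and the group of morphisms from `A` to `B` is the group of homotopy classes of
morphisms from `RQA` to `RQB`. -/
abbrev Ho (ρ : ∀ A : C, M.BifibrantReplacement A) :=
  InducedCategory M.Stable (fun A : C => M.toStable.obj (ρ A).obj)

/-- An object of `C`, viewed as an object of `Ho(M)`. -/
abbrev hoObj (ρ : ∀ A : C, M.BifibrantReplacement A) (A : C) : Ho ρ := A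

/-- The morphism of `Ho(M)` given by a morphism `RQA ⟶ RQB`. -/
def hoMk (ρ : ∀ A : C, M.BifibrantReplacement A) {A B : C} (f : (ρ A).obj ⟶ (ρ B).obj) :
    hoObj ρ A ⟶ hoObj ρ B :=
  InducedCategory.homMk (M.toStable.map f)

variable (M)

/-! ### Suspension and loop functors -/

/-- A short exact sequence `0 ⟶ X ⟶ V ⟶ Y ⟶ 0` with `V` trivial. It exhibits `Y` as a suspension
of `X`, and `X` as a loop object of `Y`. -/
structure TrivialSequence (X Y : C) where
  mid : C
  i : X ⟶ mid
  p : mid ⟶ Y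
  zero : i ≫ p = 0
  shortExact : (ShortComplex.mk i p zero).ShortExact
  trivial : M.W mid

variable {M}

/-- A bifibrant approximation of a short exact sequence `0 ⟶ X ⟶ V ⟶ Y ⟶ 0` with `V` trivial:
a commutative diagram of short exact sequences
```
0 ⟶ RQX ⟶ RQV ⟶ RQY ⟶ 0
     ↑      ↑      ↑
0 ⟶  QX ⟶  QV ⟶  QY ⟶ 0
     ↓      ↓      ↓
0 ⟶   X ⟶   V ⟶   Y ⟶ 0
```
whose outer columns are the chosen replacements, and with `RQV` in the core. -/
structure BifibrantApproximation (ρ : ∀ A : C, M.BifibrantReplacement A) {X Y : C}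
    (T : M.TrivialSequence X Y) where
  midQ : C
  iQ : (ρ X).cof.obj ⟶ midQ
  pQ : midQ ⟶ (ρ Y).cof.obj
  zeroQ : iQ ≫ pQ = 0
  shortExactQ : (ShortComplex.mk iQ pQ zeroQ).ShortExact
  down : midQ ⟶ T.mid
  comm_iQ : iQ ≫ down = (ρ X).cof.p ≫ T.i
  comm_pQ : pQ ≫ (ρ Y).cof.p = down ≫ T.p
  mid : C
  i : (ρ X).obj ⟶ mid
  p : mid ⟶ (ρ Y).obj
  zero : i ≫ p = 0
  shortExact : (ShortComplex.mk i p zero).ShortExact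
  up : midQ ⟶ mid
  comm_i : iQ ≫ up = (ρ X).fib.j ≫ i
  comm_p : pQ ≫ (ρ Y).fib.j = up ≫ p
  core : M.core mid

lemma exists_cofibrant_approximation (hM : M.IsHereditary) {X Y : C} (T : M.TrivialSequence X Y)
    (a : M.CofibrantReplacement X) (b : M.CofibrantReplacement Y) :
    ∃ (P : C) (i : a.obj ⟶ P) (p : P ⟶ b.obj) (z : i ≫ p = 0) (d : P ⟶ T.mid),
      (ShortComplex.mk i p z).ShortExact ∧ i ≫ d = a.p ≫ T.i ∧ p ≫ b.p = d ≫ T.p ∧ M.W P := by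
  have : Epi T.p := T.shortExact.epi_g
  have : Mono T.i := T.shortExact.mono_f
  have sqE := IsPullback.of_hasPullback T.p b.p
  obtain ⟨iE, wE, hiE, hE⟩ := shortExact_of_isPullback T.shortExact sqE
  obtain ⟨kE, vE, -, hE'⟩ := shortExact_of_isPullback (shortExact_kernel b.p) sqE.flip
  have : Mono iE := hE.mono_f
  have : Epi (pullback.snd T.p b.p) := hE.epi_g
  have hWE : M.W (pullback T.p b.p) := M.thick₂ _ hE' b.ker.1 T.trivial
  obtain ⟨F, r, _, hF, hkF⟩ := M.left_pair.enough_proj (pullback T.p b.p)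
  have hWF : M.W F := M.thick₂ _ (shortExact_kernel r) hkF.1 hWE
  have hK : M.Q (kernel (r ≫ pullback.snd T.p b.p)) :=
    M.left_pair.left_kernel hM.left (shortExact_kernel (r ≫ pullback.snd T.p b.p)) hF b.cofibrant
  obtain ⟨κ₀, hκ₀⟩ : ∃ κ₀, κ₀ ≫ iE = kernel.ι (r ≫ pullback.snd T.p b.p) ≫ r :=
    ⟨hE.exact.lift (kernel.ι (r ≫ pullback.snd T.p b.p) ≫ r)
      (by simp), hE.exact.lift_f _ _⟩
  obtain ⟨κ, hκ⟩ := exists_lift_of_shortExact (shortExact_kernel a.p)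
    (M.left_pair.ext_eq_zero hK a.ker) κ₀
  dsimp at κ hκ
  have sqP := IsPushout.of_hasPushout (kernel.ι (r ≫ pullback.snd T.p b.p)) κ
  obtain ⟨p, z, hp, hP⟩ := shortExact_of_isPushout
    (shortExact_kernel (r ≫ pullback.snd T.p b.p)) sqP
  obtain ⟨π, hπ₁, hπ₂⟩ : ∃ π : pushout (kernel.ι (r ≫ pullback.snd T.p b.p)) κ ⟶ pullback T.p b.p,
      pushout.inl _ _ ≫ π = r ∧ pushout.inr _ _ ≫ π = a.p ≫ iE :=
    ⟨sqP.desc r (a.p ≫ iE) (by rw [← hκ₀, ← hκ, Category.assoc]), sqP.inl_desc _ _ _,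
      sqP.inr_desc _ _ _⟩
  have hπ : π ≫ pullback.snd T.p b.p = p := by
    apply sqP.hom_ext
    · rw [reassoc_of% hπ₁, hp]
    · rw [reassoc_of% hπ₂, wE, comp_zero, z]
  have : Epi π := by
    have : Epi (pushout.inl (kernel.ι (r ≫ pullback.snd T.p b.p)) κ ≫ π) := by
      rw [hπ₁]; assumption
    exact epi_of_epi (pushout.inl _ _) π
  obtain ⟨z', h'⟩ := shortExact_kernel_of_map hP (f' := iE) (g' := pullback.snd T.p b.p) a.p π
    (𝟙 _) hπ₂ (by rw [hπ, Category.comp_id])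
  refine ⟨_, _, p, z, π ≫ pullback.fst _ _, hP, ?_, ?_, M.thick₂ _ h' a.ker.1 hWE⟩
  · rw [reassoc_of% hπ₂, hiE]
  · rw [← hπ, Category.assoc, Category.assoc, pullback.condition]

lemma exists_fibrant_approximation (hM : M.IsHereditary) {X P Y : C} {f : X ⟶ P} {g : P ⟶ Y}
    {w : f ≫ g = 0} (hS : (ShortComplex.mk f g w).ShortExact) (hP : M.W P)
    (a : M.FibrantReplacement X) (b : M.FibrantReplacement Y) :
    ∃ (V : C) (i : a.obj ⟶ V) (p : V ⟶ b.obj) (z : i ≫ p = 0) (d : P ⟶ V),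
      (ShortComplex.mk i p z).ShortExact ∧ f ≫ d = a.j ≫ i ∧ g ≫ b.j = d ≫ p ∧ M.W V := by
  have : Epi g := hS.epi_g
  have : Mono f := hS.mono_f
  have sqE := IsPushout.of_hasPushout f a.j
  obtain ⟨pE, wE, hpE, hE⟩ := shortExact_of_isPushout hS sqE
  obtain ⟨kE, vE, -, hE'⟩ := shortExact_of_isPushout (shortExact_cokernel a.j) sqE.flip
  have : Epi pE := hE.epi_g
  have : Mono (pushout.inr f a.j) := hE.mono_f
  have hWE : M.W (pushout f a.j) := M.thick₂ _ hE' hP a.coker.2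
  obtain ⟨F, r, _, hF, hkF⟩ := M.right_pair.enough_inj (pushout f a.j)
  have hK : M.R (cokernel (pushout.inr f a.j ≫ r)) :=
    M.right_pair.right_cokernel hM.right (shortExact_cokernel (pushout.inr f a.j ≫ r)) a.fibrant hF
  obtain ⟨κ₀, hκ₀⟩ : ∃ κ₀, pE ≫ κ₀ = r ≫ cokernel.π (pushout.inr f a.j ≫ r) :=
    ⟨hE.exact.desc (r ≫ cokernel.π (pushout.inr f a.j ≫ r))
      (by dsimp; rw [← Category.assoc]; exact cokernel.condition _), hE.exact.g_desc _ _⟩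
  obtain ⟨κ, hκ⟩ := exists_extend_of_shortExact (shortExact_cokernel b.j)
    (fun e => M.right_pair.ext_eq_zero b.coker hK e) κ₀
  dsimp at κ hκ
  have sqP := IsPullback.of_hasPullback (cokernel.π (pushout.inr f a.j ≫ r)) κ
  obtain ⟨i, z, hi, hV⟩ := shortExact_of_isPullback
    (shortExact_cokernel (pushout.inr f a.j ≫ r)) sqP
  obtain ⟨π, hπ₁, hπ₂⟩ : ∃ π : pushout f a.j ⟶ pullback (cokernel.π (pushout.inr f a.j ≫ r)) κ,
      π ≫ pullback.fst _ _ = r ∧ π ≫ pullback.snd _ _ = pE ≫ b.j :=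
    ⟨sqP.lift r (pE ≫ b.j) (by rw [← hκ₀, ← hκ, Category.assoc]), sqP.lift_fst _ _ _,
      sqP.lift_snd _ _ _⟩
  have hπ : pushout.inr f a.j ≫ π = i := by
    apply sqP.hom_ext
    · rw [Category.assoc, hπ₁, hi]
    · rw [Category.assoc, hπ₂, reassoc_of% wE, zero_comp, z]
  have : Mono π := by
    have : Mono (π ≫ pullback.fst (cokernel.π (pushout.inr f a.j ≫ r)) κ) := by
      rw [hπ₁]; assumption
    exact mono_of_mono π (pullback.fst _ _)
  obtain ⟨z', h'⟩ := shortExact_cokernel_of_map (f := pushout.inr f a.j) (g := pE) hV (𝟙 _) π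
    b.j (by rw [hπ, Category.id_comp]) hπ₂.symm
  refine ⟨_, i, _, z, pushout.inl _ _ ≫ π, hV, ?_, ?_, M.thick₂ _ h' hWE b.coker.2⟩
  · rw [← hπ, ← Category.assoc, ← Category.assoc, pushout.condition]
  · rw [Category.assoc, hπ₂, reassoc_of% hpE]

lemma BifibrantApproximation.nonempty (hM : M.IsHereditary)
    (ρ : ∀ A : C, M.BifibrantReplacement A) {X Y : C} (T : M.TrivialSequence X Y) :
    Nonempty (BifibrantApproximation ρ T) := by
  obtain ⟨P, i, p, z, d, hP, h₁, h₂, hW⟩ :=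
    exists_cofibrant_approximation hM T (ρ X).cof (ρ Y).cof
  obtain ⟨V, i', p', z', d', hV, h₁', h₂', hW'⟩ :=
    exists_fibrant_approximation hM hP hW (ρ X).fib (ρ Y).fib
  exact ⟨⟨P, i, p, z, hP, d, h₁, h₂, V, i', p', z', hV, d', h₁', h₂',
    ⟨⟨M.left_pair.left_ext hV (ρ X).cofibrant (ρ Y).cofibrant, hW'⟩,
      M.right_pair.right_ext hV (ρ X).fibrant (ρ Y).fibrant⟩⟩⟩

section HoBasic

variable {ρ : ∀ A : C, M.BifibrantReplacement A}

lemma hoMk_surjective {A B : C} (f : hoObj ρ A ⟶ hoObj ρ B) :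
    ∃ g : (ρ A).obj ⟶ (ρ B).obj, hoMk ρ g = f := by
  obtain ⟨g, hg⟩ := M.toStable.map_surjective f.hom
  exact ⟨g, InducedCategory.hom_ext hg⟩

lemma hoMk_eq_iff {A B : C} (f g : (ρ A).obj ⟶ (ρ B).obj) :
    hoMk ρ f = hoMk ρ g ↔ M.homotopic f g := by
  rw [← Quotient.functor_map_eq_iff M.homotopic]
  exact ⟨fun h => congrArg (fun φ : hoObj ρ A ⟶ hoObj ρ B => InducedCategory.Hom.hom φ) h,
    fun h => InducedCategory.hom_ext h⟩

lemma hoMk_id (A : C) : hoMk ρ (𝟙 (ρ A).obj) = 𝟙 (hoObj ρ A) :=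
  InducedCategory.hom_ext (M.toStable.map_id _)

lemma hoMk_comp {A B D : C} (f : (ρ A).obj ⟶ (ρ B).obj) (g : (ρ B).obj ⟶ (ρ D).obj) :
    hoMk ρ (f ≫ g) = hoMk ρ f ≫ hoMk ρ g :=
  InducedCategory.hom_ext (M.toStable.map_comp _ _)

end HoBasic

namespace BifibrantApproximation

variable {ρ : ∀ A : C, M.BifibrantReplacement A} {X Y X' Y' X'' Y'' : C}
  {T : M.TrivialSequence X Y} {T' : M.TrivialSequence X' Y'} {T'' : M.TrivialSequence X'' Y''}

/-- `f : RQX ⟶ RQX'` and `c : RQY ⟶ RQY'` are the outer components of a morphism between the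
bifibrant top rows of two approximations. -/
def Completes (P : BifibrantApproximation ρ T) (P' : BifibrantApproximation ρ T')
    (f : (ρ X).obj ⟶ (ρ X').obj) (c : (ρ Y).obj ⟶ (ρ Y').obj) : Prop :=
  ∃ h : P.mid ⟶ P'.mid, P.i ≫ h = f ≫ P'.i ∧ P.p ≫ c = h ≫ P'.p

lemma completes_id (P : BifibrantApproximation ρ T) : P.Completes P (𝟙 _) (𝟙 _) :=
  ⟨𝟙 _, by simp, by simp⟩

lemma Completes.comp {P : BifibrantApproximation ρ T} {P' : BifibrantApproximation ρ T'}
    {P'' : BifibrantApproximation ρ T''} {f : (ρ X).obj ⟶ (ρ X').obj}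
    {c : (ρ Y).obj ⟶ (ρ Y').obj} {f' : (ρ X').obj ⟶ (ρ X'').obj} {c' : (ρ Y').obj ⟶ (ρ Y'').obj}
    (h : P.Completes P' f c) (h' : P'.Completes P'' f' c') :
    P.Completes P'' (f ≫ f') (c ≫ c') := by
  obtain ⟨u, h₁, h₂⟩ := h
  obtain ⟨u', h₁', h₂'⟩ := h'
  exact ⟨u ≫ u', by rw [reassoc_of% h₁, h₁', Category.assoc],
    by rw [reassoc_of% h₂, h₂', Category.assoc]⟩

lemma exists_completes_right (P : BifibrantApproximation ρ T) (P' : BifibrantApproximation ρ T')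
    (f : (ρ X).obj ⟶ (ρ X').obj) : ∃ c, P.Completes P' f c := by
  obtain ⟨h, hh⟩ := exists_extend_of_shortExact P.shortExact
    (fun e => M.left_pair.ext_eq_zero (ρ Y).cofibrant ⟨P'.core.1.2, P'.core.2⟩ e) (f ≫ P'.i)
  dsimp at hh
  have : Epi P.p := P.shortExact.epi_g
  have hz : P.i ≫ h ≫ P'.p = 0 := by rw [reassoc_of% hh, P'.zero, comp_zero]
  exact ⟨P.shortExact.exact.desc (h ≫ P'.p) hz, h, hh,
    P.shortExact.exact.g_desc (h ≫ P'.p) hz⟩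

lemma exists_completes_left (P : BifibrantApproximation ρ T) (P' : BifibrantApproximation ρ T')
    (c : (ρ Y).obj ⟶ (ρ Y').obj) : ∃ f, P.Completes P' f c := by
  obtain ⟨h, hh⟩ := exists_lift_of_shortExact P'.shortExact
    (fun e => M.right_pair.ext_eq_zero P.core.1 (ρ X').fibrant e) (P.p ≫ c)
  dsimp at hh
  have : Mono P'.i := P'.shortExact.mono_f
  have hz : (P.i ≫ h) ≫ P'.p = 0 := by rw [Category.assoc, hh, reassoc_of% P.zero, zero_comp]
  exact ⟨P'.shortExact.exact.lift (P.i ≫ h) hz, h,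
    (P'.shortExact.exact.lift_f (P.i ≫ h) hz).symm, hh.symm⟩

lemma completes_right_unique {P : BifibrantApproximation ρ T} {P' : BifibrantApproximation ρ T'}
    {f f' : (ρ X).obj ⟶ (ρ X').obj} {c c' : (ρ Y).obj ⟶ (ρ Y').obj}
    (h : P.Completes P' f c) (h' : P.Completes P' f' c') (hf : M.homotopic f f') :
    M.homotopic c c' := by
  obtain ⟨u, h₁, h₂⟩ := h
  obtain ⟨u', h₁', h₂'⟩ := h'
  obtain ⟨V, a, b, hV, e⟩ := hf
  obtain ⟨a', ha'⟩ := exists_extend_of_shortExact P.shortExact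
    (fun e => M.left_pair.ext_eq_zero (ρ Y).cofibrant ⟨hV.1.2, hV.2⟩ e) a
  dsimp at a' ha'
  have : Epi P.p := P.shortExact.epi_g
  have hz : P.i ≫ (u' - u - a' ≫ b ≫ P'.i) = 0 := by
    rw [Preadditive.comp_sub, Preadditive.comp_sub, h₁, h₁', reassoc_of% ha',
      ← Preadditive.sub_comp, e, Category.assoc, sub_self]
  obtain ⟨t, ht⟩ : ∃ t : (ρ Y).obj ⟶ P'.mid, P.p ≫ t = u' - u - a' ≫ b ≫ P'.i :=
    ⟨P.shortExact.exact.desc _ hz, P.shortExact.exact.g_desc _ hz⟩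
  refine ⟨P'.mid, t, P'.p, P'.core, ?_⟩
  rw [← cancel_epi P.p, Preadditive.comp_sub, h₂, h₂', reassoc_of% ht]
  simp [Preadditive.sub_comp, P'.zero]

lemma completes_left_unique {P : BifibrantApproximation ρ T} {P' : BifibrantApproximation ρ T'}
    {f f' : (ρ X).obj ⟶ (ρ X').obj} {c c' : (ρ Y).obj ⟶ (ρ Y').obj}
    (h : P.Completes P' f c) (h' : P.Completes P' f' c') (hc : M.homotopic c c') :
    M.homotopic f f' := by
  obtain ⟨u, h₁, h₂⟩ := h
  obtain ⟨u', h₁', h₂'⟩ := h'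
  obtain ⟨V, a, b, hV, e⟩ := hc
  obtain ⟨b', hb'⟩ := exists_lift_of_shortExact P'.shortExact
    (fun e => M.right_pair.ext_eq_zero hV.1 (ρ X').fibrant e) b
  dsimp at b' hb'
  have : Mono P'.i := P'.shortExact.mono_f
  have hz : (u' - u - P.p ≫ a ≫ b') ≫ P'.p = 0 := by
    simp only [Preadditive.sub_comp, Category.assoc, hb', ← h₂, ← h₂', ← e, Preadditive.comp_sub]
    abel
  obtain ⟨t, ht⟩ : ∃ t : P.mid ⟶ (ρ X').obj, t ≫ P'.i = u' - u - P.p ≫ a ≫ b' :=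
    ⟨P'.shortExact.exact.lift _ hz, P'.shortExact.exact.lift_f _ hz⟩
  refine ⟨P.mid, P.i, t, P.core, ?_⟩
  rw [← cancel_mono P'.i, Preadditive.sub_comp, ← h₁, ← h₁', Category.assoc, ht]
  simp [Preadditive.comp_sub, reassoc_of% P.zero]

end BifibrantApproximation

section SuspensionLoop

variable (hM : M.IsHereditary) (ρ : ∀ A : C, M.BifibrantReplacement A)

/-- A chosen bifibrant approximation of `0 ⟶ X ⟶ V ⟶ Y ⟶ 0`. -/
noncomputable def approximation {X Y : C} (T : M.TrivialSequence X Y) :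
    BifibrantApproximation ρ T :=
  Classical.choice (BifibrantApproximation.nonempty hM ρ T)

variable {S : C → C} (s : ∀ X : C, M.TrivialSequence X (S X))

lemma exists_suspensionMap {X X' : C} (f : hoObj ρ X ⟶ hoObj ρ X') :
    ∃ c : hoObj ρ (S X) ⟶ hoObj ρ (S X'),
      ∃ (f₀ : (ρ X).obj ⟶ (ρ X').obj) (c₀ : (ρ (S X)).obj ⟶ (ρ (S X')).obj),
        hoMk ρ f₀ = f ∧ hoMk ρ c₀ = c ∧
          (approximation hM ρ (s X)).Completes (approximation hM ρ (s X')) f₀ c₀ := by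
  obtain ⟨f₀, rfl⟩ := hoMk_surjective f
  obtain ⟨c₀, h⟩ := BifibrantApproximation.exists_completes_right
    (approximation hM ρ (s X)) (approximation hM ρ (s X')) f₀
  exact ⟨_, f₀, c₀, rfl, rfl, h⟩

/-- The action of the suspension functor on morphisms: if `(f, h, c)` is a morphism between the
bifibrant approximations `0 ⟶ RQX ⟶ RQV ⟶ RQΣX ⟶ 0`, then `Σ[f] = [c]`. -/
noncomputable def suspensionMap {X X' : C} (f : hoObj ρ X ⟶ hoObj ρ X') :
    hoObj ρ (S X) ⟶ hoObj ρ (S X') :=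
  (exists_suspensionMap hM ρ s f).choose

lemma suspensionMap_eq {X X' : C} {f₀ : (ρ X).obj ⟶ (ρ X').obj}
    {c₀ : (ρ (S X)).obj ⟶ (ρ (S X')).obj}
    (h : (approximation hM ρ (s X)).Completes (approximation hM ρ (s X')) f₀ c₀) :
    suspensionMap hM ρ s (hoMk ρ f₀) = hoMk ρ c₀ := by
  obtain ⟨f₁, c₁, hf, hc, h'⟩ := (exists_suspensionMap hM ρ s (hoMk ρ f₀)).choose_spec
  rw [suspensionMap, ← hc, hoMk_eq_iff]
  exact BifibrantApproximation.completes_right_unique h' h ((hoMk_eq_iff _ _).1 hf)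

/-- The *suspension functor* `Σ` on `Ho(M)`, computed by means of chosen short exact sequences
`0 ⟶ X ⟶ V ⟶ ΣX ⟶ 0` with `V` trivial. -/
noncomputable def suspension : Ho ρ ⥤ Ho ρ where
  obj X := hoObj ρ (S X)
  map f := suspensionMap hM ρ s f
  map_id X := by
    have := suspensionMap_eq hM ρ s (approximation hM ρ (s X)).completes_id
    rw [hoMk_id, hoMk_id] at this
    exact this
  map_comp {X Y Z} f g := by
    obtain ⟨-, f₀, c₀, rfl, -, h⟩ := exists_suspensionMap hM ρ s f
    obtain ⟨-, g₀, d₀, rfl, -, h'⟩ := exists_suspensionMap hM ρ s g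
    rw [suspensionMap_eq hM ρ s h, suspensionMap_eq hM ρ s h', ← hoMk_comp, ← hoMk_comp,
      suspensionMap_eq hM ρ s (h.comp h')]

variable {Λ : C → C} (l : ∀ X : C, M.TrivialSequence (Λ X) X)

lemma exists_loopMap {X X' : C} (c : hoObj ρ X ⟶ hoObj ρ X') :
    ∃ f : hoObj ρ (Λ X) ⟶ hoObj ρ (Λ X'),
      ∃ (c₀ : (ρ X).obj ⟶ (ρ X').obj) (f₀ : (ρ (Λ X)).obj ⟶ (ρ (Λ X')).obj),
        hoMk ρ c₀ = c ∧ hoMk ρ f₀ = f ∧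
          (approximation hM ρ (l X)).Completes (approximation hM ρ (l X')) f₀ c₀ := by
  obtain ⟨c₀, rfl⟩ := hoMk_surjective c
  obtain ⟨f₀, h⟩ := BifibrantApproximation.exists_completes_left
    (approximation hM ρ (l X)) (approximation hM ρ (l X')) c₀
  exact ⟨_, c₀, f₀, rfl, rfl, h⟩

/-- The action of the loop functor on morphisms: if `(f, h, c)` is a morphism between the
bifibrant approximations `0 ⟶ RQΩX ⟶ RQV ⟶ RQX ⟶ 0`, then `Ω[c] = [f]`. -/
noncomputable def loopMap {X X' : C} (c : hoObj ρ X ⟶ hoObj ρ X') :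
    hoObj ρ (Λ X) ⟶ hoObj ρ (Λ X') :=
  (exists_loopMap hM ρ l c).choose

lemma loopMap_eq {X X' : C} {c₀ : (ρ X).obj ⟶ (ρ X').obj}
    {f₀ : (ρ (Λ X)).obj ⟶ (ρ (Λ X')).obj}
    (h : (approximation hM ρ (l X)).Completes (approximation hM ρ (l X')) f₀ c₀) :
    loopMap hM ρ l (hoMk ρ c₀) = hoMk ρ f₀ := by
  obtain ⟨c₁, f₁, hc, hf, h'⟩ := (exists_loopMap hM ρ l (hoMk ρ c₀)).choose_spec
  rw [loopMap, ← hf, hoMk_eq_iff]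
  exact BifibrantApproximation.completes_left_unique h' h ((hoMk_eq_iff _ _).1 hc)

/-- The *loop functor* `Ω` on `Ho(M)`, computed by means of chosen short exact sequences
`0 ⟶ ΩX ⟶ V ⟶ X ⟶ 0` with `V` trivial. -/
noncomputable def loop : Ho ρ ⥤ Ho ρ where
  obj X := hoObj ρ (Λ X)
  map f := loopMap hM ρ l f
  map_id X := by
    have := loopMap_eq hM ρ l (approximation hM ρ (l X)).completes_id
    rw [hoMk_id, hoMk_id] at this
    exact this
  map_comp {X Y Z} f g := by
    obtain ⟨-, f₀, c₀, rfl, -, h⟩ := exists_loopMap hM ρ l f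
    obtain ⟨-, g₀, d₀, rfl, -, h'⟩ := exists_loopMap hM ρ l g
    rw [loopMap_eq hM ρ l h, loopMap_eq hM ρ l h', ← hoMk_comp, ← hoMk_comp,
      loopMap_eq hM ρ l (h.comp h')]

/-- The `n`-fold iterate of an endofunctor. -/
def iterateFunctor {D : Type*} [Category* D] (F : D ⥤ D) : ℕ → (D ⥤ D)
  | 0 => 𝟭 D
  | n + 1 => iterateFunctor F n ⋙ F

/-- The functor `Ωⁿ` on `Ho(M)` for an integer `n`, with `Ω⁻ⁿ = Σⁿ`. -/
noncomputable def loopPow : ℤ → (Ho ρ ⥤ Ho ρ)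
  | .ofNat n => iterateFunctor (loop hM ρ l) n
  | .negSucc n => iterateFunctor (suspension hM ρ s) (n + 1)

/-- The functor `Σⁿ` on `Ho(M)` for an integer `n`, with `Σ⁻ⁿ = Ωⁿ`. -/
noncomputable def suspensionPow : ℤ → (Ho ρ ⥤ Ho ρ)
  | .ofNat n => iterateFunctor (suspension hM ρ s) n
  | .negSucc n => iterateFunctor (loop hM ρ l) (n + 1)

end SuspensionLoop

/-! ### Resolutions -/

variable (M) in
/-- An `M`-resolution of `A`, equivalently an `M`-coresolution of `A`: an exact complex
```
⋯ ⟶ K₂ ⟶ K₁ ⟶ K₀ ⟶ L⁰ ⟶ L¹ ⟶ L² ⟶ ⋯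
```
whose middle map is a composition `K₀ ⟶ A ⟶ L⁰`, where `⋯ ⟶ K₁ ⟶ K₀ ⟶ A ⟶ 0` is a resolution
by trivially cofibrant objects with fibrant kernels, and `0 ⟶ A ⟶ L⁰ ⟶ L¹ ⟶ ⋯` is a coresolution
by trivially fibrant objects with cofibrant cokernels. -/
structure Resolution (A : C) where
  K : ChainComplex C ℕ
  L : CochainComplex C ℕ
  ε : K.X 0 ⟶ A
  η : A ⟶ L.X 0
  epi : Epi ε
  mono : Mono η
  d_ε : K.d 1 0 ≫ ε = 0
  η_d : η ≫ L.d 0 1 = 0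
  exact_K_zero : (ShortComplex.mk (K.d 1 0) ε d_ε).Exact
  exact_K_succ (n : ℕ) :
    (ShortComplex.mk (K.d (n + 2) (n + 1)) (K.d (n + 1) n) (K.d_comp_d _ _ _)).Exact
  exact_L_zero : (ShortComplex.mk η (L.d 0 1) η_d).Exact
  exact_L_succ (n : ℕ) :
    (ShortComplex.mk (L.d n (n + 1)) (L.d (n + 1) (n + 2)) (L.d_comp_d _ _ _)).Exact
  triviallyCofibrant (n : ℕ) : (M.Q ⊓ M.W) (K.X n)
  fibrant_ker_ε : M.R (kernel ε)
  fibrant_ker_d (n : ℕ) : M.R (kernel (K.d (n + 1) n))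
  triviallyFibrant (n : ℕ) : (M.W ⊓ M.R) (L.X n)
  cofibrant_coker_η : M.Q (cokernel η)
  cofibrant_coker_d (n : ℕ) : M.Q (cokernel (L.d n (n + 1)))

namespace Resolution

attribute [instance] Resolution.epi Resolution.mono

/-- The data for connecting the two halves by means of `K₀ ⟶ A ⟶ L⁰`. -/
abbrev connectData {A : C} (r : M.Resolution A) : CochainComplex.ConnectData r.K r.L where
  d₀ := r.ε ≫ r.η
  comp_d₀ := by rw [← Category.assoc, r.d_ε, zero_comp]
  d₀_comp := by rw [Category.assoc, r.η_d, comp_zero]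

/-- The full complex in cochain notation: `Lⁿ` in degree `n` and `Kₙ` in degree `-1-n`, for
`n ≥ 0`. In chain notation, the term `Wₘ` is the term of cochain degree `-1-m`: thus `Wₙ = Kₙ`
and `W₋₁₋ₙ = Lⁿ`. -/
abbrev complex {A : C} (r : M.Resolution A) : CochainComplex C ℤ :=
  r.connectData.cochainComplex

variable {A B D : C}

/-- The component `Kₙ ⟶ K'ₙ` of a morphism of complexes. -/
def mapK {r : M.Resolution A} {r' : M.Resolution B} (φ : r.complex ⟶ r'.complex) (n : ℕ) :
    r.K.X n ⟶ r'.K.X n := φ.f (.negSucc n)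

/-- The component `Lⁿ ⟶ L'ⁿ` of a morphism of complexes. -/
def mapL {r : M.Resolution A} {r' : M.Resolution B} (φ : r.complex ⟶ r'.complex) (n : ℕ) :
    r.L.X n ⟶ r'.L.X n := φ.f (.ofNat n)

/-- A morphism of complexes extends `f : A ⟶ B`. -/
def Extends (r : M.Resolution A) (r' : M.Resolution B) (f : A ⟶ B)
    (φ : r.complex ⟶ r'.complex) : Prop :=
  mapK φ 0 ≫ r'.ε = r.ε ≫ f ∧ r.η ≫ mapL φ 0 = f ≫ r'.η

lemma extends_id (r : M.Resolution A) : Extends r r (𝟙 A) (𝟙 r.complex) :=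
  ⟨(Category.id_comp _).trans (Category.comp_id _).symm,
    (Category.comp_id _).trans (Category.id_comp _).symm⟩

lemma Extends.comp {r : M.Resolution A} {r' : M.Resolution B} {r'' : M.Resolution D}
    {f : A ⟶ B} {g : B ⟶ D} {φ : r.complex ⟶ r'.complex} {ψ : r'.complex ⟶ r''.complex}
    (h : Extends r r' f φ) (h' : Extends r' r'' g ψ) : Extends r r'' (f ≫ g) (φ ≫ ψ) := by
  obtain ⟨h₁, h₂⟩ := h
  obtain ⟨h₁', h₂'⟩ := h'
  have eK : mapK (φ ≫ ψ) 0 = mapK φ 0 ≫ mapK ψ 0 := rfl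
  have eL : mapL (φ ≫ ψ) 0 = mapL φ 0 ≫ mapL ψ 0 := rfl
  constructor
  · rw [eK, Category.assoc, h₁', reassoc_of% h₁]
  · rw [eL, reassoc_of% h₂, h₂', Category.assoc]

lemma Extends.sub {r : M.Resolution A} {r' : M.Resolution B}
    {f g : A ⟶ B} {φ ψ : r.complex ⟶ r'.complex}
    (h : Extends r r' f φ) (h' : Extends r r' g ψ) : Extends r r' (f - g) (φ - ψ) := by
  obtain ⟨h₁, h₂⟩ := h
  obtain ⟨h₁', h₂'⟩ := h'
  have eK : mapK (φ - ψ) 0 = mapK φ 0 - mapK ψ 0 := rfl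
  have eL : mapL (φ - ψ) 0 = mapL φ 0 - mapL ψ 0 := rfl
  constructor
  · rw [eK, Preadditive.sub_comp, h₁, h₁', Preadditive.comp_sub]
  · rw [eL, Preadditive.comp_sub, h₂, h₂', Preadditive.sub_comp]

lemma exists_sequence {P : ℕ → Type*} {p : ∀ n, P n → Prop} {q : ∀ n, P n → P (n + 1) → Prop}
    (x₀ : P 0) (h₀ : p 0 x₀) (step : ∀ n x, p n x → ∃ y, p (n + 1) y ∧ q n x y) :
    ∃ x : ∀ n, P n, x 0 = x₀ ∧ ∀ n, q n (x n) (x (n + 1)) := by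
  let x : ∀ n, {x : P n // p n x} := fun n =>
    Nat.rec ⟨x₀, h₀⟩ (fun n y => ⟨(step n y.1 y.2).choose, (step n y.1 y.2).choose_spec.1⟩) n
  exact ⟨fun n => (x n).1, rfl, fun n => (step n (x n).1 (x n).2).choose_spec.2⟩

section Lift

lemma lift_K_zero (r' : M.Resolution B) {Z : C} (hZ : (M.Q ⊓ M.W) Z) (g : Z ⟶ r'.K.X 0)
    (hg : g ≫ r'.ε = 0) : ∃ g' : Z ⟶ r'.K.X 1, g' ≫ r'.K.d 1 0 = g :=
  exists_lift_of_exact r'.exact_K_zero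
    (fun e => M.right_pair.ext_eq_zero hZ (r'.fibrant_ker_d 0) e) g hg

lemma lift_K_succ (r' : M.Resolution B) {Z : C} (hZ : (M.Q ⊓ M.W) Z) (n : ℕ)
    (g : Z ⟶ r'.K.X (n + 1)) (hg : g ≫ r'.K.d (n + 1) n = 0) :
    ∃ g' : Z ⟶ r'.K.X (n + 2), g' ≫ r'.K.d (n + 2) (n + 1) = g :=
  exists_lift_of_exact (r'.exact_K_succ n)
    (fun e => M.right_pair.ext_eq_zero hZ (r'.fibrant_ker_d (n + 1)) e) g hg

lemma extend_L_zero (r : M.Resolution A) {Z : C} (hZ : (M.W ⊓ M.R) Z) (g : r.L.X 0 ⟶ Z)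
    (hg : r.η ≫ g = 0) : ∃ g' : r.L.X 1 ⟶ Z, r.L.d 0 1 ≫ g' = g :=
  exists_extend_of_exact r.exact_L_zero
    (fun e => M.left_pair.ext_eq_zero (r.cofibrant_coker_d 0) hZ e) g hg

lemma extend_L_succ (r : M.Resolution A) {Z : C} (hZ : (M.W ⊓ M.R) Z) (n : ℕ)
    (g : r.L.X (n + 1) ⟶ Z) (hg : r.L.d n (n + 1) ≫ g = 0) :
    ∃ g' : r.L.X (n + 2) ⟶ Z, r.L.d (n + 1) (n + 2) ≫ g' = g :=
  exists_extend_of_exact (r.exact_L_succ n)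
    (fun e => M.left_pair.ext_eq_zero (r.cofibrant_coker_d (n + 1)) hZ e) g hg

end Lift

lemma exists_extension (r : M.Resolution A) (r' : M.Resolution B) (f : A ⟶ B) :
    ∃ φ : r.complex ⟶ r'.complex, Extends r r' f φ := by
  obtain ⟨k₀, hk₀⟩ := exists_lift_of_shortExact (shortExact_kernel r'.ε)
    (fun e => M.right_pair.ext_eq_zero (r.triviallyCofibrant 0) r'.fibrant_ker_ε e) (r.ε ≫ f)
  obtain ⟨l₀, hl₀⟩ := exists_extend_of_shortExact (shortExact_cokernel r.η)
    (fun e => M.left_pair.ext_eq_zero r.cofibrant_coker_η (r'.triviallyFibrant 0) e) (f ≫ r'.η)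
  dsimp at k₀ hk₀ l₀ hl₀
  obtain ⟨k, rfl, hk⟩ := exists_sequence (P := fun n => r.K.X n ⟶ r'.K.X n)
    (p := fun n x => ∃ y : r.K.X (n + 1) ⟶ r'.K.X (n + 1),
      y ≫ r'.K.d (n + 1) n = r.K.d (n + 1) n ≫ x)
    (q := fun n x y => y ≫ r'.K.d (n + 1) n = r.K.d (n + 1) n ≫ x) k₀
    (lift_K_zero r' (r.triviallyCofibrant 1) _ (by
      rw [Category.assoc, hk₀, reassoc_of% r.d_ε, zero_comp]))
    (fun n x ⟨y, hy⟩ => ⟨y, lift_K_succ r' (r.triviallyCofibrant (n + 2)) n _ (by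
      rw [Category.assoc, hy, r.K.d_comp_d_assoc, zero_comp]), hy⟩)
  obtain ⟨l, rfl, hl⟩ := exists_sequence (P := fun n => r.L.X n ⟶ r'.L.X n)
    (p := fun n x => ∃ y : r.L.X (n + 1) ⟶ r'.L.X (n + 1),
      r.L.d n (n + 1) ≫ y = x ≫ r'.L.d n (n + 1))
    (q := fun n x y => r.L.d n (n + 1) ≫ y = x ≫ r'.L.d n (n + 1)) l₀
    (extend_L_zero r (r'.triviallyFibrant 1) _ (by
      rw [reassoc_of% hl₀, r'.η_d, comp_zero]))
    (fun n x ⟨y, hy⟩ => ⟨y, extend_L_succ r (r'.triviallyFibrant (n + 2)) n _ (by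
      rw [reassoc_of% hy, r'.L.d_comp_d, comp_zero]), hy⟩)
  let fK : r.K ⟶ r'.K := { f := k, comm' := by rintro _ n rfl; exact hk n }
  let fL : r.L ⟶ r'.L := { f := l, comm' := by rintro n _ rfl; exact (hl n).symm }
  exact ⟨CochainComplex.ConnectData.map _ _ fK fL (by
    change k 0 ≫ r'.ε ≫ r'.η = (r.ε ≫ r.η) ≫ l 0
    rw [reassoc_of% hk₀, Category.assoc, hl₀]), hk₀, hl₀⟩

lemma nonempty_homotopy_zero {r : M.Resolution A} {r' : M.Resolution B} {f : A ⟶ B}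
    {φ : r.complex ⟶ r'.complex} (h : Extends r r' f φ) {V : C} (hV : M.core V) (a : A ⟶ V)
    (b : V ⟶ B) (hf : f = a ≫ b) : Nonempty (Homotopy φ 0) := by
  have hK : ∀ n, mapK φ (n + 1) ≫ r'.K.d (n + 1) n = r.K.d (n + 1) n ≫ mapK φ n := fun n => by
    have := φ.comm (.negSucc (n + 1)) (.negSucc n)
    simp only [CochainComplex.ConnectData.cochainComplex_d,
      CochainComplex.ConnectData.d_negSucc] at this
    exact this
  have hL : ∀ n, mapL φ n ≫ r'.L.d n (n + 1) = r.L.d n (n + 1) ≫ mapL φ (n + 1) := fun n =>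
    φ.comm (.ofNat n) (.ofNat (n + 1))
  have hε : mapK φ 0 ≫ r'.ε = r.ε ≫ f := h.1
  have hη : r.η ≫ mapL φ 0 = f ≫ r'.η := h.2
  obtain ⟨s, hs⟩ := exists_lift_of_shortExact (shortExact_kernel r'.ε)
    (fun e => M.right_pair.ext_eq_zero hV.1 r'.fibrant_ker_ε e) b
  obtain ⟨t, ht⟩ := exists_extend_of_shortExact (shortExact_cokernel r.η)
    (fun e => M.left_pair.ext_eq_zero r.cofibrant_coker_η ⟨hV.1.2, hV.2⟩ e) a
  dsimp at s hs t ht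
  obtain ⟨k₀, hk₀⟩ := lift_K_zero r' (r.triviallyCofibrant 0) (mapK φ 0 - r.ε ≫ a ≫ s) (by
    rw [Preadditive.sub_comp, hε, Category.assoc, Category.assoc, hs, hf, sub_self])
  obtain ⟨l₀, hl₀⟩ := extend_L_zero r (r'.triviallyFibrant 0) (mapL φ 0 - t ≫ b ≫ r'.η) (by
    rw [Preadditive.comp_sub, hη, reassoc_of% ht, hf, Category.assoc, sub_self])
  obtain ⟨k, rfl, hk⟩ := exists_sequence (P := fun n => r.K.X n ⟶ r'.K.X (n + 1))
    (p := fun n x => ∃ y : r.K.X (n + 1) ⟶ r'.K.X (n + 2),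
      y ≫ r'.K.d (n + 2) (n + 1) = mapK φ (n + 1) - r.K.d (n + 1) n ≫ x)
    (q := fun n x y => y ≫ r'.K.d (n + 2) (n + 1) = mapK φ (n + 1) - r.K.d (n + 1) n ≫ x) k₀
    (lift_K_succ r' (r.triviallyCofibrant 1) 0 _ (by
      rw [Preadditive.sub_comp, hK, Category.assoc, hk₀, Preadditive.comp_sub,
        reassoc_of% r.d_ε, zero_comp, sub_zero, sub_self]))
    (fun n x ⟨y, hy⟩ => ⟨y, lift_K_succ r' (r.triviallyCofibrant (n + 2)) (n + 1) _ (by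
      rw [Preadditive.sub_comp, hK, Category.assoc, hy, Preadditive.comp_sub,
        r.K.d_comp_d_assoc, zero_comp, sub_zero, sub_self]), hy⟩)
  obtain ⟨l, rfl, hl⟩ := exists_sequence (P := fun n => r.L.X (n + 1) ⟶ r'.L.X n)
    (p := fun n x => ∃ y : r.L.X (n + 2) ⟶ r'.L.X (n + 1),
      r.L.d (n + 1) (n + 2) ≫ y = mapL φ (n + 1) - x ≫ r'.L.d n (n + 1))
    (q := fun n x y => r.L.d (n + 1) (n + 2) ≫ y = mapL φ (n + 1) - x ≫ r'.L.d n (n + 1)) l₀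
    (extend_L_succ r (r'.triviallyFibrant 1) 0 _ (by
      rw [Preadditive.comp_sub, ← hL, reassoc_of% hl₀, Preadditive.sub_comp, Category.assoc,
        Category.assoc, r'.η_d, comp_zero, comp_zero, sub_zero, sub_self]))
    (fun n x ⟨y, hy⟩ => ⟨y, extend_L_succ r (r'.triviallyFibrant (n + 2)) (n + 1) _ (by
      rw [Preadditive.comp_sub, ← hL, reassoc_of% hy, Preadditive.sub_comp, Category.assoc,
        r'.L.d_comp_d, comp_zero, sub_zero, sub_self]), hy⟩)
  obtain ⟨sK, hsK⟩ : ∃ sK : ∀ i j, r.K.X i ⟶ r'.K.X j, (∀ i, sK i (i + 1) = k i) ∧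
      ∀ i j, i + 1 ≠ j → sK i j = 0 :=
    ⟨fun i j => if hij : i + 1 = j then k i ≫ eqToHom (congrArg r'.K.X hij) else 0,
      fun i => by simp, fun i j hij => by simp [hij]⟩
  obtain ⟨sL, hsL⟩ : ∃ sL : ∀ i j, r.L.X i ⟶ r'.L.X j, (∀ j, sL (j + 1) j = l j) ∧
      ∀ i j, j + 1 ≠ i → sL i j = 0 :=
    ⟨fun i j => if hij : j + 1 = i then eqToHom (congrArg r.L.X hij.symm) ≫ l j else 0,
      fun i => by simp, fun i j hij => by simp [hij]⟩
  let hom : ∀ i j : ℤ, r.complex.X i ⟶ r'.complex.X j := fun i j =>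
    match i, j with
    | .negSucc i, .negSucc j => sK i j
    | .ofNat i, .ofNat j => sL i j
    | .ofNat 0, .negSucc 0 => t ≫ s
    | .ofNat _, .negSucc _ => 0
    | .negSucc _, .ofNat _ => 0
  refine ⟨⟨hom, ?_, ?_⟩⟩
  · rintro (i | i) (j | j) hij
    · exact hsL.2 i j (fun h => hij (by simp [← h]))
    · obtain _ | i := i
      · obtain _ | j := j
        · exact absurd rfl hij
        · rfl
      · obtain _ | j := j <;> rfl
    · rfl
    · exact hsK.2 i j (fun h => hij (by simp [← h]; omega))
  · have e : ∀ x y z : ℤ, x + 1 = y → y + 1 = z →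
        φ.f y = r.complex.d y z ≫ hom z y + hom y x ≫ r'.complex.d x y →
        φ.f y = dNext y hom + prevD y hom + (0 : r.complex ⟶ r'.complex).f y := by
      intro x y z hx hz h
      rw [dNext_eq hom (show (ComplexShape.up ℤ).Rel y z from hz),
        prevD_eq hom (show (ComplexShape.up ℤ).Rel x y from hx), h]
      simp
    rintro ((_ | n) | (_ | n))
    · refine e (.negSucc 0) (.ofNat 0) (.ofNat 1) rfl rfl ?_
      change mapL φ 0 = r.L.d 0 1 ≫ sL 1 0 + (t ≫ s) ≫ r'.ε ≫ r'.η
      rw [hsL.1, hl₀, Category.assoc, reassoc_of% hs, sub_add_cancel]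
    · refine e (.ofNat n) (.ofNat (n + 1)) (.ofNat (n + 2)) rfl rfl ?_
      change mapL φ (n + 1) = r.L.d (n + 1) (n + 2) ≫ sL (n + 2) (n + 1) +
        sL (n + 1) n ≫ r'.L.d n (n + 1)
      rw [hsL.1, hsL.1, hl, sub_add_cancel]
    · refine e (.negSucc 1) (.negSucc 0) (.ofNat 0) rfl rfl ?_
      change mapK φ 0 = (r.ε ≫ r.η) ≫ (t ≫ s) + sK 0 1 ≫ r'.K.d 1 0
      rw [hsK.1, hk₀, Category.assoc, reassoc_of% ht, add_sub_cancel]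
    · refine e (.negSucc (n + 2)) (.negSucc (n + 1)) (.negSucc n) (by omega) (by omega) ?_
      have h₁ : r.complex.d (.negSucc (n + 1)) (.negSucc n) = r.K.d (n + 1) n :=
        r.connectData.d_negSucc (n + 1) n
      have h₂ : r'.complex.d (.negSucc (n + 2)) (.negSucc (n + 1)) = r'.K.d (n + 2) (n + 1) :=
        r'.connectData.d_negSucc (n + 2) (n + 1)
      rw [h₁, h₂]
      change mapK φ (n + 1) = r.K.d (n + 1) n ≫ sK n (n + 1) +
        sK (n + 1) (n + 2) ≫ r'.K.d (n + 2) (n + 1)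
      rw [hsK.1, hsK.1, hk, add_sub_cancel]

end Resolution

/-! ### The resolution functor -/

section ResolutionFunctor

variable (res : ∀ A : C, M.Resolution A)

/-- A chosen morphism of complexes extending a morphism of objects. -/
noncomputable def extension {A B : C} (f : A ⟶ B) : (res A).complex ⟶ (res B).complex :=
  (Resolution.exists_extension (res A) (res B) f).choose

lemma extends_extension {A B : C} (f : A ⟶ B) :
    Resolution.Extends (res A) (res B) f (extension res f) :=
  (Resolution.exists_extension (res A) (res B) f).choose_spec

lemma quotient_map_eq_of_homotopic {A B : C} {r : M.Resolution A} {r' : M.Resolution B}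
    {f g : A ⟶ B} {φ ψ : r.complex ⟶ r'.complex} (hφ : Resolution.Extends r r' f φ)
    (hψ : Resolution.Extends r r' g ψ) (h : M.homotopic f g) :
    (HomotopyCategory.quotient C (ComplexShape.up ℤ)).map φ =
      (HomotopyCategory.quotient C (ComplexShape.up ℤ)).map ψ := by
  obtain ⟨V, a, b, hV, e⟩ := h
  obtain ⟨H⟩ := Resolution.nonempty_homotopy_zero (hψ.sub hφ) hV a b e
  have := HomotopyCategory.eq_of_homotopy _ _ H
  rw [Functor.map_sub, Functor.map_zero, sub_eq_zero] at this
  exact this.symm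

lemma homotopic_refl {A B : C} (f : A ⟶ B) : M.homotopic f f :=
  homotopic_of_sub 0 0 core_zero (by simp)

/-- Chosen resolutions define a functor from `C` to its homotopy category of complexes. A morphism
is sent to the class of any morphism of complexes that extends it. -/
noncomputable def resolutionFunctor : C ⥤ HomotopyCategory C (ComplexShape.up ℤ) where
  obj A := (HomotopyCategory.quotient C (ComplexShape.up ℤ)).obj (res A).complex
  map f := (HomotopyCategory.quotient C (ComplexShape.up ℤ)).map (extension res f)
  map_id A := by
    rw [← CategoryTheory.Functor.map_id]
    exact quotient_map_eq_of_homotopic (extends_extension res _) (Resolution.extends_id _)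
      (homotopic_refl _)
  map_comp f g := by
    rw [← Functor.map_comp]
    exact quotient_map_eq_of_homotopic (extends_extension res _)
      ((extends_extension res f).comp (extends_extension res g)) (homotopic_refl _)

/-- The descent of the resolution functor to the stable category. -/
noncomputable def stableResolutionFunctor :
    M.Stable ⥤ HomotopyCategory C (ComplexShape.up ℤ) :=
  CategoryTheory.Quotient.lift _ (resolutionFunctor res) (fun _ _ _ _ h =>
    quotient_map_eq_of_homotopic (extends_extension res _) (extends_extension res _) h)

/-- The functor from `Ho(M)` to the homotopy category of complexes that sends `A` to the
resolution of `RQA`. -/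
noncomputable def hoResolutionFunctor (ρ : ∀ A : C, M.BifibrantReplacement A) :
    Ho ρ ⥤ HomotopyCategory C (ComplexShape.up ℤ) :=
  inducedFunctor _ ⋙ stableResolutionFunctor res

end ResolutionFunctor

/-! ### Vanishing on the core -/

namespace Resolution

variable {A B : C}

lemma cofibrant_coker_K (hM : M.IsHereditary) (r : M.Resolution A) (hA : M.Q A) (n : ℕ) :
    M.Q (cokernel (r.K.d (n + 1) n)) := by
  induction n with
  | zero =>
    exact M.left_pair.left_of_iso
      (IsColimit.coconePointUniqueUpToIso r.exact_K_zero.gIsCokernel (colimit.isColimit _)) hA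
  | succ n ih =>
    exact M.left_pair.left_kernel hM.left (shortExact_of_exact_cokernel (r.exact_K_succ n))
      (r.triviallyCofibrant n).1 ih

lemma fibrant_ker_L (hM : M.IsHereditary) (r : M.Resolution B) (hB : M.R B) (n : ℕ) :
    M.R (kernel (r.L.d n (n + 1))) := by
  induction n with
  | zero =>
    exact M.right_pair.right_of_iso
      (IsLimit.conePointUniqueUpToIso r.exact_L_zero.fIsKernel (limit.isLimit _)) hB
  | succ n ih =>
    exact M.right_pair.right_cokernel hM.right (shortExact_of_exact_kernel (r.exact_L_succ n))
      ih (r.triviallyFibrant n).2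

lemma complex_d_negSucc (r : M.Resolution A) (n : ℕ) :
    r.complex.d (.negSucc (n + 1)) (.negSucc n) = r.K.d (n + 1) n :=
  r.connectData.d_negSucc (n + 1) n

lemma exists_extend (hM : M.IsHereditary) (r : M.Resolution A) (hA : M.Q A) {V : C}
    (hV : (M.W ⊓ M.R) V) (i j k : ℤ) (hij : i + 1 = j) (hjk : j + 1 = k) (g : r.complex.X j ⟶ V)
    (hg : r.complex.d i j ≫ g = 0) : ∃ h : r.complex.X k ⟶ V, r.complex.d j k ≫ h = g := by
  obtain ((_ | n) | (_ | n)) := j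
  · obtain rfl : i = .negSucc 0 := by
      simp only [Int.ofNat_eq_natCast] at hij hjk ⊢; omega
    obtain rfl : k = .ofNat 1 := by
      simp only [Int.ofNat_eq_natCast] at hij hjk ⊢; omega
    have key (g : r.L.X 0 ⟶ V) (hg : (r.ε ≫ r.η) ≫ g = 0) :
        ∃ h : r.L.X 1 ⟶ V, r.L.d 0 1 ≫ h = g :=
      extend_L_zero r hV g (by rwa [Category.assoc, ← comp_zero (f := r.ε), cancel_epi] at hg)
    exact key g hg
  · obtain rfl : i = .ofNat n := by
      simp only [Int.ofNat_eq_natCast] at hij hjk ⊢; omega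
    obtain rfl : k = .ofNat (n + 2) := by
      simp only [Int.ofNat_eq_natCast] at hij hjk ⊢; omega
    exact extend_L_succ r hV n g hg
  · obtain rfl : i = .negSucc 1 := by omega
    obtain rfl : k = .ofNat 0 := by
      simp only [Int.ofNat_eq_natCast] at hij hjk ⊢; omega
    have key (g : r.K.X 0 ⟶ V) (hg : r.K.d 1 0 ≫ g = 0) :
        ∃ h : r.L.X 0 ⟶ V, (r.ε ≫ r.η) ≫ h = g := by
      obtain ⟨g', hg'⟩ : ∃ g' : A ⟶ V, r.ε ≫ g' = g :=
        ⟨r.exact_K_zero.desc g hg, r.exact_K_zero.g_desc g hg⟩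
      obtain ⟨h, hh⟩ := exists_extend_of_shortExact (shortExact_cokernel r.η)
        (fun e => M.left_pair.ext_eq_zero r.cofibrant_coker_η hV e) g'
      dsimp at h hh
      exact ⟨h, by rw [Category.assoc, hh, hg']⟩
    exact key g hg
  · obtain rfl : i = .negSucc (n + 2) := by omega
    obtain rfl : k = .negSucc n := by omega
    rw [complex_d_negSucc] at hg ⊢
    exact exists_extend_of_exact (r.exact_K_succ n)
      (fun e => M.left_pair.ext_eq_zero (r.cofibrant_coker_K hM hA n) hV e) g hg

lemma exists_lift (hM : M.IsHereditary) (r : M.Resolution B) (hB : M.R B) {V : C}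
    (hV : (M.Q ⊓ M.W) V) (i j k : ℤ) (hij : i + 1 = j) (hjk : j + 1 = k) (g : V ⟶ r.complex.X j)
    (hg : g ≫ r.complex.d j k = 0) : ∃ h : V ⟶ r.complex.X i, h ≫ r.complex.d i j = g := by
  obtain ((_ | n) | (_ | n)) := j
  · obtain rfl : i = .negSucc 0 := by
      simp only [Int.ofNat_eq_natCast] at hij hjk ⊢; omega
    obtain rfl : k = .ofNat 1 := by
      simp only [Int.ofNat_eq_natCast] at hij hjk ⊢; omega
    have key (g : V ⟶ r.L.X 0) (hg : g ≫ r.L.d 0 1 = 0) :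
        ∃ h : V ⟶ r.K.X 0, h ≫ r.ε ≫ r.η = g := by
      obtain ⟨g', hg'⟩ : ∃ g' : V ⟶ B, g' ≫ r.η = g :=
        ⟨r.exact_L_zero.lift g hg, r.exact_L_zero.lift_f g hg⟩
      obtain ⟨h, hh⟩ := exists_lift_of_shortExact (shortExact_kernel r.ε)
        (fun e => M.right_pair.ext_eq_zero hV r.fibrant_ker_ε e) g'
      dsimp at h hh
      exact ⟨h, by rw [reassoc_of% hh, hg']⟩
    exact key g hg
  · obtain rfl : i = .ofNat n := by
      simp only [Int.ofNat_eq_natCast] at hij hjk ⊢; omega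
    obtain rfl : k = .ofNat (n + 2) := by
      simp only [Int.ofNat_eq_natCast] at hij hjk ⊢; omega
    exact exists_lift_of_exact (r.exact_L_succ n)
      (fun e => M.right_pair.ext_eq_zero hV (r.fibrant_ker_L hM hB n) e) g hg
  · obtain rfl : i = .negSucc 1 := by omega
    obtain rfl : k = .ofNat 0 := by
      simp only [Int.ofNat_eq_natCast] at hij hjk ⊢; omega
    have key (g : V ⟶ r.K.X 0) (hg : g ≫ r.ε ≫ r.η = 0) :
        ∃ h : V ⟶ r.K.X 1, h ≫ r.K.d 1 0 = g :=
      lift_K_zero r hV g (by rwa [← Category.assoc, ← zero_comp (f := r.η), cancel_mono] at hg)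
    exact key g hg
  · obtain rfl : i = .negSucc (n + 2) := by omega
    obtain rfl : k = .negSucc n := by omega
    rw [complex_d_negSucc] at hg ⊢
    exact lift_K_succ r hV n g hg

lemma isZero_cohomologyInto (hM : M.IsHereditary) (r : M.Resolution A) (hA : M.Q A) {V : C}
    (hV : (M.W ⊓ M.R) V) (n : ℤ) : IsZero (((cohomologyInto n).obj (op r.complex)).obj V) := by
  refine HomologicalComplex.ExactAt.isZero_homology ?_
  rw [HomologicalComplex.exactAt_iff' _ (-1 - n + 1) (-1 - n) (-1 - n - 1)
    (ComplexShape.prev_eq' _ rfl) (ComplexShape.next_eq' _ (show (-1 - n - 1) + 1 = -1 - n by omega)),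
    ShortComplex.ab_exact_iff]
  intro g hg
  exact r.exists_extend hM hA hV (-1 - n - 1) (-1 - n) (-1 - n + 1) (by omega) rfl g hg

lemma isZero_cohomologyFrom (hM : M.IsHereditary) (r : M.Resolution B) (hB : M.R B) {V : C}
    (hV : (M.Q ⊓ M.W) V) (n : ℤ) : IsZero (((cohomologyFrom n).obj (op V)).obj r.complex) := by
  refine HomologicalComplex.ExactAt.isZero_homology ?_
  rw [HomologicalComplex.exactAt_iff' _ (n - 1) n (n + 1)
    (ComplexShape.prev_eq' _ (show (n - 1) + 1 = n by omega)) (ComplexShape.next_eq' _ rfl),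
    ShortComplex.ab_exact_iff]
  intro g hg
  exact r.exists_lift hM hB hV (n - 1) n (n + 1) (by omega) rfl g hg

end Resolution

/-! ### The bifunctors `Ext` on `Ho(M)` -/

section Ext

lemma cohomologyInto_map_eq_of_homotopic (hM : M.IsHereditary) {A : C} (r : M.Resolution A)
    (hA : M.Q A) {B B' : C} {f g : B ⟶ B'} (h : M.homotopic f g) (n : ℤ) :
    ((cohomologyInto n).obj (op r.complex)).map f =
      ((cohomologyInto n).obj (op r.complex)).map g := by
  obtain ⟨V, a, b, hV, e⟩ := h
  have h₀ : ((cohomologyInto n).obj (op r.complex)).map (a ≫ b) = 0 := by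
    rw [Functor.map_comp, (r.isZero_cohomologyInto hM hA ⟨hV.1.2, hV.2⟩ n).eq_of_src
      (((cohomologyInto n).obj (op r.complex)).map b) 0, comp_zero]
  have h₁ : ((cohomologyInto n).obj (op r.complex)).map (g - f) =
      ((cohomologyInto n).obj (op r.complex)).map g -
        ((cohomologyInto n).obj (op r.complex)).map f := by
    refine Eq.trans ?_ (HomologicalComplex.homologyMap_sub (i := -1 - n)
      ((homInto.obj (op r.complex)).map g) ((homInto.obj (op r.complex)).map f))
    refine congrArg (fun φ => HomologicalComplex.homologyMap φ (-1 - n)) ?_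
    ext i x
    exact Preadditive.comp_sub _ _ _
  rw [← e, h₁, sub_eq_zero] at h₀
  exact h₀.symm

lemma cohomologyFrom_map_eq_of_homotopic (hM : M.IsHereditary) {B : C} (r : M.Resolution B)
    (hB : M.R B) {A A' : C} {f g : A ⟶ A'} (h : M.homotopic f g) (n : ℤ) :
    ((cohomologyFrom n).map f.op).app r.complex =
      ((cohomologyFrom n).map g.op).app r.complex := by
  obtain ⟨V, a, b, hV, e⟩ := h
  have h₀ : ((cohomologyFrom n).map (a ≫ b).op).app r.complex = 0 := by
    rw [op_comp, CategoryTheory.Functor.map_comp, NatTrans.comp_app,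
      (r.isZero_cohomologyFrom hM hB hV.1 n).eq_of_src
        (((cohomologyFrom n).map a.op).app r.complex) 0, comp_zero]
  have h₁ : ((cohomologyFrom n).map (g - f).op).app r.complex =
      ((cohomologyFrom n).map g.op).app r.complex -
        ((cohomologyFrom n).map f.op).app r.complex := by
    refine Eq.trans ?_ (HomologicalComplex.homologyMap_sub (i := n)
      ((homFrom.map g.op).app r.complex) ((homFrom.map f.op).app r.complex))
    refine congrArg (fun φ => HomologicalComplex.homologyMap φ n) ?_
    ext i x
    exact Preadditive.sub_comp _ _ _
  rw [← e, h₁, sub_eq_zero] at h₀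
  exact h₀.symm

variable (hM : M.IsHereditary) (ρ : ∀ A : C, M.BifibrantReplacement A)
  (res : ∀ A : C, M.Resolution A)

/-- The bifunctor `ℓExtⁿ(RQA, RQB) = Hⁿ Hom(W_{RQA}, RQB)` on `Ho(M)`, where `W_{RQA}` is the
chosen `M`-resolution of `RQA`. -/
noncomputable def lExt (n : ℤ) : (Ho ρ)ᵒᵖ ⥤ Ho ρ ⥤ AddCommGrpCat.{v} :=
  (inducedFunctor _ ⋙ CategoryTheory.Quotient.lift M.homotopic
    ((hoResolutionFunctor res ρ).op ⋙ cohomologyInto' n).flip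
    (fun _ _ _ _ h => by
      ext A : 2
      exact cohomologyInto_map_eq_of_homotopic hM (res (ρ A.unop).obj) (ρ A.unop).cofibrant h n) :
    Ho ρ ⥤ (Ho ρ)ᵒᵖ ⥤ AddCommGrpCat.{v}).flip

/-- The bifunctor `rExtⁿ(RQA, RQB) = Hⁿ Hom(RQA, W^{RQB})` on `Ho(M)`, where `W^{RQB}` is the
chosen `M`-coresolution of `RQB`. -/
noncomputable def rExt (n : ℤ) : (Ho ρ)ᵒᵖ ⥤ Ho ρ ⥤ AddCommGrpCat.{v} :=
  (inducedFunctor _ ⋙ CategoryTheory.Quotient.lift M.homotopic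
    (hoResolutionFunctor res ρ ⋙ cohomologyFrom' n).flip.rightOp
    (fun _ _ _ _ h => by
      refine Quiver.Hom.unop_inj ?_
      ext B : 2
      exact cohomologyFrom_map_eq_of_homotopic hM (res (ρ B).obj) (ρ B).fibrant h n) :
    Ho ρ ⥤ (Ho ρ ⥤ AddCommGrpCat.{v})ᵒᵖ).leftOp

lemma lExt_obj_obj (n : ℤ) (A B : C) :
    ((lExt hM ρ res n).obj (op (hoObj ρ A))).obj (hoObj ρ B) =
      ((cohomologyInto n).obj (op (res (ρ A).obj).complex)).obj (ρ B).obj := rfl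

lemma rExt_obj_obj (n : ℤ) (A B : C) :
    ((rExt hM ρ res n).obj (op (hoObj ρ A))).obj (hoObj ρ B) =
      ((cohomologyFrom n).obj (op (ρ A).obj)).obj (res (ρ B).obj).complex := rfl

lemma lExt_map_app (n : ℤ) {A A' : C} (f : (ρ A).obj ⟶ (ρ A').obj) (B : C) :
    ((lExt hM ρ res n).map (hoMk ρ f).op).app (hoObj ρ B) =
      ((cohomologyInto n).map (extension res f).op).app (ρ B).obj := rfl

lemma lExt_obj_map (n : ℤ) (A : C) {B B' : C} (f : (ρ B).obj ⟶ (ρ B').obj) :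
    ((lExt hM ρ res n).obj (op (hoObj ρ A))).map (hoMk ρ f) =
      ((cohomologyInto n).obj (op (res (ρ A).obj).complex)).map f := rfl

lemma rExt_map_app (n : ℤ) {A A' : C} (f : (ρ A).obj ⟶ (ρ A').obj) (B : C) :
    ((rExt hM ρ res n).map (hoMk ρ f).op).app (hoObj ρ B) =
      ((cohomologyFrom n).map f.op).app (res (ρ B).obj).complex := rfl

lemma rExt_obj_map (n : ℤ) (A : C) {B B' : C} (f : (ρ B).obj ⟶ (ρ B').obj) :
    ((rExt hM ρ res n).obj (op (hoObj ρ A))).map (hoMk ρ f) =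
      ((cohomologyFrom n).obj (op (ρ A).obj)).map (extension res f) := rfl

end Ext

end AbelianModelStructure

/-! Write Zⁱ for the cycles of degree i of an `M`-resolution W of A, in cochain notation. Exactness
cuts W into short exact sequences Zⁱ → Wⁱ → Zⁱ⁺¹ with trivial middle terms, and Z⁰ ≅ A. If A is
cofibrant, heredity makes every Zⁱ cofibrant, and then every Wⁱ, as an extension of these, is
trivially cofibrant. If A is fibrant, every Zⁱ is fibrant and every Wⁱ trivially fibrant. For RQA
both happen, so all Wⁱ lie in the core ω.

Cohomology consists of stable morphisms. By exactness, a cocycle of degree n in Hom(W, B) is a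
morphism Z⁻ⁿ → B, and it is a coboundary exactly when it extends along Z⁻ⁿ → W⁻ⁿ. For A cofibrant
and B fibrant this means that it factors through an object of ω. Hence Hⁿ Hom(W_A, B) is the group
of stable morphisms Z⁻ⁿ(W_A) → B (`stableEquivInto`), and dually Hⁿ Hom(A, W^B) is the group of
stable morphisms A → Zⁿ(W^B) (`stableEquivFrom`).

Cycles are suspensions. In a morphism from a cofibrant to a fibrant sequence, the stable class of
either outer component determines the other, and every class occurs (`StableCompletes`). Therefore
the category of core sequences embeds fully faithfully into the stable category by its left terms
and also by its right terms. The sequences defining Σ, those defining Ω and those cut from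
resolutions are all core sequences. Comparing them shows that Σ and Ω are inverse equivalences, that
Zⁿ(W_RQA) is naturally ΣⁿA, and that Z⁻ⁿ(W_RQA) is naturally ΩⁿA. With the description of cohomology
this gives the two outer natural isomorphisms; the middle one is the adjunction of Ωⁿ with Σⁿ.

For resolutions of a merely cofibrant QA and a merely fibrant RB, the bijection between the two ends
of the sequences (`stableShift`) moves both indices of the stable morphisms Zⁱ(W_QA) → Zʲ(W^RB) at
once, from (-n, 0) to (0, n). So the two cohomology groups agree. It remains to replace RQA by QA
and RQB by RB, which does not change stable morphisms into fibrant, respectively out of cofibrant,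
objects. -/

/-- A biadditive relation that is the graph of a bijection gives an additive equivalence. -/
noncomputable def addEquivOfRel {G H : Type*} [AddGroup G] [AddGroup H] (r : G → H → Prop)
    (add : ∀ x x' y y', r x y → r x' y' → r (x + x') (y + y'))
    (right : ∀ x, ∃ y, r x y) (left : ∀ y, ∃ x, r x y)
    (right_unique : ∀ x y y', r x y → r x y' → y = y')
    (left_unique : ∀ x x' y, r x y → r x' y → x = x') : G ≃+ H where
  toFun x := (right x).choose
  invFun y := (left y).choose
  left_inv _ := left_unique _ _ _ (left _).choose_spec (right _).choose_spec
  right_inv _ := right_unique _ _ _ (right _).choose_spec (left _).choose_spec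
  map_add' x x' :=
    right_unique _ _ _ (right _).choose_spec (add _ _ _ _ (right x).choose_spec (right x').choose_spec)

lemma addEquivOfRel_apply {G H : Type*} [AddGroup G] [AddGroup H] {r : G → H → Prop}
    (add : ∀ x x' y y', r x y → r x' y' → r (x + x') (y + y'))
    (right : ∀ x, ∃ y, r x y) (left : ∀ y, ∃ x, r x y)
    (right_unique : ∀ x y y', r x y → r x y' → y = y')
    (left_unique : ∀ x x' y, r x y → r x' y → x = x') {x : G} {y : H} (h : r x y) :
    addEquivOfRel r add right left right_unique left_unique x = y :=
  right_unique _ _ _ (right x).choose_spec h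

namespace AbelianModelStructure

variable {M : AbelianModelStructure.{w} C}

/-! ### Morphisms that are homotopic to zero -/

lemma toStable_map_eq_iff {A B : C} (f g : A ⟶ B) :
    M.toStable.map f = M.toStable.map g ↔ M.homotopic f g :=
  Quotient.functor_map_eq_iff _ f g

lemma toStable_map_eq_zero_iff {A B : C} (f : A ⟶ B) :
    M.toStable.map f = 0 ↔ ∃ (V : C) (a : A ⟶ V) (b : V ⟶ B), M.core V ∧ a ≫ b = f := by
  rw [← M.toStable.map_zero, eq_comm, toStable_map_eq_iff]
  constructor
  · rintro ⟨V, a, b, hV, e⟩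
    exact ⟨V, a, b, hV, by rw [← e, sub_zero]⟩
  · rintro ⟨V, a, b, hV, e⟩
    exact ⟨V, a, b, hV, by rw [e, sub_zero]⟩

/-- Embed A in a fibrant V with trivially cofibrant cokernel. As an extension of trivially cofibrant
objects V lies in the core, and f extends to V because B is fibrant. So factoring through a
trivially cofibrant object on the way to a fibrant one is as good as factoring through the core. -/
lemma toStable_map_eq_zero_of_triviallyCofibrant {A B : C} (hA : (M.Q ⊓ M.W) A) (hB : M.R B)
    (f : A ⟶ B) : M.toStable.map f = 0 := by
  obtain ⟨V, i, _, hV, hK⟩ := M.right_pair.enough_inj A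
  have hS := shortExact_cokernel i
  obtain ⟨g, hg⟩ := exists_extend_of_shortExact hS
    (fun e => M.right_pair.ext_eq_zero hK hB e) f
  exact (toStable_map_eq_zero_iff f).2 ⟨V, i, g,
    ⟨⟨M.left_pair.left_ext hS hA.1 hK.1, M.thick₂ _ hS hA.2 hK.2⟩, hV⟩, hg⟩

/-- Dual argument: a cofibrant V covering B with trivially fibrant kernel lies in the core, and f
lifts to it. -/
lemma toStable_map_eq_zero_of_triviallyFibrant {A B : C} (hA : M.Q A) (hB : (M.W ⊓ M.R) B)
    (f : A ⟶ B) : M.toStable.map f = 0 := by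
  obtain ⟨V, p, _, hV, hK⟩ := M.left_pair.enough_proj B
  have hS := shortExact_kernel p
  obtain ⟨g, hg⟩ := exists_lift_of_shortExact hS (M.left_pair.ext_eq_zero hA hK) f
  exact (toStable_map_eq_zero_iff f).2 ⟨V, g, p,
    ⟨⟨hV, M.thick₂ _ hS hK.1 hB.1⟩, M.right_pair.right_ext hS hK.2 hB.2⟩, hg⟩

lemma toStable_map_comp_eq_zero_left {A V B : C} (hV : (M.Q ⊓ M.W) V) (hB : M.R B)
    (f : A ⟶ V) (g : V ⟶ B) : M.toStable.map (f ≫ g) = 0 := by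
  rw [Functor.map_comp, toStable_map_eq_zero_of_triviallyCofibrant hV hB g, comp_zero]

lemma toStable_map_comp_eq_zero_right {A V B : C} (hA : M.Q A) (hV : (M.W ⊓ M.R) V)
    (f : A ⟶ V) (g : V ⟶ B) : M.toStable.map (f ≫ g) = 0 := by
  rw [Functor.map_comp, toStable_map_eq_zero_of_triviallyFibrant hA hV f, zero_comp]

/-! ### Dimension shifting along short exact sequences -/

/-- A short exact sequence with trivially cofibrant middle term and cofibrant right term. -/
structure IsCofibrantSequence (M : AbelianModelStructure.{w} C) (S : ShortComplex C) : Prop where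
  shortExact : S.ShortExact
  mid : (M.Q ⊓ M.W) S.X₂
  right : M.Q S.X₃

/-- A short exact sequence with trivially fibrant middle term and fibrant left term. -/
structure IsFibrantSequence (M : AbelianModelStructure.{w} C) (S : ShortComplex C) : Prop where
  shortExact : S.ShortExact
  mid : (M.W ⊓ M.R) S.X₂
  left : M.R S.X₁

/-- The stable morphisms `x` and `y` are represented by the outer components of a morphism from
`S` to `S'`. -/
def StableCompletes (M : AbelianModelStructure.{w} C) (S S' : ShortComplex C)
    (x : M.toStable.obj S.X₁ ⟶ M.toStable.obj S'.X₁)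
    (y : M.toStable.obj S.X₃ ⟶ M.toStable.obj S'.X₃) : Prop :=
  ∃ φ : S ⟶ S', M.toStable.map φ.τ₁ = x ∧ M.toStable.map φ.τ₃ = y

namespace StableCompletes

variable {S S' S'' : ShortComplex C}

lemma of_hom (φ : S ⟶ S') :
    M.StableCompletes S S' (M.toStable.map φ.τ₁) (M.toStable.map φ.τ₃) :=
  ⟨φ, rfl, rfl⟩

lemma id (S : ShortComplex C) : M.StableCompletes S S (𝟙 _) (𝟙 _) :=
  ⟨𝟙 S, M.toStable.map_id _, M.toStable.map_id _⟩

lemma comp {x y x' y'} (h : M.StableCompletes S S' x y) (h' : M.StableCompletes S' S'' x' y') :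
    M.StableCompletes S S'' (x ≫ x') (y ≫ y') := by
  obtain ⟨φ, rfl, rfl⟩ := h
  obtain ⟨ψ, rfl, rfl⟩ := h'
  exact ⟨φ ≫ ψ, M.toStable.map_comp _ _, M.toStable.map_comp _ _⟩

lemma add {x y x' y'} (h : M.StableCompletes S S' x y) (h' : M.StableCompletes S S' x' y') :
    M.StableCompletes S S' (x + x') (y + y') := by
  obtain ⟨φ, rfl, rfl⟩ := h
  obtain ⟨ψ, rfl, rfl⟩ := h'
  exact ⟨φ + ψ, M.toStable.map_add, M.toStable.map_add⟩

lemma sub {x y x' y'} (h : M.StableCompletes S S' x y) (h' : M.StableCompletes S S' x' y') :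
    M.StableCompletes S S' (x - x') (y - y') := by
  obtain ⟨φ, rfl, rfl⟩ := h
  obtain ⟨ψ, rfl, rfl⟩ := h'
  exact ⟨φ - ψ, M.toStable.map_sub, M.toStable.map_sub⟩

/-- Ext¹ of the cofibrant right term of S into the trivially fibrant middle term of S' vanishes, so
a morphism of left terms extends to the middle terms and then passes to the quotients. -/
lemma exists_right (hS : M.IsCofibrantSequence S) (hS' : M.IsFibrantSequence S')
    (x : M.toStable.obj S.X₁ ⟶ M.toStable.obj S'.X₁) : ∃ y, M.StableCompletes S S' x y := by
  obtain ⟨f, rfl⟩ := M.toStable.map_surjective x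
  have : Epi S.g := hS.shortExact.epi_g
  obtain ⟨h, hh⟩ := exists_extend_of_shortExact hS.shortExact
    (fun e => M.left_pair.ext_eq_zero hS.right hS'.mid e) (f ≫ S'.f)
  have hz : S.f ≫ h ≫ S'.g = 0 := by rw [reassoc_of% hh, S'.zero, comp_zero]
  exact ⟨_, of_hom ⟨f, h, hS.shortExact.exact.desc (h ≫ S'.g) hz, hh.symm,
    (hS.shortExact.exact.g_desc _ _).symm⟩⟩

/-- Here the vanishing Ext¹ is that of the trivially cofibrant middle term of S into the fibrant
left term of S'. -/
lemma exists_left (hS : M.IsCofibrantSequence S) (hS' : M.IsFibrantSequence S')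
    (y : M.toStable.obj S.X₃ ⟶ M.toStable.obj S'.X₃) : ∃ x, M.StableCompletes S S' x y := by
  obtain ⟨c, rfl⟩ := M.toStable.map_surjective y
  have : Mono S'.f := hS'.shortExact.mono_f
  obtain ⟨h, hh⟩ := exists_lift_of_shortExact hS'.shortExact
    (M.right_pair.ext_eq_zero hS.mid hS'.left) (S.g ≫ c)
  have hz : (S.f ≫ h) ≫ S'.g = 0 := by rw [Category.assoc, hh, S.zero_assoc, zero_comp]
  exact ⟨_, of_hom ⟨hS'.shortExact.exact.lift (S.f ≫ h) hz, h, c,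
    hS'.shortExact.exact.lift_f _ _, hh⟩⟩

/-- If the left component factors through V in the core, extend its first factor to the middle term
of S and subtract the result from the middle component. The difference kills the left term, hence
descends, and shows that the right component factors through the trivially fibrant middle term of
S'. -/
lemma right_eq_zero (hS : M.IsCofibrantSequence S) (hS' : M.IsFibrantSequence S') {y}
    (h : M.StableCompletes S S' 0 y) : y = 0 := by
  obtain ⟨φ, h₁, rfl⟩ := h
  obtain ⟨V, a, b, hV, e⟩ := (toStable_map_eq_zero_iff _).1 h₁
  have : Epi S.g := hS.shortExact.epi_g
  obtain ⟨a', ha'⟩ := exists_extend_of_shortExact hS.shortExact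
    (fun e => M.left_pair.ext_eq_zero hS.right ⟨hV.1.2, hV.2⟩ e) a
  have hz : S.f ≫ (φ.τ₂ - a' ≫ b ≫ S'.f) = 0 := by
    rw [Preadditive.comp_sub, ← φ.comm₁₂, reassoc_of% ha', reassoc_of% e, sub_self]
  have key : hS.shortExact.exact.desc _ hz ≫ S'.g = φ.τ₃ := by
    rw [← cancel_epi S.g, hS.shortExact.exact.g_desc_assoc, ← φ.comm₂₃]
    simp
  rw [← key, toStable_map_comp_eq_zero_right hS.right hS'.mid]

/-- Dually, after correction by a lift of the second factor, the middle component lands in the left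
term of S', and the left component factors through the trivially cofibrant middle term of S. -/
lemma left_eq_zero (hS : M.IsCofibrantSequence S) (hS' : M.IsFibrantSequence S') {x}
    (h : M.StableCompletes S S' x 0) : x = 0 := by
  obtain ⟨φ, rfl, h₃⟩ := h
  obtain ⟨V, a, b, hV, e⟩ := (toStable_map_eq_zero_iff _).1 h₃
  have : Mono S'.f := hS'.shortExact.mono_f
  obtain ⟨b', hb'⟩ := exists_lift_of_shortExact hS'.shortExact
    (M.right_pair.ext_eq_zero hV.1 hS'.left) b
  have hz : (φ.τ₂ - S.g ≫ a ≫ b') ≫ S'.g = 0 := by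
    rw [Preadditive.sub_comp, φ.comm₂₃, Category.assoc, Category.assoc, hb', e, sub_self]
  have key : S.f ≫ hS'.shortExact.exact.lift _ hz = φ.τ₁ := by
    rw [← cancel_mono S'.f, Category.assoc, hS'.shortExact.exact.lift_f, φ.comm₁₂]
    simp
  rw [← key, toStable_map_comp_eq_zero_left hS.mid hS'.left]

lemma right_unique (hS : M.IsCofibrantSequence S) (hS' : M.IsFibrantSequence S') {x y y'}
    (h : M.StableCompletes S S' x y) (h' : M.StableCompletes S S' x y') : y = y' := by
  have := h.sub h'
  rw [sub_self] at this
  exact sub_eq_zero.1 (right_eq_zero hS hS' this)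

lemma left_unique (hS : M.IsCofibrantSequence S) (hS' : M.IsFibrantSequence S') {x x' y}
    (h : M.StableCompletes S S' x y) (h' : M.StableCompletes S S' x' y) : x = x' := by
  have := h.sub h'
  rw [sub_self] at this
  exact sub_eq_zero.1 (left_eq_zero hS hS' this)

end StableCompletes

/-- Dimension shifting: stable morphisms between the left terms of a cofibrant and a fibrant
sequence agree with those between the right terms. -/
noncomputable def stableShift {S S' : ShortComplex C} (hS : M.IsCofibrantSequence S)
    (hS' : M.IsFibrantSequence S') : (M.toStable.obj S.X₁ ⟶ M.toStable.obj S'.X₁) ≃+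
      (M.toStable.obj S.X₃ ⟶ M.toStable.obj S'.X₃) :=
  addEquivOfRel (M.StableCompletes S S')
    (fun _ _ _ _ => StableCompletes.add)
    (StableCompletes.exists_right hS hS') (StableCompletes.exists_left hS hS')
    (fun _ _ _ => StableCompletes.right_unique hS hS')
    (fun _ _ _ => StableCompletes.left_unique hS hS')

/-! ### The category of core sequences -/

/-- A short exact sequence that is both a cofibrant and a fibrant sequence. -/
structure CoreSequence (M : AbelianModelStructure.{w} C) where
  seq : ShortComplex C
  cofibrant : M.IsCofibrantSequence seq
  fibrant : M.IsFibrantSequence seq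

namespace CoreSequence

/-- A morphism of core sequences: the stable classes of the outer components of a morphism of
short complexes. -/
@[ext]
structure Hom (P P' : M.CoreSequence) where
  left : M.toStable.obj P.seq.X₁ ⟶ M.toStable.obj P'.seq.X₁
  right : M.toStable.obj P.seq.X₃ ⟶ M.toStable.obj P'.seq.X₃
  completes : M.StableCompletes P.seq P'.seq left right

instance : Category M.CoreSequence where
  Hom := Hom
  id P := ⟨_, _, .id P.seq⟩
  comp f g := ⟨_, _, f.completes.comp g.completes⟩
  id_comp _ := Hom.ext (Category.id_comp _) (Category.id_comp _)
  comp_id _ := Hom.ext (Category.comp_id _) (Category.comp_id _)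
  assoc _ _ _ := Hom.ext (Category.assoc _ _ _) (Category.assoc _ _ _)

variable (M)

/-- The left term of a core sequence. -/
def leftFunctor : M.CoreSequence ⥤ M.Stable where
  obj P := M.toStable.obj P.seq.X₁
  map f := Hom.left f

/-- The right term of a core sequence. -/
def rightFunctor : M.CoreSequence ⥤ M.Stable where
  obj P := M.toStable.obj P.seq.X₃
  map f := Hom.right f

variable {M}

lemma hom_ext_of_left {P P' : M.CoreSequence} {f g : Hom P P'} (h : f.left = g.left) : f = g :=
  Hom.ext h (StableCompletes.right_unique P.cofibrant P'.fibrant f.completes (h ▸ g.completes))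

lemma hom_ext_of_right {P P' : M.CoreSequence} {f g : Hom P P'} (h : f.right = g.right) :
    f = g :=
  Hom.ext (StableCompletes.left_unique P.cofibrant P'.fibrant f.completes (h ▸ g.completes)) h

/-- Existence and uniqueness of completions make both outer terms fully faithful functors. Two
families of core sequences with naturally isomorphic terms at one end therefore have naturally
isomorphic terms at the other end. -/
instance : (leftFunctor M).Faithful where
  map_injective h := hom_ext_of_left h

instance : (rightFunctor M).Faithful where
  map_injective h := hom_ext_of_right h

instance : (leftFunctor M).Full where
  map_surjective {P P'} x := by
    obtain ⟨y, h⟩ := StableCompletes.exists_right P.cofibrant P'.fibrant x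
    exact ⟨⟨x, y, h⟩, rfl⟩

instance : (rightFunctor M).Full where
  map_surjective {P P'} y := by
    obtain ⟨x, h⟩ := StableCompletes.exists_left P.cofibrant P'.fibrant y
    exact ⟨⟨x, y, h⟩, rfl⟩

end CoreSequence

/-! ### The equivalence between suspension and loops -/

section SuspensionLoopEquivalence

/-- The top row of a bifibrant approximation as a core sequence. -/
def BifibrantApproximation.coreSequence {ρ : ∀ A : C, M.BifibrantReplacement A} {X Y : C}
    {T : M.TrivialSequence X Y} (P : BifibrantApproximation ρ T) : M.CoreSequence where
  seq := ShortComplex.mk P.i P.p P.zero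
  cofibrant := ⟨P.shortExact, P.core.1, (ρ Y).cofibrant⟩
  fibrant := ⟨P.shortExact, ⟨P.core.1.2, P.core.2⟩, (ρ X).fibrant⟩

lemma BifibrantApproximation.Completes.stableCompletes {ρ : ∀ A : C, M.BifibrantReplacement A}
    {X Y X' Y' : C} {T : M.TrivialSequence X Y} {T' : M.TrivialSequence X' Y'}
    {P : BifibrantApproximation ρ T} {P' : BifibrantApproximation ρ T'}
    {f : (ρ X).obj ⟶ (ρ X').obj} {c : (ρ Y).obj ⟶ (ρ Y').obj} (h : P.Completes P' f c) :
    M.StableCompletes P.coreSequence.seq P'.coreSequence.seq (M.toStable.map f)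
      (M.toStable.map c) := by
  obtain ⟨u, h₁, h₂⟩ := h
  exact ⟨⟨f, u, c, h₁.symm, h₂.symm⟩, rfl, rfl⟩

variable (hM : M.IsHereditary) (ρ : ∀ A : C, M.BifibrantReplacement A)

/-- The embedding of `Ho(M)` into the stable category, with `A` sent to `RQA`. -/
abbrev hoInclusion : Ho ρ ⥤ M.Stable := inducedFunctor _

instance : (hoInclusion ρ).Additive where

variable {S : C → C} (s : ∀ X : C, M.TrivialSequence X (S X))

/-- `suspension` is defined on morphisms by a choice of representatives; this property, together
with uniqueness of completions, replaces the choice from here on. -/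
lemma suspension_completes {X X' : C} (f : hoObj ρ X ⟶ hoObj ρ X') :
    M.StableCompletes (approximation hM ρ (s X)).coreSequence.seq
      (approximation hM ρ (s X')).coreSequence.seq
      f.hom ((suspension hM ρ s).map f).hom := by
  obtain ⟨-, f₀, c₀, rfl, -, h⟩ := exists_suspensionMap hM ρ s f
  have e : (suspension hM ρ s).map (hoMk ρ f₀) = hoMk ρ c₀ := suspensionMap_eq hM ρ s h
  rw [e]
  exact h.stableCompletes

/-- The chosen approximations for the suspension, as a functor to core sequences. -/
noncomputable def suspensionSequence : Ho ρ ⥤ M.CoreSequence where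
  obj X := (approximation hM ρ (s X)).coreSequence
  map f := ⟨f.hom, ((suspension hM ρ s).map f).hom, suspension_completes hM ρ s f⟩
  -- Only the left components, which are those of f itself, have to be compared.
  map_id _ := CoreSequence.hom_ext_of_left rfl
  map_comp _ _ := CoreSequence.hom_ext_of_left rfl

/-- The sum of two completions is a completion of the sum, and the right component is unique. -/
instance : (suspension hM ρ s).Additive where
  map_add {X Y f g} := InducedCategory.hom_ext
    (StableCompletes.right_unique (approximation hM ρ (s X)).coreSequence.cofibrant
      (approximation hM ρ (s Y)).coreSequence.fibrant (suspension_completes hM ρ s (f + g))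
      ((suspension_completes hM ρ s f).add (suspension_completes hM ρ s g)))

variable {Λ : C → C} (l : ∀ X : C, M.TrivialSequence (Λ X) X)

lemma loop_completes {X X' : C} (c : hoObj ρ X ⟶ hoObj ρ X') :
    M.StableCompletes (approximation hM ρ (l X)).coreSequence.seq
      (approximation hM ρ (l X')).coreSequence.seq
      ((loop hM ρ l).map c).hom c.hom := by
  obtain ⟨-, c₀, f₀, rfl, -, h⟩ := exists_loopMap hM ρ l c
  have e : (loop hM ρ l).map (hoMk ρ c₀) = hoMk ρ f₀ := loopMap_eq hM ρ l h
  rw [e]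
  exact h.stableCompletes

/-- The chosen approximations for the loop functor, as a functor to core sequences. -/
noncomputable def loopSequence : Ho ρ ⥤ M.CoreSequence where
  obj X := (approximation hM ρ (l X)).coreSequence
  map c := ⟨((loop hM ρ l).map c).hom, c.hom, loop_completes hM ρ l c⟩
  map_id _ := CoreSequence.hom_ext_of_right rfl
  map_comp _ _ := CoreSequence.hom_ext_of_right rfl

instance : (loop hM ρ l).Additive where
  map_add {X Y f g} := InducedCategory.hom_ext
    (StableCompletes.left_unique (approximation hM ρ (l X)).coreSequence.cofibrant
      (approximation hM ρ (l Y)).coreSequence.fibrant (loop_completes hM ρ l (f + g))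
      ((loop_completes hM ρ l f).add (loop_completes hM ρ l g)))

/-- If the left terms of a functor to core sequences are given by `G`, then the right terms are
given by the suspension of `G`. -/
noncomputable def rightIsoSuspension {D : Type*} [Category* D] (T : D ⥤ M.CoreSequence)
    (G : D ⥤ Ho ρ) (e : T ⋙ CoreSequence.leftFunctor M ≅ G ⋙ hoInclusion ρ) :
    T ⋙ CoreSequence.rightFunctor M ≅ (G ⋙ suspension hM ρ s) ⋙ hoInclusion ρ :=
  -- The isomorphism of left terms lifts to one between T and the defining sequences of the
  -- suspension of G, because `leftFunctor` is fully faithful; then take right terms.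
  Functor.isoWhiskerRight (Functor.fullyFaithfulCancelRight (CoreSequence.leftFunctor M)
    (F := T) (G := G ⋙ suspensionSequence hM ρ s) e) (CoreSequence.rightFunctor M)

/-- If the right terms of a functor to core sequences are given by `G`, then the left terms are
given by the loop objects of `G`. -/
noncomputable def leftIsoLoop {D : Type*} [Category* D] (T : D ⥤ M.CoreSequence)
    (G : D ⥤ Ho ρ) (e : T ⋙ CoreSequence.rightFunctor M ≅ G ⋙ hoInclusion ρ) :
    T ⋙ CoreSequence.leftFunctor M ≅ (G ⋙ loop hM ρ l) ⋙ hoInclusion ρ :=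
  Functor.isoWhiskerRight (Functor.fullyFaithfulCancelRight (CoreSequence.rightFunctor M)
    (F := T) (G := G ⋙ loopSequence hM ρ l) e) (CoreSequence.leftFunctor M)

/-- The loop functor is inverse to the suspension. -/
noncomputable def suspensionEquivalence : Ho ρ ≌ Ho ρ :=
  CategoryTheory.Equivalence.mk (suspension hM ρ s) (loop hM ρ l)
    -- The sequence defining ΣX has right term ΣX, so its left term X is identified with ΩΣX. The
    -- counit comes in the same way from the sequence defining ΩX.
    (Functor.fullyFaithfulCancelRight (hoInclusion ρ)
      (leftIsoLoop hM ρ l (suspensionSequence hM ρ s) (suspension hM ρ s) (Iso.refl _)))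
    (Functor.fullyFaithfulCancelRight (hoInclusion ρ)
      (rightIsoSuspension hM ρ s (loopSequence hM ρ l) (loop hM ρ l) (Iso.refl _)).symm)

end SuspensionLoopEquivalence

/-! ### Iterates -/

section Iterate

/-- `F ⋙ Fⁿ ≅ Fⁿ ⋙ F`. -/
def iterateFunctorCommIso {D : Type*} [Category* D] (F : D ⥤ D) :
    ∀ n : ℕ, F ⋙ iterateFunctor F n ≅ iterateFunctor F n ⋙ F
  | 0 => F.rightUnitor ≪≫ F.leftUnitor.symm
  | n + 1 => (Functor.associator _ _ _).symm ≪≫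
      Functor.isoWhiskerRight (iterateFunctorCommIso F n) F

/-- The iterates of adjoint functors are adjoint. -/
def iterateFunctorAdjunction {D : Type*} [Category* D] {F G : D ⥤ D} (adj : F ⊣ G) :
    ∀ n : ℕ, iterateFunctor F n ⊣ iterateFunctor G n
  | 0 => Adjunction.id
  -- Composition of adjunctions reverses the order of the right adjoints and yields `G ⋙ Gⁿ`, while
  -- the iterate is `Gⁿ ⋙ G`.
  | n + 1 => ((iterateFunctorAdjunction adj n).comp adj).ofNatIsoRight
      (iterateFunctorCommIso G n)

instance iterateFunctor_additive {D : Type*} [Category* D] [Preadditive D] (F : D ⥤ D)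
    [F.Additive] : ∀ n : ℕ, (iterateFunctor F n).Additive
  | 0 => inferInstanceAs (𝟭 D).Additive
  | n + 1 => by
    have := iterateFunctor_additive F n
    exact inferInstanceAs (iterateFunctor F n ⋙ F).Additive

variable (hM : M.IsHereditary) (ρ : ∀ A : C, M.BifibrantReplacement A)
  {S : C → C} (s : ∀ X : C, M.TrivialSequence X (S X))
  {Λ : C → C} (l : ∀ X : C, M.TrivialSequence (Λ X) X)

/-- `Ωⁿ` is left adjoint to `Σⁿ`, for all integers `n`. -/
noncomputable def loopPowAdjunction :
    ∀ n : ℤ, loopPow hM ρ s l n ⊣ suspensionPow hM ρ s l n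
  | .ofNat n => iterateFunctorAdjunction (suspensionEquivalence hM ρ s l).symm.toAdjunction n
  | .negSucc n => iterateFunctorAdjunction (suspensionEquivalence hM ρ s l).toAdjunction (n + 1)

instance loopPow_additive : ∀ n : ℤ, (loopPow hM ρ s l n).Additive
  | .ofNat n => iterateFunctor_additive _ n
  | .negSucc n => iterateFunctor_additive _ (n + 1)

end Iterate

/-! ### Groups of morphisms -/

section Coyoneda

/-- An additive adjunction gives isomorphisms of groups of morphisms, natural in both
variables. -/
noncomputable def coyonedaIsoOfAdjunction {D E : Type*} [Category.{v} D] [Category.{v} E]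
    [Preadditive D] [Preadditive E] {F : D ⥤ E} {G : E ⥤ D} [F.Additive] (adj : F ⊣ G) :
    F.op ⋙ preadditiveCoyoneda ≅
      preadditiveCoyoneda ⋙ (Functor.whiskeringLeft _ _ _).obj G :=
  NatIso.ofComponents (fun X => NatIso.ofComponents
    (fun Y => (adj.homAddEquiv X.unop Y).toAddCommGrpIso)
    (fun f => by ext x; exact adj.homEquiv_naturality_right x f))
    (fun f => by ext Y x; exact adj.homEquiv_naturality_left f.unop x)

/-- A fully faithful additive functor induces isomorphisms of groups of morphisms. -/
noncomputable def coyonedaIsoOfFullyFaithful {D E : Type*} [Category.{v} D] [Category.{v} E]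
    [Preadditive D] [Preadditive E] (F : D ⥤ E) [F.Additive] [F.Full] [F.Faithful] :
    preadditiveCoyoneda (C := D) ≅
      F.op ⋙ preadditiveCoyoneda ⋙ (Functor.whiskeringLeft _ _ _).obj F :=
  NatIso.ofComponents (fun X => NatIso.ofComponents
    (fun Y => (AddEquiv.ofBijective (F.mapAddHom (X := X.unop) (Y := Y))
      ⟨F.map_injective, F.map_surjective⟩).toAddCommGrpIso)
    (fun f => by ext x; exact F.map_comp x f))
    (fun f => by ext Y x; exact F.map_comp f.unop x)

end Coyoneda

end AbelianModelStructure

/-! ### Cycles of exact complexes -/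

section Cycles

variable {C : Type u} [Category.{v} C] [Abelian C]

/-- Composing with a monomorphism does not change the kernel. This serves to pass between a
differential and its corestriction to the cycles, and at the splicing map `r.ε ≫ r.η` of a
resolution. -/
lemma exact_comp_mono_iff {X₁ X₂ X₃ Y : C} {f : X₁ ⟶ X₂} {g : X₂ ⟶ X₃} (w : f ≫ g = 0)
    (m : X₃ ⟶ Y) [Mono m] (w' : f ≫ g ≫ m = 0) :
    (ShortComplex.mk f (g ≫ m) w').Exact ↔ (ShortComplex.mk f g w).Exact := by
  let φ : ShortComplex.mk f g w ⟶ ShortComplex.mk f (g ≫ m) w' :=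
    ⟨𝟙 X₁, 𝟙 X₂, m, by simp, by simp⟩
  have : Epi φ.τ₁ := inferInstanceAs (Epi (𝟙 X₁))
  have : IsIso φ.τ₂ := inferInstanceAs (IsIso (𝟙 X₂))
  have : Mono φ.τ₃ := inferInstanceAs (Mono m)
  exact (ShortComplex.exact_iff_of_epi_of_isIso_of_mono φ).symm

lemma exact_epi_comp_iff {X₁ X₂ X₃ Y : C} {f : X₁ ⟶ X₂} {g : X₂ ⟶ X₃} (w : f ≫ g = 0)
    (e : Y ⟶ X₁) [Epi e] (w' : (e ≫ f) ≫ g = 0) :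
    (ShortComplex.mk (e ≫ f) g w').Exact ↔ (ShortComplex.mk f g w).Exact := by
  let φ : ShortComplex.mk (e ≫ f) g w' ⟶ ShortComplex.mk f g w :=
    ⟨e, 𝟙 X₂, 𝟙 X₃, by simp, by simp⟩
  have : Epi φ.τ₁ := inferInstanceAs (Epi e)
  have : IsIso φ.τ₂ := inferInstanceAs (IsIso (𝟙 X₂))
  have : Mono φ.τ₃ := inferInstanceAs (Mono (𝟙 X₃))
  exact ShortComplex.exact_iff_of_epi_of_isIso_of_mono φ

lemma iCycles_toCycles (K : CochainComplex C ℤ) (i j : ℤ) :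
    K.iCycles i ≫ K.toCycles i j = 0 := by
  rw [← cancel_mono (K.iCycles j)]
  simp

/-- The sequence `Zⁱ ⟶ Kⁱ ⟶ Zʲ` (for `j = i + 1`). -/
noncomputable abbrev cyclesSequence (K : CochainComplex C ℤ) (i j : ℤ) : ShortComplex C :=
  ShortComplex.mk (K.iCycles i) (K.toCycles i j) (iCycles_toCycles K i j)

lemma toCycles_cyclesMap {K L : CochainComplex C ℤ} (φ : K ⟶ L) (i j : ℤ) :
    K.toCycles i j ≫ HomologicalComplex.cyclesMap φ j = φ.f i ≫ L.toCycles i j := by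
  rw [← cancel_mono (L.iCycles j)]
  simp

/-- The morphism of cycle sequences given by a morphism of complexes. -/
noncomputable abbrev cyclesSequenceMap {K L : CochainComplex C ℤ} (φ : K ⟶ L) (i j : ℤ) :
    cyclesSequence K i j ⟶ cyclesSequence L i j where
  τ₁ := HomologicalComplex.cyclesMap φ i
  τ₂ := φ.f i
  τ₃ := HomologicalComplex.cyclesMap φ j
  comm₁₂ := HomologicalComplex.cyclesMap_i φ i
  comm₂₃ := (toCycles_cyclesMap φ i j).symm

lemma epi_toCycles {K : CochainComplex C ℤ} {i j : ℤ} (hij : i + 1 = j) (h : K.ExactAt j) :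
    Epi (K.toCycles i j) := by
  obtain rfl : (ComplexShape.up ℤ).prev j = i := ComplexShape.prev_eq' _ hij
  exact ShortComplex.Exact.epi_toCycles h

/-- The cycles are the kernel of the differential, hence also of its corestriction to the next
cycles; exactness at j makes that corestriction epi. -/
lemma shortExact_cyclesSequence {K : CochainComplex C ℤ} {i j : ℤ} (hij : i + 1 = j)
    (h : K.ExactAt j) : (cyclesSequence K i j).ShortExact := by
  have : (ShortComplex.mk (K.iCycles i) (K.toCycles i j ≫ K.iCycles j) (by simp)).Exact := by
    simp only [HomologicalComplex.toCycles_i]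
    exact ShortComplex.exact_of_f_is_kernel _
      (K.cyclesIsKernel i j (ComplexShape.next_eq' _ hij))
  exact ShortComplex.ShortExact.mk' ((exact_comp_mono_iff _ _ _).1 this)
    (by dsimp; infer_instance) (epi_toCycles hij h)

lemma exact_d_toCycles {K : CochainComplex C ℤ} {i j k : ℤ} (hij : i + 1 = j)
    (hjk : j + 1 = k) (hj : K.ExactAt j) :
    (ShortComplex.mk (K.d i j) (K.toCycles j k) (by simp)).Exact := by
  refine (exact_comp_mono_iff _ (K.iCycles k) (by simp)).1 ?_
  simp only [HomologicalComplex.toCycles_i]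
  exact (K.exactAt_iff' i j k (ComplexShape.prev_eq' _ hij) (ComplexShape.next_eq' _ hjk)).1 hj

/-- `Zᵏ` is the cokernel of `Kⁱ ⟶ Kʲ` in an exact complex (for `j = i + 1`, `k = j + 1`). -/
noncomputable def cokernelIsoCycles {K : CochainComplex C ℤ} {i j k : ℤ} (hij : i + 1 = j)
    (hjk : j + 1 = k) (hj : K.ExactAt j) (hk : K.ExactAt k) : cokernel (K.d i j) ≅ K.cycles k :=
  have : Epi (ShortComplex.mk (K.d i j) (K.toCycles j k) (by simp)).g := epi_toCycles hjk hk
  IsColimit.coconePointUniqueUpToIso (colimit.isColimit _)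
    (exact_d_toCycles hij hjk hj).gIsCokernel

/-- Of the two terms dh + hd, the one beginning with the differential vanishes on cycles. What is
left factors through the term of degree j of K, which is the form needed to see that it is stably
zero. -/
lemma cyclesMap_sub_of_homotopy {K L : CochainComplex C ℤ} {φ ψ : K ⟶ L} (h : Homotopy φ ψ)
    {i j k : ℤ} (hij : i + 1 = j) (hjk : j + 1 = k) :
    HomologicalComplex.cyclesMap φ j - HomologicalComplex.cyclesMap ψ j =
      K.iCycles j ≫ h.hom j i ≫ L.toCycles i j := by
  rw [← cancel_mono (L.iCycles j)]
  have e := h.comm j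
  rw [dNext_eq h.hom (show (ComplexShape.up ℤ).Rel j k from hjk),
    prevD_eq h.hom (show (ComplexShape.up ℤ).Rel i j from hij)] at e
  simp [Preadditive.sub_comp, e]

end Cycles

namespace AbelianModelStructure

variable {M : AbelianModelStructure.{w} C}

/-! ### Cycles of resolutions -/

namespace Resolution

variable {A B : C}

lemma exactAt (r : M.Resolution A) (j : ℤ) : r.complex.ExactAt j := by
  rw [HomologicalComplex.exactAt_iff' _ (j - 1) j (j + 1)
    (ComplexShape.prev_eq' _ (by simp)) (ComplexShape.next_eq' _ rfl)]
  -- Exactness is part of the definition except in degrees 0 and -1, next to the splicing map. There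
  -- it survives because ε is epi and η is mono.
  have hη : (ShortComplex.mk (r.ε ≫ r.η) (r.L.d 0 1)
      (by rw [Category.assoc, r.η_d, comp_zero])).Exact :=
    (exact_epi_comp_iff r.η_d r.ε _).2 r.exact_L_zero
  have hε : (ShortComplex.mk (r.K.d 1 0) (r.ε ≫ r.η)
      (by rw [← Category.assoc, r.d_ε, zero_comp])).Exact :=
    (exact_comp_mono_iff r.d_ε r.η _).2 r.exact_K_zero
  suffices h : ∀ i k : ℤ, i + 1 = j → j + 1 = k → (r.complex.sc' i j k).Exact from
    h _ _ (by simp) rfl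
  intro i k hij hjk
  obtain ((_ | n) | (_ | n)) := j
  · obtain rfl : i = .negSucc 0 := by
      simp only [Int.ofNat_eq_natCast] at hij hjk ⊢; omega
    obtain rfl : k = .ofNat 1 := by
      simp only [Int.ofNat_eq_natCast] at hij hjk ⊢; omega
    exact hη
  · obtain rfl : i = .ofNat n := by
      simp only [Int.ofNat_eq_natCast] at hij hjk ⊢; omega
    obtain rfl : k = .ofNat (n + 2) := by
      simp only [Int.ofNat_eq_natCast] at hij hjk ⊢; omega
    exact r.exact_L_succ n
  · obtain rfl : i = .negSucc 1 := by omega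
    obtain rfl : k = .ofNat 0 := by
      simp only [Int.ofNat_eq_natCast] at hij hjk ⊢; omega
    exact hε
  · obtain rfl : i = .negSucc (n + 2) := by omega
    obtain rfl : k = .negSucc n := by omega
    have h := r.exact_K_succ n
    have e : r.complex.sc' (.negSucc (n + 2)) (.negSucc (n + 1)) (.negSucc n) =
        ShortComplex.mk (r.K.d (n + 2) (n + 1)) (r.K.d (n + 1) n) (r.K.d_comp_d _ _ _) := by
      dsimp only [HomologicalComplex.sc', HomologicalComplex.shortComplexFunctor']
      congr 1
    rw [e]
    exact h

lemma shortExact_cyclesSequence (r : M.Resolution A) {i j : ℤ} (hij : i + 1 = j) :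
    (cyclesSequence r.complex i j).ShortExact :=
  _root_.shortExact_cyclesSequence hij (r.exactAt j)

/-- By exactness Zᵏ is the cokernel of the differential into degree k - 1. In the coresolution half,
and at the splice, it is cofibrant by definition. In the resolution half this is propagated
downwards from A, since by heredity kernels of epimorphisms between cofibrant objects are cofibrant.
-/
lemma cofibrant_cycles (hM : M.IsHereditary) (r : M.Resolution A) (hA : M.Q A) (k : ℤ) :
    M.Q (r.complex.cycles k) := by
  suffices h : ∀ i j : ℤ, i + 1 = j → M.Q (cokernel (r.complex.d i j)) from
    M.left_pair.left_of_iso (cokernelIsoCycles (i := k - 2) (j := k - 1) (by omega) (by omega)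
      (r.exactAt _) (r.exactAt _)) (h _ _ (by omega))
  rintro (n | _ | n) j hij
  · obtain rfl : j = .ofNat (n + 1) := by
      simp only [Int.ofNat_eq_natCast] at hij ⊢; omega
    exact r.cofibrant_coker_d n
  · obtain rfl : j = .ofNat 0 := by
      simp only [Int.ofNat_eq_natCast] at hij ⊢; omega
    exact M.left_pair.left_of_iso (cokernelEpiComp r.ε r.η).symm r.cofibrant_coker_η
  · obtain rfl : j = .negSucc n := by omega
    rw [complex_d_negSucc]
    exact r.cofibrant_coker_K hM hA n

/-- Zⁱ is a kernel of the differential. The kernels in the resolution half and at the splice are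
fibrant by definition, and heredity propagates fibrancy of B upwards through the coresolution half.
-/
lemma fibrant_cycles (hM : M.IsHereditary) (r : M.Resolution B) (hB : M.R B) (i : ℤ) :
    M.R (r.complex.cycles i) := by
  suffices h : ∀ i j : ℤ, i + 1 = j → M.R (kernel (r.complex.d i j)) from
    M.right_pair.right_of_iso (IsLimit.conePointUniqueUpToIso (limit.isLimit _)
      (r.complex.cyclesIsKernel i (i + 1) (ComplexShape.next_eq' _ rfl))) (h _ _ rfl)
  rintro (n | _ | n) j hij
  · obtain rfl : j = .ofNat (n + 1) := by
      simp only [Int.ofNat_eq_natCast] at hij ⊢; omega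
    exact r.fibrant_ker_L hM hB n
  · obtain rfl : j = .ofNat 0 := by
      simp only [Int.ofNat_eq_natCast] at hij ⊢; omega
    exact M.right_pair.right_of_iso (kernelCompMono r.ε r.η).symm r.fibrant_ker_ε
  · obtain rfl : j = .negSucc n := by omega
    rw [complex_d_negSucc]
    exact r.fibrant_ker_d n

lemma trivial_X (r : M.Resolution A) : ∀ i : ℤ, M.W (r.complex.X i)
  | .ofNat n => (r.triviallyFibrant n).1
  | .negSucc n => (r.triviallyCofibrant n).2

lemma isCofibrantSequence (hM : M.IsHereditary) (r : M.Resolution A) (hA : M.Q A) {i j : ℤ}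
    (hij : i + 1 = j) : M.IsCofibrantSequence (cyclesSequence r.complex i j) where
  shortExact := r.shortExact_cyclesSequence hij
  -- The terms of the coresolution half are not cofibrant by definition; they become so as
  -- extensions of cofibrant cycles.
  mid := ⟨M.left_pair.left_ext (r.shortExact_cyclesSequence hij) (r.cofibrant_cycles hM hA i)
    (r.cofibrant_cycles hM hA j), r.trivial_X i⟩
  right := r.cofibrant_cycles hM hA j

lemma isFibrantSequence (hM : M.IsHereditary) (r : M.Resolution B) (hB : M.R B) {i j : ℤ}
    (hij : i + 1 = j) : M.IsFibrantSequence (cyclesSequence r.complex i j) where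
  shortExact := r.shortExact_cyclesSequence hij
  mid := ⟨r.trivial_X i, M.right_pair.right_ext (r.shortExact_cyclesSequence hij)
    (r.fibrant_cycles hM hB i) (r.fibrant_cycles hM hB j)⟩
  left := r.fibrant_cycles hM hB i

/-- A resolved object is the object of cycles of degree zero. -/
noncomputable def cyclesZeroIso (r : M.Resolution A) : A ≅ r.complex.cycles 0 :=
  IsLimit.conePointUniqueUpToIso r.exact_L_zero.fIsKernel
    (r.complex.cyclesIsKernel 0 1 (ComplexShape.next_eq' _ rfl))

lemma cyclesZeroIso_hom_i (r : M.Resolution A) :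
    r.cyclesZeroIso.hom ≫ r.complex.iCycles 0 = r.η :=
  IsLimit.conePointUniqueUpToIso_hom_comp r.exact_L_zero.fIsKernel
    (r.complex.cyclesIsKernel 0 1 (ComplexShape.next_eq' _ rfl)) .zero

lemma cyclesZeroIso_naturality {r : M.Resolution A} {r' : M.Resolution B} {f : A ⟶ B}
    {φ : r.complex ⟶ r'.complex} (h : Extends r r' f φ) :
    f ≫ r'.cyclesZeroIso.hom =
      r.cyclesZeroIso.hom ≫ HomologicalComplex.cyclesMap φ 0 := by
  rw [← cancel_mono (r'.complex.iCycles 0), Category.assoc, Category.assoc,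
    HomologicalComplex.cyclesMap_i, r'.cyclesZeroIso_hom_i]
  -- The cycles of degree 0 embed in L⁰, so only the condition of `Extends` on the coresolution half
  -- enters.
  refine h.2.symm.trans ?_
  rw [← r.cyclesZeroIso_hom_i]
  exact Category.assoc _ _ _

/-- By `cyclesMap_sub_of_homotopy` the difference factors through a trivially cofibrant term of the
first complex, and its target is fibrant. -/
lemma toStable_cyclesMap_eq (hM : M.IsHereditary) {r : M.Resolution A} {r' : M.Resolution B}
    (hA : M.Q A) (hB : M.R B) {φ ψ : r.complex ⟶ r'.complex}
    (h : (HomotopyCategory.quotient C (ComplexShape.up ℤ)).map φ =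
      (HomotopyCategory.quotient C (ComplexShape.up ℤ)).map ψ) (j : ℤ) :
    M.toStable.map (HomologicalComplex.cyclesMap φ j) =
      M.toStable.map (HomologicalComplex.cyclesMap ψ j) := by
  rw [← sub_eq_zero, ← Functor.map_sub,
    cyclesMap_sub_of_homotopy (HomotopyCategory.homotopyOfEq _ _ h) (sub_add_cancel j 1) rfl]
  exact toStable_map_comp_eq_zero_left (r.isCofibrantSequence hM hA (i := j) rfl).mid
    (r'.fibrant_cycles hM hB j) _ _

end Resolution

/-! ### Syzygies as functors on the homotopy category -/

section Syzygy

/-- This makes `syzygy` well defined and functorial: homotopic morphisms of objects extend to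
homotopic morphisms of complexes, and these agree stably on cycles. -/
lemma toStable_cyclesMap_eq_of_hoMk_eq (hM : M.IsHereditary)
    {ρ : ∀ A : C, M.BifibrantReplacement A} {res : ∀ A : C, M.Resolution A} {A B : C} {f g : (ρ A).obj ⟶ (ρ B).obj}
    {φ ψ : (res (ρ A).obj).complex ⟶ (res (ρ B).obj).complex}
    (hφ : Resolution.Extends _ _ f φ) (hψ : Resolution.Extends _ _ g ψ)
    (h : hoMk ρ f = hoMk ρ g) (i : ℤ) :
    M.toStable.map (HomologicalComplex.cyclesMap φ i) =
      M.toStable.map (HomologicalComplex.cyclesMap ψ i) :=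
  Resolution.toStable_cyclesMap_eq hM (ρ A).cofibrant (ρ B).fibrant
    (quotient_map_eq_of_homotopic hφ hψ ((hoMk_eq_iff _ _).1 h)) i

variable (hM : M.IsHereditary) (ρ : ∀ A : C, M.BifibrantReplacement A)
  (res : ∀ A : C, M.Resolution A)

/-- A representative of a morphism of `Ho(M)`. -/
noncomputable def hoRep {A B : C} (f : hoObj ρ A ⟶ hoObj ρ B) : (ρ A).obj ⟶ (ρ B).obj :=
  (hoMk_surjective f).choose

lemma hoMk_hoRep {A B : C} (f : hoObj ρ A ⟶ hoObj ρ B) : hoMk ρ (hoRep ρ f) = f :=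
  (hoMk_surjective f).choose_spec

/-- The functor that sends `A` to the cycles of degree `i` in the resolution of `RQA`. -/
noncomputable def syzygy (i : ℤ) : Ho ρ ⥤ M.Stable where
  obj A := M.toStable.obj ((res (ρ A).obj).complex.cycles i)
  map {A B} f := M.toStable.map
    (HomologicalComplex.cyclesMap (extension res (hoRep ρ (A := A) (B := B) f)) i)
  map_id (A : C) := by
    rw [← M.toStable.map_id, ← HomologicalComplex.cyclesMap_id]
    exact toStable_cyclesMap_eq_of_hoMk_eq hM (extends_extension res _)
      (Resolution.extends_id _) ((hoMk_hoRep ρ (𝟙 (hoObj ρ A))).trans (hoMk_id A).symm) i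
  map_comp {A B D : C} f g := by
    rw [← M.toStable.map_comp, ← HomologicalComplex.cyclesMap_comp]
    refine toStable_cyclesMap_eq_of_hoMk_eq hM (extends_extension res _)
      ((extends_extension res _).comp (extends_extension res _)) ?_ i
    exact (hoMk_hoRep ρ _).trans
      ((congrArg₂ (· ≫ ·) (hoMk_hoRep ρ f) (hoMk_hoRep ρ g)).symm.trans (hoMk_comp _ _).symm)

lemma syzygy_map {A B : C} (f : (ρ A).obj ⟶ (ρ B).obj) (i : ℤ) :
    (syzygy hM ρ res i).map (hoMk ρ f) =
      M.toStable.map (HomologicalComplex.cyclesMap (extension res f) i) :=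
  toStable_cyclesMap_eq_of_hoMk_eq hM (extends_extension res _) (extends_extension res _)
    (hoMk_hoRep ρ (hoMk ρ f)) i

/-- The sequences `Zⁱ ⟶ Wⁱ ⟶ Zⁱ⁺¹` of the resolution of `RQA`, as a functor to core
sequences. -/
noncomputable def syzygySequence {i j : ℤ} (hij : i + 1 = j) : Ho ρ ⥤ M.CoreSequence where
  obj A :=
    { seq := cyclesSequence (res (ρ A).obj).complex i j
      cofibrant := (res (ρ A).obj).isCofibrantSequence hM (ρ A).cofibrant hij
      fibrant := (res (ρ A).obj).isFibrantSequence hM (ρ A).fibrant hij }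
  map {A B} f := ⟨(syzygy hM ρ res i).map f, (syzygy hM ρ res j).map f,
    .of_hom (cyclesSequenceMap (extension res (hoRep ρ (A := A) (B := B) f)) i j)⟩
  map_id A := CoreSequence.hom_ext_of_left ((syzygy hM ρ res i).map_id A)
  map_comp f g := CoreSequence.hom_ext_of_left ((syzygy hM ρ res i).map_comp f g)

/-- The cycles of degree zero in the resolution of `RQA` are `RQA`. -/
noncomputable def syzygyZeroIso : syzygy hM ρ res 0 ≅ hoInclusion ρ :=
  (NatIso.ofComponents (F := hoInclusion ρ) (G := syzygy hM ρ res 0)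
    (fun (A : C) => M.toStable.mapIso (res (ρ A).obj).cyclesZeroIso)
    (fun {A B : C} f => by
      obtain ⟨f, rfl⟩ := hoMk_surjective (ρ := ρ) (A := A) (B := B) f
      rw [syzygy_map]
      refine (M.toStable.map_comp _ _).symm.trans (Eq.trans ?_ (M.toStable.map_comp _ _))
      rw [← Resolution.cyclesZeroIso_naturality (extends_extension res f)])).symm

variable {S : C → C} (s : ∀ X : C, M.TrivialSequence X (S X))
  {Λ : C → C} (l : ∀ X : C, M.TrivialSequence (Λ X) X)

/-- The cycles of degree `n ≥ 0` are given by the `n`-fold suspension. -/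
noncomputable def syzygyIsoSuspension : ∀ (n : ℕ) (i : ℤ), i = n →
    (syzygy hM ρ res i ≅ iterateFunctor (suspension hM ρ s) n ⋙ hoInclusion ρ)
  | 0, _, rfl => syzygyZeroIso hM ρ res
  -- The core sequence Zⁿ → Wⁿ → Zⁿ⁺¹ has left term Σⁿ by recursion, so its right term is the
  -- suspension of Σⁿ.
  | n + 1, _, rfl => rightIsoSuspension hM ρ s
      (syzygySequence hM ρ res (i := n) (Nat.cast_succ n).symm) _ (syzygyIsoSuspension n n rfl)

/-- The cycles of degree `-n ≤ 0` are given by the `n`-fold loop objects. -/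
noncomputable def syzygyIsoLoop : ∀ (n : ℕ) (i : ℤ), i = -n →
    (syzygy hM ρ res i ≅ iterateFunctor (loop hM ρ l) n ⋙ hoInclusion ρ)
  | 0, _, rfl => syzygyZeroIso hM ρ res
  -- Here i = -(n+1), and the recursion identifies the right term Z⁻ⁿ of the sequence.
  | n + 1, i, h => leftIsoLoop hM ρ l
      (syzygySequence hM ρ res (i := i) (j := -n) (by omega)) _ (syzygyIsoLoop n _ rfl)

/-- The cycles of degree `n` are given by `Σⁿ`. -/
noncomputable def syzygyIsoSuspensionPow :
    ∀ n : ℤ, syzygy hM ρ res n ≅ suspensionPow hM ρ s l n ⋙ hoInclusion ρ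
  | .ofNat n => syzygyIsoSuspension hM ρ res s n _ rfl
  | .negSucc n => syzygyIsoLoop hM ρ res l (n + 1) _ (by omega)

/-- The cycles of degree `-n` are given by `Ωⁿ`. -/
noncomputable def syzygyIsoLoopPow :
    ∀ n : ℤ, syzygy hM ρ res (-n) ≅ loopPow hM ρ s l n ⋙ hoInclusion ρ
  | .ofNat n => syzygyIsoLoop hM ρ res l n _ rfl
  | .negSucc n => syzygyIsoSuspension hM ρ res s (n + 1) _ (by omega)

end Syzygy

end AbelianModelStructure

/-! ### Cohomology classes -/

/-- Two surjective homomorphisms with the same kernel have isomorphic targets. -/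
noncomputable def addEquivOfSurjective {F G H : Type*} [AddGroup F] [AddGroup G] [AddGroup H]
    (p : F →+ G) (q : F →+ H) (hp : Function.Surjective p) (hq : Function.Surjective q)
    (h : ∀ x, p x = 0 ↔ q x = 0) : G ≃+ H :=
  addEquivOfRel (fun x y => ∃ z, p z = x ∧ q z = y)
    (by
      rintro _ _ _ _ ⟨z, rfl, rfl⟩ ⟨z', rfl, rfl⟩
      exact ⟨z + z', map_add _ _ _, map_add _ _ _⟩)
    (fun x => by obtain ⟨z, hz⟩ := hp x; exact ⟨_, z, hz, rfl⟩)
    (fun y => by obtain ⟨z, hz⟩ := hq y; exact ⟨_, z, rfl, hz⟩)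
    (by
      rintro _ _ _ ⟨z, rfl, rfl⟩ ⟨z', e, rfl⟩
      rw [← sub_eq_zero, ← map_sub, ← h, map_sub, e, sub_self])
    (by
      rintro _ _ _ ⟨z, rfl, rfl⟩ ⟨z', rfl, e⟩
      rw [← sub_eq_zero, ← map_sub, h, map_sub, e, sub_self])

lemma addEquivOfSurjective_apply {F G H : Type*} [AddGroup F] [AddGroup G] [AddGroup H]
    (p : F →+ G) (q : F →+ H) (hp : Function.Surjective p) (hq : Function.Surjective q)
    (h : ∀ x, p x = 0 ↔ q x = 0) (x : F) : addEquivOfSurjective p q hp hq h (p x) = q x :=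
  addEquivOfRel_apply _ _ _ _ _ ⟨x, rfl, rfl⟩

section HomologyClass

variable {ι : Type*} {c : ComplexShape ι} (L : HomologicalComplex AddCommGrpCat.{v} c)

/-- The homology class of a morphism to the cycles. -/
noncomputable def homologyClass {G : AddCommGrpCat.{v}} {j k : ι} (hk : c.next j = k)
    (f : G ⟶ L.X j) (hf : f ≫ L.d j k = 0) : G ⟶ L.homology j :=
  L.liftCycles f k hk hf ≫ L.homologyπ j

variable {L}

lemma homologyClass_naturality {L' : HomologicalComplex AddCommGrpCat.{v} c} (ψ : L ⟶ L')
    {G G' : AddCommGrpCat.{v}} {j k : ι} (hk : c.next j = k)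
    {f : G ⟶ L.X j} (hf : f ≫ L.d j k = 0) {f' : G' ⟶ L'.X j} (hf' : f' ≫ L'.d j k = 0)
    (g : G ⟶ G') (h : g ≫ f' = f ≫ ψ.f j) :
    g ≫ homologyClass L' hk f' hf' =
      homologyClass L hk f hf ≫ HomologicalComplex.homologyMap ψ j := by
  rw [homologyClass, homologyClass, Category.assoc, HomologicalComplex.homologyπ_naturality,
    ← Category.assoc, ← Category.assoc]
  congr 1
  rw [← cancel_mono (L'.iCycles j)]
  simp [h]

lemma homologyClass_surjective {G : AddCommGrpCat.{v}} {j k : ι} (hk : c.next j = k)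
    (f : G ⟶ L.X j) (hf : f ≫ L.d j k = 0) (h : ∀ x, L.d j k x = 0 → ∃ y, f y = x) :
    Function.Surjective (homologyClass L hk f hf) := by
  intro z
  obtain ⟨z, rfl⟩ := (AddCommGrpCat.epi_iff_surjective (L.homologyπ j)).1 inferInstance z
  obtain ⟨y, hy⟩ := h (L.iCycles j z) (by rw [← ConcreteCategory.comp_apply]; simp)
  refine ⟨y, ?_⟩
  rw [homologyClass, ConcreteCategory.comp_apply]
  congr 1
  apply (AddCommGrpCat.mono_iff_injective (L.iCycles j)).1 inferInstance
  rw [← hy, ← ConcreteCategory.comp_apply, HomologicalComplex.liftCycles_i]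

/-- Homology is the cokernel of the map from the previous term to the cycles, and the cycles embed
in the term of degree j, where the two sides can be compared. -/
lemma homologyClass_eq_zero_iff {G : AddCommGrpCat.{v}} {i j k : ι} (hi : c.prev j = i)
    (hk : c.next j = k) (f : G ⟶ L.X j) (hf : f ≫ L.d j k = 0) (y : G) :
    homologyClass L hk f hf y = 0 ↔ ∃ x, L.d i j x = f y := by
  have hex : (ShortComplex.mk (L.toCycles i j) (L.homologyπ j) (by simp)).Exact :=
    ShortComplex.exact_of_g_is_cokernel _ (L.homologyIsCokernel i j hi)
  rw [ShortComplex.ab_exact_iff] at hex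
  have hinj := (AddCommGrpCat.mono_iff_injective (L.iCycles j)).1 inferInstance
  have e : L.iCycles j (L.liftCycles f k hk hf y) = f y := by
    rw [← ConcreteCategory.comp_apply, HomologicalComplex.liftCycles_i]
  rw [homologyClass, ConcreteCategory.comp_apply]
  constructor
  · intro h
    obtain ⟨x, hx⟩ := hex _ h
    refine ⟨x, ?_⟩
    rw [← e, ← L.toCycles_i i j, ConcreteCategory.comp_apply]
    exact congrArg _ hx
  · rintro ⟨x, hx⟩
    have : L.toCycles i j x = L.liftCycles f k hk hf y := by
      apply hinj
      rw [e, ← hx, ← ConcreteCategory.comp_apply, HomologicalComplex.toCycles_i]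
    rw [← this, ← ConcreteCategory.comp_apply]
    simp

end HomologyClass

/-! ### Cocycles of Hom complexes as morphisms from or to cycles -/

section HomClasses

variable {C : Type u} [Category.{v} C] [Abelian C]

/-- The class in `Hⁿ Hom(K, B)` of a morphism `Z⁻ⁿ ⟶ B`. -/
noncomputable def classInto (K : CochainComplex C ℤ) (B : C) (n : ℤ) :
    (preadditiveYoneda.obj B).obj (op (K.cycles (-n))) ⟶
      ((cohomologyInto n).obj (op K)).obj B :=
  -- Chain degree n is cochain degree -1-n, and the differentials of `homInto` lower the cochain
  -- degree. The cocycle attached to Z⁻ⁿ → B is its composite with the map from degree -1-n to Z⁻ⁿ.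
  homologyClass ((homInto.obj (op K)).obj B) (j := -1 - n) (k := -1 - n - 1)
    (ComplexShape.next_eq' _ (show -1 - n - 1 + 1 = -1 - n by omega))
    ((preadditiveYoneda.obj B).map (K.toCycles (-1 - n) (-n)).op)
    (((preadditiveYoneda.obj B).map_comp _ _).symm.trans
      ((congrArg (fun f => (preadditiveYoneda.obj B).map (Quiver.Hom.op f))
        (K.d_toCycles (-1 - n - 1) (-1 - n) (-n))).trans
          ((preadditiveYoneda.obj B).map_zero _ _)))

/-- The class in `Hⁿ Hom(A, K)` of a morphism `A ⟶ Zⁿ`. -/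
noncomputable def classFrom (A : C) (K : CochainComplex C ℤ) (n : ℤ) :
    (preadditiveCoyoneda.obj (op A)).obj (K.cycles n) ⟶
      ((cohomologyFrom n).obj (op A)).obj K :=
  homologyClass ((homFrom.obj (op A)).obj K) (j := n) (k := n + 1)
    (ComplexShape.next_eq' _ rfl)
    ((preadditiveCoyoneda.obj (op A)).map (K.iCycles n))
    (((preadditiveCoyoneda.obj (op A)).map_comp _ _).symm.trans (by
      rw [K.iCycles_d]; exact (preadditiveCoyoneda.obj (op A)).map_zero _ _))

lemma classInto_map_app {K L : CochainComplex C ℤ} (φ : K ⟶ L) {B : C} {n : ℤ}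
    (f : L.cycles (-n) ⟶ B) :
    classInto K B n (HomologicalComplex.cyclesMap φ (-n) ≫ f) =
      ((cohomologyInto n).map φ.op).app B (classInto L B n f) := by
  refine ConcreteCategory.congr_hom (homologyClass_naturality
    ((homInto.map φ.op).app B) _ _ _
    ((preadditiveYoneda.obj B).map (HomologicalComplex.cyclesMap φ (-n)).op) ?_) f
  exact ((preadditiveYoneda.obj B).map_comp _ _).symm.trans
    ((congrArg (fun f => (preadditiveYoneda.obj B).map (Quiver.Hom.op f))
      (toCycles_cyclesMap φ (-1 - n) (-n))).trans ((preadditiveYoneda.obj B).map_comp _ _))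

lemma classInto_map {K : CochainComplex C ℤ} {B B' : C} (g : B ⟶ B') {n : ℤ}
    (f : K.cycles (-n) ⟶ B) :
    classInto K B' n (f ≫ g) = ((cohomologyInto n).obj (op K)).map g (classInto K B n f) :=
  ConcreteCategory.congr_hom (homologyClass_naturality ((homInto.obj (op K)).map g) _ _ _
    ((preadditiveYoneda.map g).app (op (K.cycles (-n))))
    ((preadditiveYoneda.map g).naturality _).symm) f

lemma classFrom_map_app {A A' : C} (g : A ⟶ A') {K : CochainComplex C ℤ} {n : ℤ}
    (f : A' ⟶ K.cycles n) :
    classFrom A K n (g ≫ f) = ((cohomologyFrom n).map g.op).app K (classFrom A' K n f) :=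
  ConcreteCategory.congr_hom (homologyClass_naturality ((homFrom.map g.op).app K) _ _ _
    ((preadditiveCoyoneda.map g.op).app (K.cycles n))
    ((preadditiveCoyoneda.map g.op).naturality _).symm) f

lemma classFrom_map {A : C} {K L : CochainComplex C ℤ} (φ : K ⟶ L) {n : ℤ}
    (f : A ⟶ K.cycles n) :
    classFrom A L n (f ≫ HomologicalComplex.cyclesMap φ n) =
      ((cohomologyFrom n).obj (op A)).map φ (classFrom A K n f) := by
  refine ConcreteCategory.congr_hom (homologyClass_naturality
    ((homFrom.obj (op A)).map φ) _ _ _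
    ((preadditiveCoyoneda.obj (op A)).map (HomologicalComplex.cyclesMap φ n)) ?_) f
  refine ((preadditiveCoyoneda.obj (op A)).map_comp _ _).symm.trans
    (Eq.trans ?_ ((preadditiveCoyoneda.obj (op A)).map_comp _ _))
  rw [HomologicalComplex.cyclesMap_i]

/-- Exactness enters here: it makes Z⁻ⁿ the cokernel of the differential into degree -1-n, so a
cocycle factors through Z⁻ⁿ. -/
lemma classInto_surjective {K : CochainComplex C ℤ} (hK : ∀ i, K.ExactAt i) (B : C) (n : ℤ) :
    Function.Surjective (classInto K B n) := by
  refine homologyClass_surjective _ _ _ fun (g : K.X (-1 - n) ⟶ B) hg => ?_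
  have : Epi (ShortComplex.mk _ _ (K.d_toCycles (-1 - n - 1) (-1 - n) (-n))).g :=
    epi_toCycles (by omega) (hK _)
  have hex := exact_d_toCycles (K := K) (i := -1 - n - 1) (j := -1 - n) (k := -n)
    (by omega) (by omega) (hK _)
  exact ⟨hex.desc g hg, hex.g_desc g hg⟩

lemma classInto_eq_zero_iff {K : CochainComplex C ℤ} (hK : ∀ i, K.ExactAt i) {B : C} {n : ℤ}
    (f : K.cycles (-n) ⟶ B) :
    classInto K B n f = 0 ↔ ∃ g : K.X (-n) ⟶ B, K.iCycles (-n) ≫ g = f := by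
  have := epi_toCycles (i := -1 - n) (j := -n) (by omega) (hK _)
  refine (homologyClass_eq_zero_iff (L := (homInto.obj (op K)).obj B)
    (G := (preadditiveYoneda.obj B).obj (op (K.cycles (-n)))) (i := -n)
    (ComplexShape.prev_eq' _ (show -1 - n + 1 = -n by omega)) _ _ _ f).trans ?_
  change (∃ g : K.X (-n) ⟶ B, K.d (-1 - n) (-n) ≫ g = K.toCycles (-1 - n) (-n) ≫ f) ↔ _
  refine exists_congr fun g => ?_
  rw [← K.toCycles_i, Category.assoc, cancel_epi]

/-- Cycles are kernels in any complex, so the covariant case does not depend on exactness. -/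
lemma classFrom_surjective (A : C) (K : CochainComplex C ℤ) (n : ℤ) :
    Function.Surjective (classFrom A K n) := by
  refine homologyClass_surjective _ _ _ fun (g : A ⟶ K.X n) hg => ?_
  exact ⟨K.liftCycles g (n + 1) (ComplexShape.next_eq' _ rfl) hg, K.liftCycles_i _ _ _ _⟩

lemma classFrom_eq_zero_iff {A : C} {K : CochainComplex C ℤ} {n : ℤ} (f : A ⟶ K.cycles n) :
    classFrom A K n f = 0 ↔ ∃ g : A ⟶ K.X (n - 1), g ≫ K.toCycles (n - 1) n = f := by
  refine (homologyClass_eq_zero_iff (L := (homFrom.obj (op A)).obj K)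
    (G := (preadditiveCoyoneda.obj (op A)).obj (K.cycles n)) (i := n - 1)
    (ComplexShape.prev_eq' _ (show n - 1 + 1 = n by omega)) _ _ _ f).trans ?_
  change (∃ g : A ⟶ K.X (n - 1), g ≫ K.d (n - 1) n = f ≫ K.iCycles n) ↔ _
  refine exists_congr fun g => ?_
  rw [← K.toCycles_i, ← Category.assoc, cancel_mono]

end HomClasses

namespace AbelianModelStructure

variable {M : AbelianModelStructure.{w} C}

/-! ### Cohomology groups as groups of stable morphisms -/

section StableCohomology

variable {A B : C}

/-- `Hⁿ Hom(W_A, B)` is the group of stable morphisms `Z⁻ⁿ(W_A) ⟶ B`. -/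
noncomputable def stableEquivInto (hM : M.IsHereditary) (r : M.Resolution A) (hA : M.Q A)
    (hB : M.R B) (n : ℤ) :
    (M.toStable.obj (r.complex.cycles (-n)) ⟶ M.toStable.obj B) ≃+
      ((cohomologyInto n).obj (op r.complex)).obj B :=
  addEquivOfSurjective (F := r.complex.cycles (-n) ⟶ B) M.toStable.mapAddHom
    (classInto r.complex B n).hom M.toStable.map_surjective (classInto_surjective r.exactAt B n)
    (fun f => by
      -- The two kernels to compare: stably zero, and extendable to W⁻ⁿ. A morphism through V in the
      -- core extends because Z¹⁻ⁿ is cofibrant and V trivially fibrant. Conversely, an extendable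
      -- morphism factors through the trivially cofibrant W⁻ⁿ on its way to the fibrant B.
      have hS := r.isCofibrantSequence hM hA (i := -n) rfl
      refine Iff.trans ?_ (classInto_eq_zero_iff r.exactAt f).symm
      constructor
      · intro h
        obtain ⟨V, a, b, hV, rfl⟩ := (toStable_map_eq_zero_iff f).1 h
        obtain ⟨a', ha'⟩ := exists_extend_of_shortExact hS.shortExact
          (fun e => M.left_pair.ext_eq_zero hS.right ⟨hV.1.2, hV.2⟩ e) a
        exact ⟨a' ≫ b, by rw [← Category.assoc]; exact congrArg (· ≫ b) ha'⟩
      · rintro ⟨g, rfl⟩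
        exact toStable_map_comp_eq_zero_left hS.mid hB _ _)

lemma stableEquivInto_apply (hM : M.IsHereditary) (r : M.Resolution A) (hA : M.Q A)
    (hB : M.R B) (n : ℤ) (f : r.complex.cycles (-n) ⟶ B) :
    stableEquivInto hM r hA hB n (M.toStable.map f) = classInto r.complex B n f :=
  addEquivOfSurjective_apply (F := r.complex.cycles (-n) ⟶ B) M.toStable.mapAddHom
    (classInto r.complex B n).hom _ _ _ f

/-- `Hⁿ Hom(A, W^B)` is the group of stable morphisms `A ⟶ Zⁿ(W^B)`. -/
noncomputable def stableEquivFrom (hM : M.IsHereditary) (r : M.Resolution B) (hA : M.Q A)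
    (hB : M.R B) (n : ℤ) :
    (M.toStable.obj A ⟶ M.toStable.obj (r.complex.cycles n)) ≃+
      ((cohomologyFrom n).obj (op A)).obj r.complex :=
  addEquivOfSurjective (F := A ⟶ r.complex.cycles n) M.toStable.mapAddHom
    (classFrom A r.complex n).hom M.toStable.map_surjective (classFrom_surjective A r.complex n)
    (fun f => by
      -- Coboundaries are the morphisms that lift along Wⁿ⁻¹ → Zⁿ. Those through the core lift
      -- because Zⁿ⁻¹ is fibrant; those that lift factor from the cofibrant A through a trivially
      -- fibrant object.
      have hS := r.isFibrantSequence hM hB (i := n - 1) (j := n) (by omega)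
      refine Iff.trans ?_ (classFrom_eq_zero_iff f).symm
      constructor
      · intro h
        obtain ⟨V, a, b, hV, rfl⟩ := (toStable_map_eq_zero_iff f).1 h
        obtain ⟨b', hb'⟩ := exists_lift_of_shortExact hS.shortExact
          (M.right_pair.ext_eq_zero hV.1 hS.left) b
        exact ⟨a ≫ b', by rw [Category.assoc]; exact congrArg (a ≫ ·) hb'⟩
      · rintro ⟨g, rfl⟩
        exact toStable_map_comp_eq_zero_right hA hS.mid _ _)

lemma stableEquivFrom_apply (hM : M.IsHereditary) (r : M.Resolution B) (hA : M.Q A)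
    (hB : M.R B) (n : ℤ) (f : A ⟶ r.complex.cycles n) :
    stableEquivFrom hM r hA hB n (M.toStable.map f) = classFrom A r.complex n f :=
  addEquivOfSurjective_apply (F := A ⟶ r.complex.cycles n) M.toStable.mapAddHom
    (classFrom A r.complex n).hom _ _ _ f

end StableCohomology

/-! ### The natural isomorphisms between morphisms in Ho(M) and Ext -/

section ExtIso

variable (hM : M.IsHereditary) (ρ : ∀ A : C, M.BifibrantReplacement A)
  (res : ∀ A : C, M.Resolution A)

/-- `ℓExtⁿ` in terms of the syzygies of the first argument. -/
noncomputable def lExtIso (n : ℤ) : (syzygy hM ρ res (-n)).op ⋙ preadditiveCoyoneda ⋙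
    (Functor.whiskeringLeft _ _ _).obj (hoInclusion ρ) ≅ lExt hM ρ res n :=
  NatIso.ofComponents (fun A => NatIso.ofComponents
    (fun B => (stableEquivInto hM (res (ρ A.unop).obj) (ρ A.unop).cofibrant
      (ρ B).fibrant n).toAddCommGrpIso)
    (fun {B B' : C} g => by
      -- With representatives chosen for both the morphism of Ho(M) and the stable class, naturality
      -- becomes that of `classInto`.
      obtain ⟨g, rfl⟩ := hoMk_surjective (ρ := ρ) (A := B) (B := B') g
      ext x
      obtain ⟨x, rfl⟩ := M.toStable.map_surjective x
      refine Eq.trans ?_ ((classInto_map g x).trans (congrArg _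
        (stableEquivInto_apply hM (res (ρ A.unop).obj) (ρ A.unop).cofibrant
          (ρ B).fibrant n x).symm))
      refine Eq.trans ?_ (stableEquivInto_apply hM (res (ρ A.unop).obj) (ρ A.unop).cofibrant
          (ρ B').fibrant n (x ≫ g))
      exact congrArg (stableEquivInto hM (res (ρ A.unop).obj) (ρ A.unop).cofibrant
        (ρ B').fibrant n) (M.toStable.map_comp x g).symm))
    (fun {A A'} f => by
      obtain ⟨f₀, hf⟩ := hoMk_surjective (ρ := ρ) (A := A'.unop) (B := A.unop) f.unop
      obtain rfl : f = (hoMk ρ f₀).op := Quiver.Hom.unop_inj hf.symm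
      ext B x
      obtain ⟨x, rfl⟩ := M.toStable.map_surjective x
      refine Eq.trans ?_ ((classInto_map_app (extension res f₀) x).trans (congrArg _
        (stableEquivInto_apply hM (res (ρ A.unop).obj) (ρ A.unop).cofibrant
          (ρ B).fibrant n x).symm))
      refine Eq.trans ?_ (stableEquivInto_apply hM (res (ρ A'.unop).obj) (ρ A'.unop).cofibrant
          (ρ B).fibrant n _)
      refine congrArg (stableEquivInto hM (res (ρ A'.unop).obj) (ρ A'.unop).cofibrant
        (ρ B).fibrant n) (Eq.trans ?_ (M.toStable.map_comp _ _).symm)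
      -- `syzygy` uses its own representative of the morphism; `syzygy_map` exchanges it for f₀.
      exact congrArg (· ≫ M.toStable.map x) (syzygy_map hM ρ res f₀ (-n)))

/-- `rExtⁿ` in terms of the cycles of the resolution of the second argument. -/
noncomputable def rExtIso (n : ℤ) : (hoInclusion ρ).op ⋙ preadditiveCoyoneda ⋙
    (Functor.whiskeringLeft _ _ _).obj (syzygy hM ρ res n) ≅ rExt hM ρ res n :=
  NatIso.ofComponents (fun A => NatIso.ofComponents
    (fun B => (stableEquivFrom hM (res (ρ B).obj) (ρ A.unop).cofibrant
      (ρ B).fibrant n).toAddCommGrpIso)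
    (fun {B B' : C} g => by
      obtain ⟨g, rfl⟩ := hoMk_surjective (ρ := ρ) (A := B) (B := B') g
      ext x
      obtain ⟨x, rfl⟩ := M.toStable.map_surjective x
      refine Eq.trans ?_ ((classFrom_map (extension res g) x).trans (congrArg _
        (stableEquivFrom_apply hM (res (ρ B).obj) (ρ A.unop).cofibrant
          (ρ B).fibrant n x).symm))
      refine Eq.trans ?_ (stableEquivFrom_apply hM (res (ρ B').obj) (ρ A.unop).cofibrant
          (ρ B').fibrant n _)
      refine congrArg (stableEquivFrom hM (res (ρ B').obj) (ρ A.unop).cofibrant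
        (ρ B').fibrant n) (Eq.trans ?_ (M.toStable.map_comp _ _).symm)
      exact congrArg (M.toStable.map x ≫ ·) (syzygy_map hM ρ res g n)))
    (fun {A A'} f => by
      obtain ⟨f₀, hf⟩ := hoMk_surjective (ρ := ρ) (A := A'.unop) (B := A.unop) f.unop
      obtain rfl : f = (hoMk ρ f₀).op := Quiver.Hom.unop_inj hf.symm
      ext B x
      obtain ⟨x, rfl⟩ := M.toStable.map_surjective x
      refine Eq.trans ?_ ((classFrom_map_app f₀ x).trans (congrArg _
        (stableEquivFrom_apply hM (res (ρ B).obj) (ρ A.unop).cofibrant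
          (ρ B).fibrant n x).symm))
      refine Eq.trans ?_ (stableEquivFrom_apply hM (res (ρ B).obj) (ρ A'.unop).cofibrant
          (ρ B).fibrant n (f₀ ≫ x))
      exact congrArg (stableEquivFrom hM (res (ρ B).obj) (ρ A'.unop).cofibrant
        (ρ B).fibrant n) (M.toStable.map_comp f₀ x).symm)

variable {S : C → C} (s : ∀ X : C, M.TrivialSequence X (S X))
  {Λ : C → C} (l : ∀ X : C, M.TrivialSequence (Λ X) X)

/-- `Ho(M)(Ωⁿ A, B) ≅ ℓExtⁿ(RQA, RQB)`. -/
noncomputable def loopPowIsoLExt (n : ℤ) :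
    (loopPow hM ρ s l n).op ⋙ preadditiveCoyoneda ≅ lExt hM ρ res n :=
  -- Morphisms ΩⁿA → B in Ho(M) are stable morphisms between the replacements, and the source is Z⁻ⁿ
  -- of the resolution of RQA.
  Functor.isoWhiskerLeft (loopPow hM ρ s l n).op (coyonedaIsoOfFullyFaithful (hoInclusion ρ)) ≪≫
    Functor.isoWhiskerRight (NatIso.op (syzygyIsoLoopPow hM ρ res s l n))
      (preadditiveCoyoneda ⋙ (Functor.whiskeringLeft _ _ _).obj (hoInclusion ρ)) ≪≫
    lExtIso hM ρ res n

/-- `rExtⁿ(RQA, RQB) ≅ Ho(M)(A, Σⁿ B)`. -/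
noncomputable def rExtIsoSuspensionPow (n : ℤ) :
    rExt hM ρ res n ≅ preadditiveCoyoneda ⋙ (Functor.whiskeringLeft _ _ _).obj
      (suspensionPow hM ρ s l n) :=
  (rExtIso hM ρ res n).symm ≪≫
    Functor.isoWhiskerLeft ((hoInclusion ρ).op ⋙ preadditiveCoyoneda)
      ((Functor.whiskeringLeft _ _ _).mapIso (syzygyIsoSuspensionPow hM ρ res s l n)) ≪≫
    (Functor.isoWhiskerRight (coyonedaIsoOfFullyFaithful (hoInclusion ρ))
      ((Functor.whiskeringLeft _ _ _).obj (suspensionPow hM ρ s l n))).symm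

/-- `ℓExtⁿ(RQA, RQB) ≅ rExtⁿ(RQA, RQB)`. -/
noncomputable def lExtIsoRExt (n : ℤ) : lExt hM ρ res n ≅ rExt hM ρ res n :=
  (loopPowIsoLExt hM ρ res s l n).symm ≪≫
    coyonedaIsoOfAdjunction (loopPowAdjunction hM ρ s l n) ≪≫
    (rExtIsoSuspensionPow hM ρ res s l n).symm

end ExtIso

end AbelianModelStructure

/-- Precomposition with an isomorphism, as an additive equivalence. -/
def precompAddEquiv {D : Type*} [Category* D] [Preadditive D] {X Y : D} (e : X ≅ Y) (Z : D) :
    (Y ⟶ Z) ≃+ (X ⟶ Z) where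
  toFun f := e.hom ≫ f
  invFun f := e.inv ≫ f
  left_inv f := by simp
  right_inv f := by simp
  map_add' f g := by simp

/-- Postcomposition with an isomorphism, as an additive equivalence. -/
def postcompAddEquiv {D : Type*} [Category* D] [Preadditive D] (X : D) {Y Z : D} (e : Y ≅ Z) :
    (X ⟶ Y) ≃+ (X ⟶ Z) where
  toFun f := f ≫ e.hom
  invFun f := f ≫ e.inv
  left_inv f := by simp
  right_inv f := by simp
  map_add' f g := by simp

namespace AbelianModelStructure

variable {M : AbelianModelStructure.{w} C}

/-! ### Independence of the replacements -/

section Replacement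

variable {S S' : ShortComplex C}

/-- Surjectivity is vanishing of Ext¹ of the cokernel into Z. For injectivity, if the restriction of
f factors through the core, extend the first factor and subtract: the remainder factors through the
trivially cofibrant cokernel and so is stably zero. -/
lemma precomp_bijective (hS : S.ShortExact) (h₃ : (M.Q ⊓ M.W) S.X₃) {Z : C} (hZ : M.R Z) :
    Function.Bijective (Preadditive.leftComp (M.toStable.obj Z) (M.toStable.map S.f)) := by
  have := hS.epi_g
  constructor
  · refine (injective_iff_map_eq_zero _).2 fun x hx => ?_
    obtain ⟨f, rfl⟩ := M.toStable.map_surjective x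
    obtain ⟨V, a, b, hV, e⟩ := (toStable_map_eq_zero_iff (S.f ≫ f)).1
      ((M.toStable.map_comp _ _).trans hx)
    obtain ⟨a', ha'⟩ := exists_extend_of_shortExact hS
      (fun e => M.left_pair.ext_eq_zero h₃.1 ⟨hV.1.2, hV.2⟩ e) a
    have hz : S.f ≫ (f - a' ≫ b) = 0 := by
      rw [Preadditive.comp_sub, reassoc_of% ha', e, sub_self]
    have key : f = S.g ≫ hS.exact.desc _ hz + a' ≫ b := by
      rw [hS.exact.g_desc, sub_add_cancel]
    rw [key, Functor.map_add, toStable_map_comp_eq_zero_left h₃ hZ,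
      toStable_map_comp_eq_zero_left hV.1 hZ, add_zero]
  · intro x
    obtain ⟨f, rfl⟩ := M.toStable.map_surjective x
    obtain ⟨g, hg⟩ := exists_extend_of_shortExact hS
      (fun e => M.right_pair.ext_eq_zero h₃ hZ e) f
    exact ⟨M.toStable.map g, by rw [← hg]; exact (M.toStable.map_comp _ _).symm⟩

/-- Dual to `precomp_bijective`: the obstruction to lifting, and the remainder in the injectivity
argument, both lie in the trivially fibrant kernel. -/
lemma postcomp_bijective (hS : S.ShortExact) (h₁ : (M.W ⊓ M.R) S.X₁) {X : C} (hX : M.Q X) :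
    Function.Bijective (Preadditive.rightComp (M.toStable.obj X) (M.toStable.map S.g)) := by
  have := hS.mono_f
  constructor
  · refine (injective_iff_map_eq_zero _).2 fun x hx => ?_
    obtain ⟨f, rfl⟩ := M.toStable.map_surjective x
    obtain ⟨V, a, b, hV, e⟩ := (toStable_map_eq_zero_iff (f ≫ S.g)).1
      ((M.toStable.map_comp _ _).trans hx)
    obtain ⟨b', hb'⟩ := exists_lift_of_shortExact hS
      (M.right_pair.ext_eq_zero hV.1 h₁.2) b
    have hz : (f - a ≫ b') ≫ S.g = 0 := by
      rw [Preadditive.sub_comp, Category.assoc, hb', e, sub_self]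
    have key : f = hS.exact.lift _ hz ≫ S.f + a ≫ b' := by
      rw [hS.exact.lift_f, sub_add_cancel]
    rw [key, Functor.map_add, toStable_map_comp_eq_zero_right hX h₁,
      toStable_map_comp_eq_zero_right hX ⟨hV.1.2, hV.2⟩, add_zero]
  · intro x
    obtain ⟨f, rfl⟩ := M.toStable.map_surjective x
    obtain ⟨g, hg⟩ := exists_lift_of_shortExact hS (M.left_pair.ext_eq_zero hX h₁) f
    exact ⟨M.toStable.map g, by rw [← hg]; exact (M.toStable.map_comp _ _).symm⟩

/-- Fibrant replacements are unique up to stable isomorphism. -/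
lemma FibrantReplacement.nonempty_stableIso {A : C} (a b : M.FibrantReplacement A) :
    Nonempty (M.toStable.obj a.obj ≅ M.toStable.obj b.obj) := by
  have key (a b : M.FibrantReplacement A) : ∃ f : a.obj ⟶ b.obj, a.j ≫ f = b.j :=
    exists_extend_of_shortExact (shortExact_cokernel a.j)
      (fun e => M.right_pair.ext_eq_zero a.coker b.fibrant e) b.j
  -- An endomorphism fixing j agrees with the identity after restriction along j, and that
  -- restriction is injective on stable morphisms.
  have uniq (a : M.FibrantReplacement A) {f : a.obj ⟶ a.obj} (h : a.j ≫ f = a.j) :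
      M.toStable.map f = 𝟙 _ := by
    apply (precomp_bijective (shortExact_cokernel a.j) a.coker a.fibrant).1
    exact (M.toStable.map_comp _ _).symm.trans
      ((congrArg M.toStable.map h).trans (Category.comp_id (M.toStable.map a.j)).symm)
  obtain ⟨f, hf⟩ := key a b
  obtain ⟨g, hg⟩ := key b a
  exact ⟨M.toStable.map f, M.toStable.map g,
    (M.toStable.map_comp _ _).symm.trans (uniq a (by rw [reassoc_of% hf, hg])),
    (M.toStable.map_comp _ _).symm.trans (uniq b (by rw [reassoc_of% hg, hf]))⟩

/-- Cofibrant replacements are unique up to stable isomorphism. -/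
lemma CofibrantReplacement.nonempty_stableIso {A : C} (a b : M.CofibrantReplacement A) :
    Nonempty (M.toStable.obj a.obj ≅ M.toStable.obj b.obj) := by
  have key (a b : M.CofibrantReplacement A) : ∃ f : a.obj ⟶ b.obj, f ≫ b.p = a.p :=
    exists_lift_of_shortExact (shortExact_kernel b.p)
      (M.left_pair.ext_eq_zero a.cofibrant b.ker) a.p
  have uniq (a : M.CofibrantReplacement A) {f : a.obj ⟶ a.obj} (h : f ≫ a.p = a.p) :
      M.toStable.map f = 𝟙 _ := by
    apply (postcomp_bijective (shortExact_kernel a.p) a.ker a.cofibrant).1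
    exact (M.toStable.map_comp _ _).symm.trans
      ((congrArg M.toStable.map h).trans (Category.id_comp (M.toStable.map a.p)).symm)
  obtain ⟨f, hf⟩ := key a b
  obtain ⟨g, hg⟩ := key b a
  exact ⟨M.toStable.map f, M.toStable.map g,
    (M.toStable.map_comp _ _).symm.trans (uniq a (by rw [Category.assoc, hg, hf])),
    (M.toStable.map_comp _ _).symm.trans (uniq b (by rw [Category.assoc, hf, hg]))⟩

/-- Stable morphisms from `RQA` to a fibrant object agree with those from `QA`, for every
cofibrant replacement `QA`. -/
lemma nonempty_stableEquiv_cofibrantReplacement {A : C} (ρ : M.BifibrantReplacement A)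
    (a : M.CofibrantReplacement A) {Z : C} (hZ : M.R Z) :
    Nonempty ((M.toStable.obj ρ.obj ⟶ M.toStable.obj Z) ≃+
      (M.toStable.obj a.obj ⟶ M.toStable.obj Z)) := by
  obtain ⟨e⟩ := a.nonempty_stableIso ρ.cof
  exact ⟨(AddEquiv.ofBijective _ (precomp_bijective (shortExact_cokernel ρ.fib.j)
    ρ.fib.coker hZ)).trans (precompAddEquiv e _)⟩

/-- Stable morphisms from a cofibrant object to `RQB` agree with those to `RB`, for every
fibrant replacement `RB`. -/
lemma nonempty_stableEquiv_fibrantReplacement (hM : M.IsHereditary) {B : C}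
    (ρ : M.BifibrantReplacement B) (b : M.FibrantReplacement B) {X : C} (hX : M.Q X) :
    Nonempty ((M.toStable.obj X ⟶ M.toStable.obj ρ.obj) ≃+
      (M.toStable.obj X ⟶ M.toStable.obj b.obj)) := by
  -- The pushout P of RQB ← QB → B is a fibrant replacement of B: the cokernel of B → P is that of
  -- QB → RQB, and P is fibrant by heredity. The kernel of RQB → P is that of QB → B, hence
  -- trivially fibrant, so stable morphisms from X into RQB and into P agree.
  have sq := IsPushout.of_hasPushout ρ.fib.j ρ.cof.p
  have hS := shortExact_cokernel ρ.fib.j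
  obtain ⟨p, w, hp, hP⟩ := shortExact_of_isPushout hS sq
  have : Mono (pushout.inr ρ.fib.j ρ.cof.p) := hP.mono_f
  have : Epi (pushout.inl ρ.fib.j ρ.cof.p) :=
    MorphismProperty.of_isPushout (P := MorphismProperty.epimorphisms C) sq
      ρ.cof.epi
  obtain ⟨z, hK⟩ := shortExact_kernel_of_map hS (f' := pushout.inr ρ.fib.j ρ.cof.p) (g' := p)
    ρ.cof.p (pushout.inl ρ.fib.j ρ.cof.p) (𝟙 _) pushout.condition
    (by rw [hp, Category.comp_id])
  let b' : M.FibrantReplacement B :=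
    { obj := pushout ρ.fib.j ρ.cof.p
      j := pushout.inr ρ.fib.j ρ.cof.p
      mono := hP.mono_f
      fibrant := M.right_pair.right_cokernel hM.right hK ρ.cof.ker.2 ρ.fibrant
      coker := M.right_pair.left_of_iso (IsColimit.coconePointUniqueUpToIso
        hP.gIsCokernel (colimit.isColimit _)) ρ.fib.coker }
  obtain ⟨e⟩ := b'.nonempty_stableIso b
  exact ⟨(AddEquiv.ofBijective _ (postcomp_bijective hK ρ.cof.ker hX)).trans
    (postcompAddEquiv _ e)⟩

end Replacement

/-! ### Comparison of resolutions with coresolutions -/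

section Balance

variable {A B : C}

lemma nonempty_stableShift (hM : M.IsHereditary) (r : M.Resolution A) (hA : M.Q A)
    (r' : M.Resolution B) (hB : M.R B) (k : ℕ) {i j i' j' : ℤ} (hi : i + k = i')
    (hj : j + k = j') :
    Nonempty ((M.toStable.obj (r.complex.cycles i) ⟶ M.toStable.obj (r'.complex.cycles j)) ≃+
      (M.toStable.obj (r.complex.cycles i') ⟶ M.toStable.obj (r'.complex.cycles j'))) := by
  induction k generalizing i' j' with
  | zero =>
    obtain rfl : i = i' := by simpa using hi
    obtain rfl : j = j' := by simpa using hj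
    exact ⟨AddEquiv.refl _⟩
  | succ k ih =>
    obtain ⟨e⟩ := ih rfl rfl
    exact ⟨e.trans (stableShift (r.isCofibrantSequence hM hA (i := i + k) (by lia))
      (r'.isFibrantSequence hM hB (i := j + k) (by lia)))⟩

/-- `Hⁿ Hom(W_A, B) ≅ Hⁿ Hom(A, W^B)` for cofibrant `A` and fibrant `B`. -/
lemma nonempty_cohomologyInto_equiv_cohomologyFrom (hM : M.IsHereditary) (r : M.Resolution A)
    (hA : M.Q A) (r' : M.Resolution B) (hB : M.R B) (n : ℤ) :
    Nonempty (((cohomologyInto n).obj (op r.complex)).obj B ≃+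
      ((cohomologyFrom n).obj (op A)).obj r'.complex) := by
  -- Both groups are stable morphisms between cycles of the two complexes, as Z⁰ recovers A and B.
  -- The shift by n passes from one to the other; for negative n it is used backwards.
  suffices h : Nonempty ((M.toStable.obj (r.complex.cycles (-n)) ⟶
      M.toStable.obj (r'.complex.cycles 0)) ≃+
      (M.toStable.obj (r.complex.cycles 0) ⟶ M.toStable.obj (r'.complex.cycles n))) by
    obtain ⟨e⟩ := h
    exact ⟨(stableEquivInto hM r hA hB n).symm.trans
      ((postcompAddEquiv _ (M.toStable.mapIso r'.cyclesZeroIso)).trans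
        (e.trans ((precompAddEquiv (M.toStable.mapIso r.cyclesZeroIso) _).trans
          (stableEquivFrom hM r' hA hB n))))⟩
  obtain ⟨k, rfl | rfl⟩ := n.eq_nat_or_neg
  · exact nonempty_stableShift hM r hA r' hB k (neg_add_cancel _) (zero_add _)
  · obtain ⟨e⟩ := nonempty_stableShift hM r hA r' hB k (i := 0) (j := -k) (i' := - -k)
      (j' := 0) (by lia) (by lia)
    exact ⟨e.symm⟩

end Balance

/-- The groups `ℓExtⁿ(RQA, RQB)` are computed by any resolution of a cofibrant replacement of
`A` and any fibrant replacement of `B`. -/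
lemma nonempty_lExt_equiv (hM : M.IsHereditary) (ρ : ∀ A : C, M.BifibrantReplacement A)
    (res : ∀ A : C, M.Resolution A) (n : ℤ) {A B : C} (a : M.CofibrantReplacement A)
    (b : M.FibrantReplacement B) (r' : M.Resolution b.obj) :
    Nonempty (((lExt hM ρ res n).obj (op (hoObj ρ A))).obj (hoObj ρ B) ≃+
      ((cohomologyFrom n).obj (op a.obj)).obj r'.complex) := by
  let r := res (ρ A).obj
  have hA := (ρ A).cofibrant
  obtain ⟨e₁⟩ := nonempty_stableEquiv_fibrantReplacement hM (ρ B) b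
    (r.cofibrant_cycles hM hA (-n))
  obtain ⟨e₂⟩ := nonempty_cohomologyInto_equiv_cohomologyFrom hM r hA r' b.fibrant n
  obtain ⟨e₃⟩ := nonempty_stableEquiv_cofibrantReplacement (ρ A) a
    (r'.fibrant_cycles hM b.fibrant n)
  -- First RQB is exchanged for RB while the source is the cofibrant Z⁻ⁿ. Balancing then moves the
  -- resolution to the second variable, where A enters only through RQA itself and can be exchanged
  -- for QA against the fibrant Zⁿ.
  exact ⟨(stableEquivInto hM r hA (ρ B).fibrant n).symm.trans (e₁.trans
    ((stableEquivInto hM r hA b.fibrant n).trans (e₂.trans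
      ((stableEquivFrom hM r' hA b.fibrant n).symm.trans (e₃.trans
        (stableEquivFrom hM r' a.cofibrant b.fibrant n))))))⟩

end AbelianModelStructure

/-! ### The isomorphisms of the theorem -/

theorem mainTheorem2 {C : Type u} [Category.{v} C] [Abelian C] [HasExt.{w} C]
    (M : AbelianModelStructure.{w} C) (hM : M.IsHereditary)
    (ρ : ∀ A : C, M.BifibrantReplacement A)
    {S : C → C} (s : ∀ X : C, M.TrivialSequence X (S X))
    {Λ : C → C} (l : ∀ X : C, M.TrivialSequence (Λ X) X)
    (res : ∀ A : C, M.Resolution A) (n : ℤ) :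
    -- `Ho(M)(Ωⁿ A, B) ≅ ℓExtⁿ(RQA, RQB)`, naturally in `A` and `B`
    Nonempty ((AbelianModelStructure.loopPow hM ρ s l n).op ⋙ preadditiveCoyoneda ≅
      AbelianModelStructure.lExt hM ρ res n) ∧
    -- `ℓExtⁿ(RQA, RQB) ≅ rExtⁿ(RQA, RQB)`, naturally in `A` and `B`
    Nonempty (AbelianModelStructure.lExt hM ρ res n ≅ AbelianModelStructure.rExt hM ρ res n) ∧
    -- `rExtⁿ(RQA, RQB) ≅ Ho(M)(A, Σⁿ B)`, naturally in `A` and `B`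
    Nonempty (AbelianModelStructure.rExt hM ρ res n ≅
      preadditiveCoyoneda ⋙ (Functor.whiskeringLeft _ _ _).obj
        (AbelianModelStructure.suspensionPow hM ρ s l n)) ∧
    -- these groups are computed by any canonical resolution and any canonical coresolution
    ∀ (A B : C) (a : M.CofibrantReplacement A) (b : M.FibrantReplacement B)
      (r : M.Resolution a.obj) (r' : M.Resolution b.obj),
      Nonempty (((preadditiveCoyoneda.obj (op ((AbelianModelStructure.loopPow hM ρ s l n).obj
          (AbelianModelStructure.hoObj ρ A)))).obj (AbelianModelStructure.hoObj ρ B)) ≅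
        ((cohomologyInto n).obj (op r.complex)).obj b.obj) ∧
      Nonempty (((preadditiveCoyoneda.obj (op (AbelianModelStructure.hoObj ρ A))).obj
          ((AbelianModelStructure.suspensionPow hM ρ s l n).obj
            (AbelianModelStructure.hoObj ρ B))) ≅
        ((cohomologyFrom n).obj (op a.obj)).obj r'.complex) := by
  refine ⟨⟨AbelianModelStructure.loopPowIsoLExt hM ρ res s l n⟩,
    ⟨AbelianModelStructure.lExtIsoRExt hM ρ res s l n⟩,
    ⟨AbelianModelStructure.rExtIsoSuspensionPow hM ρ res s l n⟩, fun A B a b r r' => ?_⟩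
  -- Both remaining groups are compared through Hⁿ Hom(QA, W^RB): e₁ reaches it from ℓExtⁿ, and e₂
  -- relates it to Hⁿ Hom(W_QA, RB).
  obtain ⟨e₁⟩ := AbelianModelStructure.nonempty_lExt_equiv hM ρ res n a b r'
  obtain ⟨e₂⟩ := AbelianModelStructure.nonempty_cohomologyInto_equiv_cohomologyFrom hM r
    a.cofibrant r' b.fibrant n
  let i := ((AbelianModelStructure.loopPowIsoLExt hM ρ res s l n).app
    (op (AbelianModelStructure.hoObj ρ A))).app (AbelianModelStructure.hoObj ρ B)
  let i' := ((AbelianModelStructure.lExtIsoRExt hM ρ res s l n ≪≫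
    AbelianModelStructure.rExtIsoSuspensionPow hM ρ res s l n).app
      (op (AbelianModelStructure.hoObj ρ A))).app (AbelianModelStructure.hoObj ρ B)
  exact ⟨⟨i ≪≫ e₁.toAddCommGrpIso ≪≫ e₂.symm.toAddCommGrpIso⟩,
    ⟨i'.symm ≪≫ e₁.toAddCommGrpIso⟩⟩
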